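/- Let $\mathbb{K}$ be a field of characteristic $0$ and let $I$ be a finite set. Fix a non-zero Laurent polynomial $\zeta_{ij}(x)\in\mathbb{K}[x^{\pm1}]$ for all $i\neq j$ in $I$, and a non-zero $\zeta_{ii}(x)\in\frac{\mathbb{K}[x^{\pm1}]}{1-x}$ for all $i\in I$; no other condition is imposed on the $\zeta_{ij}$. **The algebras $\widetilde{\mathbf U}^\pm$.** Let $\widetilde{\mathbf U}^+$ (respectively $\widetilde{\mathbf U}^-$) be the associative unital $\mathbb{K}$-algebra generated by symbols $e_{i,d}$ (respectively $f_{i,d}$), $i\in I$, $d\in\mathbb{Z}$, modulo the relations $$e_i(z)e_j(w)\,\zeta_{ji}\!\left(\tfrac wz\right)=e_j(w)e_i(z)\,\zeta_{ij}\!\left(\tfrac zw\right),\qquad\text{respectively}\qquad f_i(z)f_j(w)\,\zeta_{ij}\!\left(\tfrac zw\right)=f_j(w)f_i(z)\,\zeta_{ji}\!\left(\tfrac wz\right),$$ for all $i,j\in I$, where $e_i(z)=\sum_{d\in\mathbb{Z}}e_{i,d}z^{-d}$ and $f_i(z)=\sum_{d\in\mathbb{Z}}f_{i,d}z^{-d}$.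 The relations are understood by equating the coefficients of all monomials in $z,w$; if $i=j$, both sides are first multiplied by $z-w$. **The algebras $\mathcal V^\pm$.** Let $$\mathcal V^+=\mathcal V^-=\bigoplus_{\boldsymbol n=(n_i)\in\mathbb{N}^I}\mathbb{K}[z_{i1}^{\pm1},\dots,z_{in_i}^{\pm1}]_{i\in I}^{\mathrm{sym}}$$ as vector spaces, where sym denotes Laurent polynomials that are symmetric in $z_{i1},\dots,z_{in_i}$ for each $i$ separately. The product on $\mathcal V^+$ of $R$ of degree $\boldsymbol n$ and $R'$ of degree $\boldsymbol n'$ is $$R*R'=\mathrm{Sym}\left[\frac{R(\dots,z_{i1},\dots,z_{in_i},\dots)\,R'(\dots,z_{i,n_i+1},\dots,z_{i,n_i+n_i'},\dots)}{\prod_i n_i!\,\prod_i n_i'!}\ \prod_{i,j\in I}\ \prod_{\substack{1\le a\le n_i\\ n_j<b\le n_j+n_j'}}\zeta_{ij}\!\left(\frac{z_{ia}}{z_{jb}}\right)\right],$$ where Sym is the sum over all permutations in $\prod_i S(n_i+n'_i)$; in the product on $\mathcal V^-$, each $\zeta_{ij}(z_{ia}/z_{jb})$ is replaced by $\zeta_{ji}(z_{jb}/z_{ia})$.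 There are algebra homomorphisms $$\widetilde\Upsilon^\pm:\widetilde{\mathbf U}^\pm\to\mathcal V^\pm,\qquad e_{i,d},\,f_{i,d}\mapsto z_{i1}^d.$$ Put $K^\pm=\mathrm{Ker}\,\widetilde\Upsilon^\pm$ and $\mathbf U^\pm=\widetilde{\mathbf U}^\pm/K^\pm$. **The pairings.** There are bilinear pairings $\langle\cdot,\cdot\rangle:\widetilde{\mathbf U}^+\otimes\mathcal V^-\to\mathbb{K}$ and $\langle\cdot,\cdot\rangle:\mathcal V^+\otimes\widetilde{\mathbf U}^-\to\mathbb{K}$ such that, for $R^\pm\in\mathcal V^\pm$ of degree $\boldsymbol n$, $$\langle e_{i_1,d_1}\cdots e_{i_n,d_n},R^-\rangle=\mathrm{CT}_{|z_1|\gg\dots\gg|z_n|}\ \frac{z_1^{d_1}\cdots z_n^{d_n}\,R^-(z_1,\dots,z_n)}{\prod_{1\le a<b\le n}\zeta_{i_bi_a}(z_b/z_a)},$$ $$\langle R^+,f_{i_1,-d_1}\cdots f_{i_n,-d_n}\rangle=\mathrm{CT}_{|z_1|\ll\dots\ll|z_n|}\ \frac{z_1^{-d_1}\cdots z_n^{-d_n}\,R^+(z_1,\dots,z_n)}{\prod_{1\le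 a<b\le n}\zeta_{i_ai_b}(z_a/z_b)}$$ if $\#\{a: i_a=i\}=n_i$ for all $i\in I$, and both are $0$ otherwise. Here $\mathrm{CT}_{|z_1|\gg\dots\gg|z_n|}$ (respectively $\mathrm{CT}_{|z_1|\ll\dots\ll|z_n|}$) is the constant term of the expansion in $\frac{z_2}{z_1},\dots,\frac{z_n}{z_{n-1}}$ (respectively in $\frac{z_1}{z_2},\dots,\frac{z_{n-1}}{z_n}$), and in $R^\pm(z_1,\dots,z_n)$ the variable $z_a$ is plugged in for one of the variables $z_{i_a1},z_{i_a2},\dots$ of $R^\pm$, distinct $a$ for distinct variables (the choice does not matter by symmetry). Let $$\mathcal S^-=\{R\in\mathcal V^-:\langle K^+,R\rangle=0\},\qquad \mathcal S^+=\{R\in\mathcal V^+:\langle R,K^-\rangle=0\}.$$ **Theorem.** $\mathcal S^\pm=\mathrm{Im}\,\widetilde\Upsilon^\pm$, and this is the subalgebra of $\mathcal V^\pm$ generated by $\{z_{i1}^d\}_{i\in I,\,d\in\mathbb{Z}}$. Hence $\widetilde\Upsilon^\pm$ induces isomorphisms of algebras $\Upsilon^\pm:\mathbf U^\pm\xrightarrow{\sim}\mathcal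 S^\pm$. Moreover, the two pairings above descend to pairings $$\mathbf U^+\otimes\mathcal S^-\to\mathbb{K},\qquad \mathcal S^+\otimes\mathbf U^-\to\mathbb{K},$$ which are non-degenerate in both arguments and coincide under the isomorphisms, that is, $\langle u,\Upsilon^-(v)\rangle=\langle\Upsilon^+(u),v\rangle$ for all $u\in\mathbf U^+$, $v\in\mathbf U^-$. -/

import Mathlib

set_option linter.unusedSectionVars false

noncomputable section

namespace ShuffleAlgebra

/-- The value `p(x)` of a Laurent polynomial in one variable at an element `x` of a field. -/
def laurentEval {K F : Type*} [Field K] [Field F] [Algebra K F] (x : F)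
    (p : LaurentPolynomial K) : F :=
  p.coeff.sum fun k c => algebraMap K F c * x ^ k

/-- The datum `(ζ_{ij})_{i,j ∈ I}`: a non-zero Laurent polynomial `ζ_{ij}` for `i ≠ j`, and a
non-zero `ζ_{ii} ∈ K[x^{±1}] / (1 - x)`.  It is recorded through the numerators `num i j`, that is
`ζ_{ij}(x) = num i j (x) / (1 - x)^{δ_{ij}}`, see `ZetaDatum.eval`. -/
structure ZetaDatum (K I : Type*) [Field K] where
  num : I → I → LaurentPolynomial K
  num_ne_zero : ∀ i j, num i j ≠ 0

section Zeta

variable {K I F : Type*} [Field K] [DecidableEq I] [Field F] [Algebra K F]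

/-- The value `ζ_{ij}(x)` of the rational function `ζ_{ij}` at an element of a field. -/
def ZetaDatum.eval (ζ : ZetaDatum K I) (i j : I) (x : F) : F :=
  laurentEval x (ζ.num i j) / (if i = j then 1 - x else 1)

lemma laurentEval_eq_lift {x : F} (hx : x ≠ 0) (p : LaurentPolynomial K) :
    laurentEval x p = AddMonoidAlgebra.lift K F ℤ
      ((Units.coeHom F).comp (zpowersHom Fˣ (Units.mk0 x hx))) p := by
  rw [AddMonoidAlgebra.lift_apply']
  simp only [laurentEval]
  refine Finsupp.sum_congr fun k _ => ?_
  simp [zpowersHom_apply]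

lemma laurentEval_mul {x : F} (hx : x ≠ 0) (p q : LaurentPolynomial K) :
    laurentEval x (p * q) = laurentEval x p * laurentEval x q := by
  simp [laurentEval_eq_lift hx]

lemma laurentEval_neg (x : F) (p : LaurentPolynomial K) :
    laurentEval x (-p) = - laurentEval x p := by
  simp only [laurentEval, AddMonoidAlgebra.coeff_neg]
  rw [Finsupp.sum_neg_index (by simp)]
  simp [Finsupp.sum]

lemma laurentEval_T (x : F) (k : ℤ) :
    laurentEval x (LaurentPolynomial.T k : LaurentPolynomial K) = x ^ k := by
  unfold laurentEval LaurentPolynomial.T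
  rw [AddMonoidAlgebra.coeff_single, Finsupp.sum_single_index (by simp)]
  simp

lemma laurentEval_invert (x : F) (p : LaurentPolynomial K) :
    laurentEval x (LaurentPolynomial.invert p) = laurentEval x⁻¹ p := by
  have h : (LaurentPolynomial.invert p).coeff = p.coeff.mapDomain (fun k => -k) := by
    ext k
    rw [LaurentPolynomial.invert_apply]
    have := Finsupp.mapDomain_apply (f := fun k : ℤ => -k) neg_injective p.coeff (-k)
    simpa using this.symm
  rw [laurentEval, h, Finsupp.sum_mapDomain_index (by simp) (by intros; simp [add_mul])]
  simp [laurentEval]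

/-- The opposite datum `ζ^{op}_{ij}(x) = ζ_{ji}(x⁻¹)`, see `ZetaDatum.op_eval`. -/
def ZetaDatum.op (ζ : ZetaDatum K I) : ZetaDatum K I where
  num i j := (if i = j then -LaurentPolynomial.T 1 else 1) * LaurentPolynomial.invert (ζ.num j i)
  num_ne_zero i j := by
    refine mul_ne_zero ?_ ?_
    · split_ifs
      · refine neg_ne_zero.mpr ?_
        exact (LaurentPolynomial.isUnit_T 1).ne_zero
      · exact one_ne_zero
    · simpa using ζ.num_ne_zero j i

lemma ZetaDatum.op_eval (ζ : ZetaDatum K I) (i j : I) {x : F} (hx : x ≠ 0) :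
    ζ.op.eval i j x = ζ.eval j i x⁻¹ := by
  unfold ZetaDatum.eval ZetaDatum.op
  by_cases h : i = j
  · subst h
    simp only [if_true]
    rw [laurentEval_mul hx, laurentEval_neg, laurentEval_T, laurentEval_invert, zpow_one]
    by_cases h1 : x = 1
    · subst h1; simp
    · have : 1 - x ≠ 0 := fun h => h1 (sub_eq_zero.mp h).symm
      have h2 : 1 - x⁻¹ ≠ 0 := fun h => h1 (by
        have := (sub_eq_zero.mp h); rw [eq_comm, inv_eq_one] at this; exact this)
      have h3 : x - 1 ≠ 0 := sub_ne_zero.mpr h1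
      field_simp
      ring
  · simp only [h, Ne.symm h, if_false]
    rw [one_mul, laurentEval_invert]

end Zeta

section Big

/-- The ring of Laurent polynomials over `K` in the variables `z_{ia}`, `(i, a) ∈ I × ℕ` (so the
variable that is usually called `z_{i1}` is the one with index `(i, 0)`). -/
abbrev Laurent (K I : Type*) [Field K] := AddMonoidAlgebra K (I × ℕ →₀ ℤ)

/-- The field of rational functions over `K` in the variables `z_{ia}`. -/
abbrev Rational (K I : Type*) [Field K] := FractionRing (Laurent K I)

variable {K I : Type*} [Field K]

variable (K) in
/-- The variable `z_x`. -/
def z (x : I × ℕ) : Laurent K I := AddMonoidAlgebra.single (Finsupp.single x 1) 1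

variable (K) in
/-- The variable `z_x`, as a rational function. -/
def rz (x : I × ℕ) : Rational K I := algebraMap (Laurent K I) (Rational K I) (z K x)

variable (K) in
/-- The substitution `z_x ↦ z_{f x}` on Laurent polynomials. -/
def subst (f : I × ℕ → I × ℕ) : Laurent K I →ₐ[K] Laurent K I :=
  AddMonoidAlgebra.mapDomainAlgHom K K (Finsupp.mapDomain.addMonoidHom f)

lemma subst_single (f : I × ℕ → I × ℕ) (m : I × ℕ →₀ ℤ) (c : K) :
    subst K f (AddMonoidAlgebra.single m c) = AddMonoidAlgebra.single (m.mapDomain f) c := by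
  simp [subst]

lemma subst_injective {f : I × ℕ → I × ℕ} (hf : Function.Injective f) :
    Function.Injective (subst K f) := by
  intro a b h
  exact AddMonoidAlgebra.mapDomain_injective (R := K) (Finsupp.mapDomain_injective hf) h

variable (K) in
/-- The substitution `z_x ↦ z_{f x}` on rational functions, for an injective map `f`. -/
def ratSubst (f : I × ℕ ↪ I × ℕ) : Rational K I →ₐ[K] Rational K I :=
  IsFractionRing.liftAlgHom (R := K) (A := Laurent K I) (K := Rational K I)
    (g := (IsScalarTower.toAlgHom K (Laurent K I) (Rational K I)).comp (subst K f))
    ((IsFractionRing.injective (Laurent K I) (Rational K I)).comp (subst_injective f.injective))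

/-- The finite set of the variables `z_{ia}`, `i ∈ I`, `1 ≤ a ≤ n_i`. -/
def box [Fintype I] (n : I → ℕ) : Finset (I × ℕ) :=
  (Finset.univ.sigma fun i => Finset.range (n i)).map (Equiv.sigmaEquivProd I ℕ).toEmbedding

/-- The group `∏_i S(n_i)`, permuting for each `i` the variables `z_{i1}, …, z_{in_i}`. -/
def colorPerm (n : I → ℕ) : Subgroup (Equiv.Perm (I × ℕ)) where
  carrier := {σ | (∀ x, (σ x).1 = x.1) ∧ ∀ x : I × ℕ, n x.1 ≤ x.2 → σ x = x}
  mul_mem' := by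
    rintro σ τ ⟨h1, h2⟩ ⟨h3, h4⟩
    refine ⟨fun x => by simp [h1, h3], fun x hx => by simp [h4 x hx, h2 x hx]⟩
  one_mem' := by simp
  inv_mem' := by
    rintro σ ⟨h1, h2⟩
    refine ⟨fun x => ?_, fun x hx => ?_⟩
    · have := h1 (σ⁻¹ x); simpa using this.symm
    · rw [Equiv.Perm.inv_eq_iff_eq, h2 x hx]

/-- The space `K[z_{i1}^{±1}, …, z_{in_i}^{±1}]_{i ∈ I}^{sym}` of Laurent polynomials in the
variables `z_{ia}` with `a ≤ n_i` that are symmetric in `z_{i1}, …, z_{in_i}` for each `i`. -/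
def symLaurent (K : Type*) {I : Type*} [Field K] (n : I → ℕ) : Submodule K (Laurent K I) where
  carrier := {P | (∀ m ∈ P.coeff.support, ∀ x : I × ℕ, n x.1 ≤ x.2 → m x = 0) ∧
    ∀ σ ∈ colorPerm n, subst K σ P = P}
  add_mem' := by
    classical
    rintro P Q ⟨h1, h2⟩ ⟨h3, h4⟩
    refine ⟨fun m hm x hx => ?_, fun σ hσ => by rw [map_add, h2 σ hσ, h4 σ hσ]⟩
    rw [AddMonoidAlgebra.coeff_add] at hm
    rcases Finset.mem_union.mp (Finsupp.support_add hm) with h | h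
    · exact h1 m h x hx
    · exact h3 m h x hx
  zero_mem' := by simp
  smul_mem' := by
    rintro c P ⟨h1, h2⟩
    refine ⟨fun m hm x hx => ?_, fun σ hσ => by rw [map_smul, h2 σ hσ]⟩
    rw [AddMonoidAlgebra.coeff_smul] at hm
    exact h1 m (Finsupp.support_smul hm) x hx

variable [Fintype I] [DecidableEq I]

lemma mem_box {n : I → ℕ} {x : I × ℕ} : x ∈ box n ↔ x.2 < n x.1 := by
  obtain ⟨i, a⟩ := x
  simp [box]

lemma colorPerm_mem_box {n : I → ℕ} {σ : Equiv.Perm (I × ℕ)} (hσ : σ ∈ colorPerm n) (x : I × ℕ) :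
    (σ x).2 < n (σ x).1 ↔ x.2 < n x.1 := by
  by_cases h : n x.1 ≤ x.2
  · rw [hσ.2 x h]
  · refine ⟨fun _ => not_le.mp h, fun _ => ?_⟩
    by_contra h'
    have := hσ.2 (σ x) (not_lt.mp h')
    have := σ.injective this
    rw [this] at h'
    exact h (not_lt.mp h')

/-- `colorPerm n` as permutations of a finite set. -/
def colorPermEquiv (n : I → ℕ) : colorPerm n ≃
    {g : Equiv.Perm {x // x ∈ box n} // (fun x => x.1.1) ∘ g = fun x => x.1.1} where
  toFun σ := ⟨σ.1.subtypePerm fun x => by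
    rw [mem_box, mem_box, colorPerm_mem_box σ.2], by
    ext x; simp [σ.2.1]⟩
  invFun g := ⟨Equiv.Perm.ofSubtype g.1, by
    refine ⟨fun x => ?_, fun x hx => ?_⟩
    · by_cases h : x ∈ box n
      · rw [Equiv.Perm.ofSubtype_apply_of_mem _ h]
        exact congrFun g.2 ⟨x, h⟩
      · rw [Equiv.Perm.ofSubtype_apply_of_not_mem _ h]
    · exact Equiv.Perm.ofSubtype_apply_of_not_mem _ (by rw [mem_box]; omega)⟩
  left_inv σ := by
    apply Subtype.ext
    refine Equiv.Perm.ofSubtype_subtypePerm (fun x => by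
      rw [mem_box, mem_box, colorPerm_mem_box σ.2]) fun x hx => ?_
    rw [mem_box]
    by_contra h
    exact hx (σ.2.2 x (not_lt.mp h))
  right_inv g := by
    apply Subtype.ext
    exact Equiv.Perm.subtypePerm_ofSubtype g.1

instance (n : I → ℕ) : Fintype (colorPerm n) := Fintype.ofEquiv _ (colorPermEquiv n).symm

lemma card_colorPerm (n : I → ℕ) : Fintype.card (colorPerm n) = ∏ i, (n i).factorial := by
  rw [Fintype.card_congr (colorPermEquiv n), DomMulAct.stabilizer_card]
  refine Finset.prod_congr rfl fun i _ => ?_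
  congr 1
  have e : {a : {x // x ∈ box n} // a.1.1 = i} ≃ Fin (n i) :=
    { toFun := fun a => ⟨a.1.1.2, by have := mem_box.mp a.1.2; rw [a.2] at this; exact this⟩
      invFun := fun a => ⟨⟨(i, a), mem_box.mpr a.2⟩, rfl⟩
      left_inv := by rintro ⟨⟨⟨j, a⟩, h⟩, rfl⟩; rfl
      right_inv := by intro a; rfl }
  rw [Fintype.card_congr e, Fintype.card_fin]

/-- Symmetrization (the sum over all permutations) with respect to the variables
`z_{i1}, …, z_{in_i}` for each `i` separately. -/
def sym (n : I → ℕ) (F : Rational K I) : Rational K I :=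
  ∑ σ : colorPerm n, ratSubst K (σ : Equiv.Perm (I × ℕ)).toEmbedding F

/-- The shift of indices `z_{ia} ↦ z_{i, n_i + a}`. -/
def shift (n : I → ℕ) : I × ℕ ↪ I × ℕ where
  toFun x := (x.1, n x.1 + x.2)
  inj' := by
    rintro ⟨i, a⟩ ⟨j, b⟩ h
    simp only [Prod.mk.injEq] at h
    obtain ⟨rfl, h⟩ := h
    simpa using h

/-- The product of all `ζ_{ij}(z_{ia} / z_{jb})`, over `(i, a) ∈ A` and `(j, b) ∈ B`. -/
def cross (ζ : ZetaDatum K I) (A B : Finset (I × ℕ)) : Rational K I :=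
  ∏ x ∈ A, ∏ y ∈ B, ζ.eval x.1 y.1 (rz K x / rz K y)

/-- The shuffle product of two Laurent polynomials in the variables `z_{ia}`, `a ≤ n_i`, and
`z_{ia}`, `a ≤ n'_i`, respectively, as a rational function:
`Sym [ R(z_{i1}, …, z_{in_i}) R'(z_{i,n_i+1}, …, z_{i,n_i+n'_i}) / (n! n'!)
∏_{1 ≤ a ≤ n_i, n_j < b ≤ n_j + n'_j} ζ_{ij}(z_{ia} / z_{jb}) ]`. -/
def ratShuffle (ζ : ZetaDatum K I) (n n' : I → ℕ) (R R' : Laurent K I) : Rational K I :=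
  sym (n + n')
    ((((∏ i, (n i).factorial) * (∏ i, (n' i).factorial) : ℕ) : K)⁻¹ •
      (algebraMap (Laurent K I) (Rational K I) R *
        algebraMap (Laurent K I) (Rational K I) (subst K (shift n) R') *
        cross ζ (box n) (box (n + n') \ box n)))

end Big

section SymLemmas

variable {K I : Type*} [Field K]

local notation "ι" => algebraMap (Laurent K I) (Rational K I)

lemma ratSubst_algebraMap (f : I × ℕ ↪ I × ℕ) (P : Laurent K I) :
    ratSubst K f (ι P) = ι (subst K f P) := by
  exact IsFractionRing.lift_algebraMap
    (g := ((IsScalarTower.toAlgHom K (Laurent K I) (Rational K I)).comp (subst K f)).toRingHom)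
    ((IsFractionRing.injective (Laurent K I) (Rational K I)).comp (subst_injective f.injective)) P

lemma subst_subst (f g : I × ℕ → I × ℕ) (P : Laurent K I) :
    subst K f (subst K g P) = subst K (f ∘ g) P := by
  induction P using AddMonoidAlgebra.induction_linear with
  | zero => simp
  | add P Q hP hQ => simp [hP, hQ]
  | single m c => rw [subst_single, subst_single, subst_single, Finsupp.mapDomain_comp]

lemma ratSubst_ratSubst (f g : I × ℕ ↪ I × ℕ) (F : Rational K I) :
    ratSubst K f (ratSubst K g F) = ratSubst K (g.trans f) F := by
  obtain ⟨a, b, -, rfl⟩ := IsFractionRing.div_surjective (A := Laurent K I) F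
  simp only [map_div₀, ratSubst_algebraMap, subst_subst]
  rfl

lemma ratSubst_rz (f : I × ℕ ↪ I × ℕ) (x : I × ℕ) : ratSubst K f (rz K x) = rz K (f x) := by
  rw [rz, ratSubst_algebraMap, z, subst_single, Finsupp.mapDomain_single]
  rfl

lemma z_ne_zero (x : I × ℕ) : z K x ≠ 0 := by
  intro h
  have := congrArg (fun P => AddMonoidAlgebra.coeff P (Finsupp.single x 1)) h
  simp [z] at this

lemma rz_ne_zero (x : I × ℕ) : rz K x ≠ 0 := by
  rw [rz, Ne, IsFractionRing.to_map_eq_zero_iff]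
  exact z_ne_zero x

lemma map_laurentEval {F F' : Type*} [Field F] [Algebra K F] [Field F'] [Algebra K F']
    (g : F →ₐ[K] F') (x : F) (p : LaurentPolynomial K) :
    g (laurentEval x p) = laurentEval (g x) p := by
  simp [laurentEval, Finsupp.sum]

lemma subst_congr {n : I → ℕ} {P : Laurent K I} (hP : P ∈ symLaurent K n)
    {f g : I × ℕ → I × ℕ} (h : ∀ x : I × ℕ, x.2 < n x.1 → f x = g x) :
    subst K f P = subst K g P := by
  change AddMonoidAlgebra.mapDomain _ _ = AddMonoidAlgebra.mapDomain _ _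
  unfold AddMonoidAlgebra.mapDomain
  congr 1
  refine Finsupp.mapDomain_congr fun m hm => ?_
  refine Finsupp.mapDomain_congr fun x hx => h x ?_
  by_contra h'
  exact (Finsupp.mem_support_iff.mp hx) (hP.1 m hm x (not_lt.mp h'))

lemma subst_id (P : Laurent K I) : subst K id P = P := by
  induction P using AddMonoidAlgebra.induction_linear with
  | zero => simp
  | add P Q hP hQ => simp [hP, hQ]
  | single m c => rw [subst_single, Finsupp.mapDomain_id]

variable [Fintype I] [DecidableEq I]

lemma map_zeta {F F' : Type*} [Field F] [Algebra K F] [Field F'] [Algebra K F']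
    (g : F →ₐ[K] F') (ζ : ZetaDatum K I) (i j : I) (x : F) :
    g (ζ.eval i j x) = ζ.eval i j (g x) := by
  unfold ZetaDatum.eval
  rw [map_div₀, map_laurentEval]
  split_ifs <;> simp

lemma ratSubst_cross (ζ : ZetaDatum K I) (f : I × ℕ ↪ I × ℕ) (hf : ∀ x, (f x).1 = x.1)
    (A B : Finset (I × ℕ)) :
    ratSubst K f (cross ζ A B) = cross ζ (A.map f) (B.map f) := by
  simp [cross, map_prod, map_zeta, ratSubst_rz, hf]

lemma ratSubst_sym {n : I → ℕ} {σ : Equiv.Perm (I × ℕ)} (hσ : σ ∈ colorPerm n)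
    (F : Rational K I) : ratSubst K σ.toEmbedding (sym n F) = sym n F := by
  unfold sym
  rw [map_sum]
  refine Fintype.sum_equiv (Equiv.mulLeft (⟨σ, hσ⟩ : colorPerm n)) _ _ fun τ => ?_
  rw [ratSubst_ratSubst]
  rfl

lemma sym_ratSubst {n : I → ℕ} {σ : Equiv.Perm (I × ℕ)} (hσ : σ ∈ colorPerm n)
    (F : Rational K I) : sym n (ratSubst K σ.toEmbedding F) = sym n F := by
  unfold sym
  refine Fintype.sum_equiv (Equiv.mulRight (⟨σ, hσ⟩ : colorPerm n)) _ _ fun τ => ?_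
  rw [ratSubst_ratSubst]
  rfl

lemma sym_add (n : I → ℕ) (F G : Rational K I) : sym n (F + G) = sym n F + sym n G := by
  simp [sym, Finset.sum_add_distrib]

lemma sym_smul (n : I → ℕ) (c : K) (F : Rational K I) : sym n (c • F) = c • sym n F := by
  simp [sym, Finset.smul_sum]

lemma sym_sum {α : Type*} (s : Finset α) (n : I → ℕ) (F : α → Rational K I) :
    sym n (∑ a ∈ s, F a) = ∑ a ∈ s, sym n (F a) := by
  simp only [sym, map_sum]
  exact Finset.sum_comm

lemma sym_zero (n : I → ℕ) : sym n (0 : Rational K I) = 0 := by simp [sym]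

lemma sym_neg (n : I → ℕ) (F : Rational K I) : sym n (-F) = - sym n F := by
  simp [sym]

lemma mul_sym {n : I → ℕ} (F G : Rational K I)
    (hF : ∀ σ ∈ colorPerm n, ratSubst K σ.toEmbedding F = F) :
    F * sym n G = sym n (F * G) := by
  unfold sym
  rw [Finset.mul_sum]
  refine Finset.sum_congr rfl fun σ _ => ?_
  rw [map_mul, hF σ σ.2]

lemma sym_sum_ratSubst {α : Type*} [Fintype α] {n : I → ℕ} (h : α → Equiv.Perm (I × ℕ))
    (hh : ∀ a, h a ∈ colorPerm n) (F : Rational K I) :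
    sym n (∑ a, ratSubst K (h a).toEmbedding F) = (Fintype.card α : K) • sym n F := by
  rw [sym_sum]
  simp only [sym_ratSubst (hh _)]
  rw [Finset.sum_const, Finset.card_univ, Nat.cast_smul_eq_nsmul]

lemma sym_of_invariant {n : I → ℕ} (F : Rational K I)
    (hF : ∀ σ ∈ colorPerm n, ratSubst K σ.toEmbedding F = F) :
    sym n F = ((∏ i, (n i).factorial : ℕ) : K) • F := by
  unfold sym
  simp only [hF _ (Subtype.prop _)]
  rw [Finset.sum_const, Finset.card_univ, card_colorPerm, Nat.cast_smul_eq_nsmul]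

lemma colorPerm_mono {n m : I → ℕ} (h : n ≤ m) : colorPerm n ≤ colorPerm m :=
  fun _ hσ => ⟨hσ.1, fun x hx => hσ.2 x ((h x.1).trans hx)⟩

lemma box_map_perm {n : I → ℕ} {σ : Equiv.Perm (I × ℕ)} (hσ : σ ∈ colorPerm n) :
    (box n).map σ.toEmbedding = box n := by
  ext x
  simp only [Finset.mem_map_equiv, mem_box]
  have := colorPerm_mem_box hσ (σ.symm x)
  rw [Equiv.apply_symm_apply] at this
  exact this.symm

lemma map_eq_self {A : Finset (I × ℕ)} {f : I × ℕ ↪ I × ℕ} (h : ∀ x ∈ A, f x = x) :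
    A.map f = A := by
  rw [Finset.map_eq_image]
  refine (Finset.image_congr fun x hx => h x hx).trans Finset.image_id

lemma shift_apply (n : I → ℕ) (x : I × ℕ) : shift n x = (x.1, n x.1 + x.2) := rfl

lemma box_map_shift (n n' : I → ℕ) : (box n').map (shift n) = box (n + n') \ box n := by
  ext ⟨i, a⟩
  simp only [Finset.mem_map, mem_box, Finset.mem_sdiff, shift_apply, Prod.exists, Prod.mk.injEq,
    Pi.add_apply]
  constructor
  · rintro ⟨j, b, h, rfl, rfl⟩; omega
  · rintro ⟨h1, h2⟩; exact ⟨i, a - n i, by omega, rfl, by omega⟩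

lemma box_mono {n m : I → ℕ} (h : n ≤ m) : box n ⊆ box m := by
  intro x hx
  rw [mem_box] at *
  exact lt_of_lt_of_le hx (h _)

lemma cross_union_left (ζ : ZetaDatum K I) {A B C : Finset (I × ℕ)} (h : Disjoint A B) :
    cross ζ (A ∪ B) C = cross ζ A C * cross ζ B C := by
  rw [cross, Finset.prod_union h]; rfl

lemma cross_union_right (ζ : ZetaDatum K I) {A B C : Finset (I × ℕ)} (h : Disjoint B C) :
    cross ζ A (B ∪ C) = cross ζ A B * cross ζ A C := by
  simp only [cross, Finset.prod_union h, Finset.prod_mul_distrib]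

variable [CharZero K]

lemma factorial_ne_zero (n : I → ℕ) : ((∏ i, (n i).factorial : ℕ) : K) ≠ 0 :=
  Nat.cast_ne_zero.mpr (Finset.prod_ne_zero_iff.mpr fun _ _ => Nat.factorial_ne_zero _)

lemma ratShuffle_assoc_left (ζ : ZetaDatum K I) (n n' n'' : I → ℕ) (R R' R'' P : Laurent K I)
    (hP : ι P = ratShuffle ζ n n' R R') :
    ratShuffle ζ (n + n') n'' P R'' =
      (((∏ i, (n i).factorial) * (∏ i, (n' i).factorial) * (∏ i, (n'' i).factorial) : ℕ) : K)⁻¹ •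
      sym (n + n' + n'') (ι R * ι (subst K (shift n) R') * ι (subst K (shift (n + n')) R'') *
        (cross ζ (box n) (box (n + n') \ box n) *
          (cross ζ (box n) (box (n + n' + n'') \ box (n + n')) *
          cross ζ (box (n + n') \ box n) (box (n + n' + n'') \ box (n + n'))))) := by
  have hu : box (n + n') = box n ∪ (box (n + n') \ box n) :=
    (Finset.union_sdiff_of_subset (box_mono (by intro _; simp))).symm
  unfold ratShuffle at hP ⊢
  rw [hP, sym_smul, sym_smul]
  set Z := cross ζ (box n) (box (n + n') \ box n)
  set W := cross ζ (box (n + n')) (box (n + n' + n'') \ box (n + n')) with hW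
  have hW' : W = cross ζ (box n) (box (n + n' + n'') \ box (n + n')) *
          cross ζ (box (n + n') \ box n) (box (n + n' + n'') \ box (n + n')) := by
    rw [← cross_union_left ζ Finset.disjoint_sdiff, ← hu]
  rw [← hW']
  have hinv : ∀ σ ∈ colorPerm (n + n'), ratSubst K σ.toEmbedding
      (ι (subst K (shift (n + n')) R'') * W) = ι (subst K (shift (n + n')) R'') * W := by
    intro σ hσ
    rw [map_mul, ratSubst_algebraMap, subst_subst, hW, ratSubst_cross ζ _ hσ.1, box_map_perm hσ]
    congr 3
    · have : (σ.toEmbedding : I × ℕ → I × ℕ) ∘ shift (n + n') = shift (n + n') := by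
        funext x
        exact hσ.2 _ (by simp [shift_apply])
      rw [this]
    · refine map_eq_self fun x hx => hσ.2 _ ?_
      rw [Finset.mem_sdiff, mem_box, mem_box] at hx
      omega
  have : ∀ G : Rational K I, sym (n + n') G * ι (subst K (shift (n + n')) R'') * W =
      ∑ σ : colorPerm (n + n'), ratSubst K (σ : Equiv.Perm (I × ℕ)).toEmbedding
        (G * ι (subst K (shift (n + n')) R'') * W) := by
    intro G
    rw [mul_assoc, mul_comm, mul_sym _ _ hinv]
    simp only [sym, mul_comm, mul_left_comm]
  rw [smul_mul_assoc, smul_mul_assoc, this, sym_smul, sym_sum_ratSubst (fun σ : colorPerm (n + n') => σ.1)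
    (fun σ => colorPerm_mono (by intro i; simp) σ.2), smul_smul, smul_smul, card_colorPerm]
  congr 1
  · have h1 := factorial_ne_zero (K := K) (n + n')
    have h2 := factorial_ne_zero (K := K) n
    have h3 := factorial_ne_zero (K := K) n'
    have h4 := factorial_ne_zero (K := K) n''
    simp only [Nat.cast_mul]
    field_simp
  · congr 1; ring

lemma viaEmbedding_mem {n m : I → ℕ} {σ : Equiv.Perm (I × ℕ)} (hσ : σ ∈ colorPerm m) :
    σ.viaEmbedding (shift n) ∈ colorPerm (n + m) ∧
    ∀ x : I × ℕ, x.2 < n x.1 → σ.viaEmbedding (shift n) x = x := by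
  have key : ∀ x : I × ℕ, x.2 < n x.1 → σ.viaEmbedding (shift n) x = x := by
    intro x hx
    refine Equiv.Perm.viaEmbedding_apply_of_notMem _ _ _ ?_
    rintro ⟨y, rfl⟩
    simp [shift_apply] at hx
  have key2 : ∀ x : I × ℕ, n x.1 ≤ x.2 → x = shift n (x.1, x.2 - n x.1) := by
    intro x hx
    rw [shift_apply]
    ext <;> simp
    omega
  refine ⟨⟨fun x => ?_, fun x hx => ?_⟩, key⟩
  · rcases lt_or_ge x.2 (n x.1) with h | h
    · rw [key x h]
    · rw [key2 x h, Equiv.Perm.viaEmbedding_apply]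
      exact hσ.1 _
  · have h : n x.1 ≤ x.2 := le_trans (by simp) hx
    rw [key2 x h, Equiv.Perm.viaEmbedding_apply, hσ.2]
    simp only [Pi.add_apply] at hx ⊢
    omega

lemma ratShuffle_assoc_right (ζ : ZetaDatum K I) (n n' n'' : I → ℕ) (R R' R'' Q : Laurent K I)
    (hR : R ∈ symLaurent K n) (hQ : ι Q = ratShuffle ζ n' n'' R' R'') :
    ratShuffle ζ n (n' + n'') R Q =
      (((∏ i, (n i).factorial) * (∏ i, (n' i).factorial) * (∏ i, (n'' i).factorial) : ℕ) : K)⁻¹ •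
      sym (n + n' + n'') (ι R * ι (subst K (shift n) R') * ι (subst K (shift (n + n')) R'') *
        (cross ζ (box n) (box (n + n') \ box n) *
          (cross ζ (box n) (box (n + n' + n'') \ box (n + n')) *
          cross ζ (box (n + n') \ box n) (box (n + n' + n'') \ box (n + n'))))) := by
  have hshift : ∀ x, (shift n x).1 = x.1 := fun x => rfl
  unfold ratShuffle at hQ ⊢
  rw [← ratSubst_algebraMap, hQ, sym_smul, sym_smul, map_smul, sym.eq_def (n' + n''), map_sum,
    ← add_assoc]
  have hu : box (n + n' + n'') \ box n =
      (box (n + n') \ box n) ∪ (box (n + n' + n'') \ box (n + n')) := by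
    have h1 : box n ⊆ box (n + n') := box_mono fun _ => by simp
    have h2 : box (n + n') ⊆ box (n + n' + n'') := box_mono fun _ => by simp
    ext x
    have := @h1 x
    have := @h2 x
    simp only [Finset.mem_union, Finset.mem_sdiff]
    tauto
  have hd : Disjoint (box (n + n') \ box n) (box (n + n' + n'') \ box (n + n')) := by
    rw [Finset.disjoint_left]
    intro x hx hx'
    exact (Finset.mem_sdiff.mp hx').2 (Finset.mem_sdiff.mp hx).1
  set W := cross ζ (box n) (box (n + n' + n'') \ box n) with hW
  have hcomm : ∀ (σ : Equiv.Perm (I × ℕ)) (G : Rational K I),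
      ratSubst K (shift n) (ratSubst K σ.toEmbedding G) =
      ratSubst K (σ.viaEmbedding (shift n)).toEmbedding (ratSubst K (shift n) G) := by
    intro σ G
    rw [ratSubst_ratSubst, ratSubst_ratSubst]
    congr 1
    have : σ.toEmbedding.trans (shift n) =
        (shift n).trans (σ.viaEmbedding (shift n)).toEmbedding := by
      ext x : 1
      exact (Equiv.Perm.viaEmbedding_apply σ (shift n) x).symm
    rw [this]
  have hinv : ∀ σ ∈ colorPerm (n' + n''),
      ratSubst K (σ.viaEmbedding (shift n)).toEmbedding (ι R * W) = ι R * W := by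
    intro σ hσ
    obtain ⟨h1, h2⟩ := viaEmbedding_mem (n := n) hσ
    rw [map_mul, ratSubst_algebraMap, hW, ratSubst_cross ζ _ h1.1]
    congr 2
    · refine (subst_congr hR (g := id) fun x hx => ?_).trans (subst_id R)
      exact h2 x hx
    · refine map_eq_self fun x hx => h2 x (mem_box.mp hx)
    · have hbn : (box n).map (σ.viaEmbedding (shift n)).toEmbedding = box n :=
        map_eq_self fun x hx => h2 x (mem_box.mp hx)
      rw [Finset.map_sdiff, hbn, add_assoc, box_map_perm h1]
  have : ∀ G : Rational K I, ι R * (∑ σ : colorPerm (n' + n''), ratSubst K (shift n)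
      (ratSubst K (σ : Equiv.Perm (I × ℕ)).toEmbedding G)) * W =
      ∑ σ : colorPerm (n' + n''),
        ratSubst K ((σ : Equiv.Perm (I × ℕ)).viaEmbedding (shift n)).toEmbedding
        (ι R * W * ratSubst K (shift n) G) := by
    intro G
    rw [mul_right_comm, Finset.mul_sum]
    refine Finset.sum_congr rfl fun σ _ => ?_
    rw [map_mul, hinv σ σ.2, hcomm]
  rw [mul_smul_comm, smul_mul_assoc, this, sym_smul, sym_sum_ratSubst
    (fun σ : colorPerm (n' + n'') => (σ : Equiv.Perm (I × ℕ)).viaEmbedding (shift n))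
    (fun σ => by rw [add_assoc]; exact (viaEmbedding_mem (n := n) σ.2).1), smul_smul, smul_smul,
    card_colorPerm]
  congr 1
  · have h1 := factorial_ne_zero (K := K) (n' + n'')
    have h2 := factorial_ne_zero (K := K) n
    have h3 := factorial_ne_zero (K := K) n'
    have h4 := factorial_ne_zero (K := K) n''
    simp only [Nat.cast_mul]
    field_simp
  · congr 1
    rw [map_mul, map_mul, ratSubst_algebraMap, ratSubst_algebraMap, subst_subst,
      ratSubst_cross ζ _ hshift, box_map_shift, Finset.map_sdiff, box_map_shift, box_map_shift,
      ← add_assoc, hW, hu, cross_union_right ζ hd]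
    have e1 : (shift n : I × ℕ → I × ℕ) ∘ shift n' = shift (n + n') := by
      funext x
      simp [shift_apply, add_assoc]
    have e2 : (box (n + n' + n'') \ box n) \ (box (n + n') \ box n) =
        box (n + n' + n'') \ box (n + n') := by
      have h1 : box n ⊆ box (n + n') := box_mono fun _ => by simp
      ext x
      have := @h1 x
      simp only [Finset.mem_sdiff]
      tauto
    rw [e1, ← hu, e2]
    ring

end SymLemmas

section Closure

variable {K I : Type*} [Field K]

local notation "ι" => algebraMap (Laurent K I) (Rational K I)

lemma iota_injective : Function.Injective ι := IsFractionRing.injective _ _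

lemma subst_z (f : I × ℕ → I × ℕ) (x : I × ℕ) : subst K f (z K x) = z K (f x) := by
  rw [z, subst_single, Finsupp.mapDomain_single]; rfl

lemma z_injective {x y : I × ℕ} (h : z K x = z K y) : x = y := by
  have := congrArg (fun P => AddMonoidAlgebra.coeff P (Finsupp.single x 1)) h
  simp only [z, AddMonoidAlgebra.coeff_single, Finsupp.single_eq_same] at this
  by_contra hne
  rw [Finsupp.single_eq_of_ne] at this
  · exact one_ne_zero this
  · intro h'
    exact hne (Finsupp.single_left_injective one_ne_zero h')

/-- A monomial, as a homomorphism from exponents to a quotient ring. -/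
def monHom (J : Ideal (Laurent K I)) (f : I × ℕ → I × ℕ) :
    (I × ℕ →₀ ℤ) →+ Additive (Laurent K I ⧸ J) where
  toFun m := Additive.ofMul (Ideal.Quotient.mk J (subst K f (AddMonoidAlgebra.single m 1)))
  map_zero' := by
    rw [← AddMonoidAlgebra.one_def, map_one, map_one]; rfl
  map_add' m m' := by
    rw [← mul_one (1 : K), ← AddMonoidAlgebra.single_mul_single, map_mul, map_mul, mul_one]; rfl

lemma dvd_of_spec [DecidableEq I] {x y : I × ℕ} {P : Laurent K I}
    (h : subst K (Function.update id x y) P = 0) : z K x - z K y ∣ P := by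
  set J : Ideal (Laurent K I) := Ideal.span {z K x - z K y}
  have hxy : Ideal.Quotient.mk J (z K x) = Ideal.Quotient.mk J (z K y) :=
    Ideal.Quotient.eq.mpr (Ideal.mem_span_singleton_self _)
  have h1 : monHom J (Function.update id x y) = monHom J id := by
    refine Finsupp.addHom_ext' fun w => AddMonoidHom.ext_int ?_
    change Additive.ofMul (Ideal.Quotient.mk J (subst K _ (z K w))) =
      Additive.ofMul (Ideal.Quotient.mk J (subst K _ (z K w)))
    congr 1
    rw [subst_z, subst_z]
    by_cases hw : w = x
    · subst hw; simp [hxy]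
    · simp [Function.update_of_ne hw]
  have h2 : ∀ Q : Laurent K I, Ideal.Quotient.mk J (subst K (Function.update id x y) Q) =
      Ideal.Quotient.mk J Q := by
    intro Q
    induction Q using AddMonoidAlgebra.induction_linear with
    | zero => simp
    | add P Q hP hQ => simp only [map_add, hP, hQ]
    | single m c =>
      have h3 := congrArg Additive.toMul (DFunLike.congr_fun h1 m)
      change Ideal.Quotient.mk J (subst K _ (AddMonoidAlgebra.single m 1)) =
        Ideal.Quotient.mk J (subst K _ (AddMonoidAlgebra.single m 1)) at h3
      rw [subst_id] at h3
      have h4 : (AddMonoidAlgebra.single m c : Laurent K I) =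
          algebraMap K _ c * AddMonoidAlgebra.single m 1 := by
        rw [← Algebra.smul_def]; simp
      rw [h4, map_mul, map_mul, map_mul, h3, AlgHom.commutes]
  have h5 := h2 P
  rw [h, map_zero, eq_comm, Ideal.Quotient.eq_zero_iff_mem, Ideal.mem_span_singleton] at h5
  exact h5

variable (K) in
/-- The Laurent polynomial `∏ (z_x - z_y)` over a finite set of pairs `(x, y)`. -/
def discr (T : Finset ((I × ℕ) × (I × ℕ))) : Laurent K I := ∏ p ∈ T, (z K p.1 - z K p.2)

lemma mem_range_of_discr_mul [CharZero K] [DecidableEq I] {n : I → ℕ} (Q : Rational K I)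
    (hQ : ∀ σ ∈ colorPerm n, ratSubst K σ.toEmbedding Q = Q)
    (T : Finset ((I × ℕ) × (I × ℕ)))
    (hT : ∀ p ∈ T, p.1.1 = p.2.1 ∧ p.1.2 < p.2.2 ∧ p.2.2 < n p.2.1) :
    ι (discr K T) * Q ∈ RingHom.range ι → Q ∈ RingHom.range ι := by
  induction T using Finset.induction_on with
  | empty => simp [discr]
  | insert p T' hp ih =>
    intro hmem
    refine ih (fun q hq => hT q (Finset.mem_insert_of_mem hq)) ?_
    obtain ⟨x, y⟩ := p
    obtain ⟨hc, hlt, hn⟩ := hT (x, y) (Finset.mem_insert_self _ _)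
    simp only at hc hlt hn
    have hxy : x ≠ y := fun h => by rw [h] at hlt; exact lt_irrefl _ hlt
    obtain ⟨P, hP⟩ := hmem
    have hd : discr K (insert (x, y) T') = (z K x - z K y) * discr K T' :=
      Finset.prod_insert hp
    have hs : Equiv.swap x y ∈ colorPerm n := by
      refine ⟨fun w => ?_, fun w hw => ?_⟩
      · rw [Equiv.swap_apply_def]; split_ifs with h1 h2
        · rw [h1, hc]
        · rw [h2, hc]
        · rfl
      · refine Equiv.swap_apply_of_ne_of_ne ?_ ?_
        · rintro rfl; rw [hc] at hw; omega
        · rintro rfl; omega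
    set s := Equiv.swap x y
    have h1 : ι (subst K s P) = ι (z K y - z K x) * ι (subst K s (discr K T')) * Q := by
      have := congrArg (ratSubst K s.toEmbedding) hP
      rw [ratSubst_algebraMap, hd, map_mul, map_mul, map_mul, hQ s hs, ratSubst_algebraMap,
        ratSubst_algebraMap, map_sub, subst_z, subst_z] at this
      simpa [s] using this
    have h2 : discr K T' * subst K s P = - (subst K s (discr K T') * P) := by
      apply iota_injective
      rw [map_neg, map_mul, map_mul, h1, hP, hd]
      simp only [map_sub, map_mul]
      ring
    set f : I × ℕ → I × ℕ := Function.update id x y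
    have hfs : f ∘ s = f := by
      funext w
      simp only [f, s, Function.comp, Equiv.swap_apply_def, Function.update_apply, id]
      split_ifs <;> simp_all
    have h3 := congrArg (subst K f) h2
    have hss : ∀ R : Laurent K I, subst K f (subst K s R) = subst K f R := fun R => by
      rw [subst_subst, hfs]
    rw [map_neg, map_mul, map_mul, hss, hss] at h3
    have h4 : subst K f (discr K T') * subst K f P = 0 := by
      have h5 : (2 : Laurent K I) * (subst K f (discr K T') * subst K f P) = 0 := by
        linear_combination h3
      refine (mul_eq_zero.mp h5).resolve_left ?_
      have : CharZero (Laurent K I) :=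
        charZero_of_injective_algebraMap (FaithfulSMul.algebraMap_injective K (Laurent K I))
      exact two_ne_zero
    have h6 : subst K f (discr K T') ≠ 0 := by
      rw [discr, map_prod, Finset.prod_ne_zero_iff]
      rintro ⟨a, b⟩ hab h0
      rw [map_sub, subst_z, subst_z, sub_eq_zero] at h0
      have h7 := z_injective h0
      obtain ⟨hc', hlt', hn'⟩ := hT (a, b) (Finset.mem_insert_of_mem hab)
      simp only at hc' hlt' hn'
      have hab' : a ≠ b := fun h => by rw [h] at hlt'; exact lt_irrefl _ hlt'
      simp only [f, Function.update_apply, id] at h7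
      split_ifs at h7 with ha hb hb
      · exact hab' (ha.trans hb.symm)
      · subst ha; subst h7; exact hp hab
      · subst hb; subst h7; omega
      · exact hab' h7
    obtain ⟨P', rfl⟩ := dvd_of_spec ((mul_eq_zero.mp h4).resolve_left h6)
    refine ⟨P', ?_⟩
    have h8 : ι (z K x - z K y) ≠ 0 := by
      rw [Ne, map_eq_zero_iff _ iota_injective, sub_eq_zero]
      exact fun h => hxy (z_injective h)
    apply mul_left_cancel₀ h8
    rw [← map_mul, hP, hd, map_mul, mul_assoc]

open Classical in
/-- The substitution `z_x ↦ 1` for all variables outside the box. -/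
def restrict (n : I → ℕ) : Laurent K I →ₐ[K] Laurent K I :=
  AddMonoidAlgebra.mapDomainAlgHom K K
    (Finsupp.filterAddHom (M := ℤ) fun x : I × ℕ => x.2 < n x.1)

open Classical in
lemma restrict_single (n : I → ℕ) (m : I × ℕ →₀ ℤ) (c : K) :
    restrict n (AddMonoidAlgebra.single m c) =
      AddMonoidAlgebra.single (m.filter fun x : I × ℕ => x.2 < n x.1) c := by
  simp only [restrict, AddMonoidAlgebra.mapDomainAlgHom_apply, AddMonoidAlgebra.mapDomain_single]
  rfl

lemma restrict_eq_self_iff (n : I → ℕ) (P : Laurent K I) :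
    restrict n P = P ↔ ∀ m ∈ P.coeff.support, ∀ x : I × ℕ, n x.1 ≤ x.2 → m x = 0 := by
  classical
  have hdef : (restrict n P).coeff =
      P.coeff.mapDomain fun m => m.filter fun x : I × ℕ => x.2 < n x.1 := by
    rfl
  constructor
  · intro h m hm x hx
    rw [← h, hdef] at hm
    obtain ⟨m', -, rfl⟩ := Finset.mem_image.mp (Finsupp.mapDomain_support hm)
    rw [Finsupp.filter_apply_neg]
    exact not_lt.mpr hx
  · intro h
    apply AddMonoidAlgebra.ext
    rw [hdef]
    refine (Finsupp.mapDomain_congr (g := id) fun m hm => ?_).trans Finsupp.mapDomain_id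
    rw [id, Finsupp.filter_eq_self_iff]
    intro x hx
    by_contra h'
    exact hx (h m hm x (not_lt.mp h'))

/-- The Laurent polynomials in the variables of the box, inside the rational functions. -/
def boxRing (K : Type*) {I : Type*} [Field K] (n : I → ℕ) : Subring (Rational K I) :=
  (RingHom.eqLocus (restrict n : Laurent K I →ₐ[K] Laurent K I).toRingHom
    (RingHom.id _)).map (algebraMap (Laurent K I) (Rational K I))

lemma mem_boxRing {n : I → ℕ} {P : Laurent K I} (h : restrict n P = P) : ι P ∈ boxRing K n :=
  ⟨P, h, rfl⟩

lemma restrict_monomial {n : I → ℕ} {x : I × ℕ} (hx : x.2 < n x.1) (k : ℤ) :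
    restrict n (AddMonoidAlgebra.single (Finsupp.single x k) (1 : K)) =
      AddMonoidAlgebra.single (Finsupp.single x k) (1 : K) := by
  rw [restrict_single, Finsupp.filter_single_of_pos (fun x : I × ℕ => x.2 < n x.1) hx]

lemma rz_mem {n : I → ℕ} {x : I × ℕ} (hx : x.2 < n x.1) : rz K x ∈ boxRing K n :=
  mem_boxRing (restrict_monomial hx 1)

lemma rz_inv_mem {n : I → ℕ} {x : I × ℕ} (hx : x.2 < n x.1) : (rz K x)⁻¹ ∈ boxRing K n := by
  have : (rz K x)⁻¹ = ι (AddMonoidAlgebra.single (Finsupp.single x (-1)) 1) := by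
    refine inv_eq_of_mul_eq_one_right ?_
    rw [rz, z, ← map_mul, AddMonoidAlgebra.single_mul_single, ← Finsupp.single_add]
    simp [← AddMonoidAlgebra.one_def]
  rw [this]
  exact mem_boxRing (restrict_monomial hx _)

lemma zpow_mem_boxRing {n : I → ℕ} {x y : I × ℕ} (hx : x.2 < n x.1) (hy : y.2 < n y.1) (k : ℤ) :
    (rz K x / rz K y) ^ k ∈ boxRing K n := by
  cases k with
  | ofNat k =>
    rw [Int.ofNat_eq_natCast, zpow_natCast, div_eq_mul_inv]
    exact pow_mem (mul_mem (rz_mem hx) (rz_inv_mem hy)) _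
  | negSucc k =>
    rw [zpow_negSucc, ← inv_pow, inv_div, div_eq_mul_inv]
    exact pow_mem (mul_mem (rz_mem hy) (rz_inv_mem hx)) _

lemma algebraMap_mem_boxRing (n : I → ℕ) (c : K) : algebraMap K (Rational K I) c ∈ boxRing K n := by
  rw [IsScalarTower.algebraMap_apply K (Laurent K I)]
  exact mem_boxRing (AlgHom.commutes _ _)

lemma laurentEval_mem {n : I → ℕ} {x y : I × ℕ} (hx : x.2 < n x.1) (hy : y.2 < n y.1)
    (p : LaurentPolynomial K) : laurentEval (rz K x / rz K y) p ∈ boxRing K n :=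
  sum_mem fun _ _ => mul_mem (algebraMap_mem_boxRing _ _) (zpow_mem_boxRing hx hy _)

lemma subst_restrict {n m : I → ℕ} {f : I × ℕ → I × ℕ} {P : Laurent K I} (hP : P ∈ symLaurent K n)
    (hf : ∀ x : I × ℕ, x.2 < n x.1 → (f x).2 < m (f x).1) :
    restrict m (subst K f P) = subst K f P := by
  classical
  rw [restrict_eq_self_iff]
  intro m' hm' x hx
  have hdef : (subst K f P).coeff = P.coeff.mapDomain fun m => m.mapDomain f := rfl
  rw [hdef] at hm'
  obtain ⟨m'', h'', rfl⟩ := Finset.mem_image.mp (Finsupp.mapDomain_support hm')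
  by_contra hne
  have := Finsupp.mapDomain_support (Finsupp.mem_support_iff.mpr hne)
  obtain ⟨w, hw, rfl⟩ := Finset.mem_image.mp this
  refine absurd (hf w ?_) (not_lt.mpr hx)
  by_contra h'
  exact (Finsupp.mem_support_iff.mp hw) (hP.1 m'' h'' w (not_lt.mp h'))

variable [Fintype I] [DecidableEq I]

/-- All pairs of variables of the same colour in the box. -/
def pairs (n : I → ℕ) : Finset ((I × ℕ) × (I × ℕ)) :=
  (box n ×ˢ box n).filter fun p => p.1.1 = p.2.1 ∧ p.1.2 < p.2.2

lemma mem_pairs {n : I → ℕ} {p : (I × ℕ) × (I × ℕ)} :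
    p ∈ pairs n ↔ (p.1.2 < n p.1.1 ∧ p.2.2 < n p.2.1) ∧ p.1.1 = p.2.1 ∧ p.1.2 < p.2.2 := by
  simp [pairs, mem_box]

lemma discr_mul_cross_mem (ζ : ZetaDatum K I) {n N : I → ℕ} (hn : n ≤ N)
    {σ : Equiv.Perm (I × ℕ)} (hσ : σ ∈ colorPerm N) :
    ι (discr K (pairs N)) * ratSubst K σ.toEmbedding (cross ζ (box n) (box N \ box n)) ∈
      boxRing K N := by
  set U := box n ×ˢ (box N \ box n) with hU
  set S := U.filter fun p => p.1.1 = p.2.1 with hS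
  let g : (I × ℕ) × (I × ℕ) → (I × ℕ) × (I × ℕ) := fun p =>
    if (σ p.1).2 < (σ p.2).2 then (σ p.1, σ p.2) else (σ p.2, σ p.1)
  have hUmem : ∀ p ∈ U, p.1 ∈ box n ∧ p.2 ∈ box N ∧ p.2 ∉ box n := by
    intro p hp
    rw [hU, Finset.mem_product, Finset.mem_sdiff] at hp
    exact hp
  have hbox : ∀ p ∈ U, (σ p.1).2 < N (σ p.1).1 ∧ (σ p.2).2 < N (σ p.2).1 := by
    intro p hp
    obtain ⟨h1, h2, -⟩ := hUmem p hp
    rw [colorPerm_mem_box hσ, colorPerm_mem_box hσ]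
    exact ⟨mem_box.mp (box_mono hn h1), mem_box.mp h2⟩
  have hne : ∀ p ∈ U, σ p.1 ≠ σ p.2 := by
    intro p hp h
    obtain ⟨h1, -, h3⟩ := hUmem p hp
    rw [σ.injective h] at h1
    exact h3 h1
  have hgS : ∀ p ∈ S, g p ∈ pairs N := by
    intro p hp
    rw [hS, Finset.mem_filter] at hp
    obtain ⟨hp, hc⟩ := hp
    have h1 := hbox p hp
    have h2 := hne p hp
    have h3 : (σ p.1).1 = (σ p.2).1 := by rw [hσ.1, hσ.1, hc]
    have h4 : (σ p.1).2 ≠ (σ p.2).2 := fun h => h2 (Prod.ext h3 h)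
    rw [mem_pairs]
    simp only [g]
    split_ifs with h
    · exact ⟨h1, h3, h⟩
    · exact ⟨h1.symm, h3.symm, by simp only; omega⟩
  have hginj : Set.InjOn g S := by
    intro p hp q hq h
    obtain ⟨h1, -, h2⟩ := hUmem p (Finset.mem_filter.mp hp).1
    obtain ⟨h3, -, h4⟩ := hUmem q (Finset.mem_filter.mp hq).1
    simp only [g] at h
    split_ifs at h <;> rw [Prod.mk.injEq] at h <;> obtain ⟨h5, h6⟩ := h <;>
      replace h5 := σ.injective h5 <;> replace h6 := σ.injective h6
    · exact Prod.ext h5 h6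
    · rw [h5] at h1; exact absurd h1 h4
    · rw [← h5] at h3; exact absurd h3 h2
    · exact Prod.ext h6 h5
  have hsub : S.image g ⊆ pairs N := fun q hq => by
    obtain ⟨p, hp, rfl⟩ := Finset.mem_image.mp hq
    exact hgS p hp
  have hD : ι (discr K (pairs N)) = ι (discr K (pairs N \ S.image g)) *
      ∏ p ∈ S, (rz K (g p).1 - rz K (g p).2) := by
    unfold discr
    rw [← Finset.prod_sdiff hsub, map_mul, map_prod ι _ (S.image g), Finset.prod_image hginj]
    simp only [map_sub, rz]
  have hcross : ratSubst K σ.toEmbedding (cross ζ (box n) (box N \ box n)) =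
      (∏ p ∈ U, laurentEval (rz K (σ p.1) / rz K (σ p.2)) (ζ.num p.1.1 p.2.1)) *
      ∏ p ∈ S, (1 - rz K (σ p.1) / rz K (σ p.2))⁻¹ := by
    rw [hS, Finset.prod_filter, ← Finset.prod_mul_distrib, hU, Finset.prod_product, cross]
    simp only [map_prod, map_zeta, map_div₀, ratSubst_rz]
    refine Finset.prod_congr rfl fun x _ => Finset.prod_congr rfl fun y _ => ?_
    unfold ZetaDatum.eval
    split_ifs <;> simp [div_eq_mul_inv]
  rw [hD, hcross]
  have : ∀ a b c d : Rational K I, a * b * (c * d) = a * c * (b * d) := by intros; ring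
  rw [this, ← Finset.prod_mul_distrib]
  refine mul_mem (mul_mem ?_ (prod_mem fun p hp => ?_)) (prod_mem fun p hp => ?_)
  · rw [discr, map_prod]
    refine prod_mem fun p hp => ?_
    have := mem_pairs.mp (Finset.mem_sdiff.mp hp).1
    rw [map_sub]
    exact sub_mem (rz_mem this.1.1) (rz_mem this.1.2)
  · exact laurentEval_mem (hbox p hp).1 (hbox p hp).2 _
  · have hpU := (Finset.mem_filter.mp hp).1
    have h0 : rz K (σ p.2) ≠ 0 := rz_ne_zero _
    have h1 : rz K (σ p.2) - rz K (σ p.1) ≠ 0 := fun h => hne p hpU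
      (z_injective (iota_injective (sub_eq_zero.mp h))).symm
    have h2 : (1 - rz K (σ p.1) / rz K (σ p.2))⁻¹ =
        rz K (σ p.2) / (rz K (σ p.2) - rz K (σ p.1)) := by
      rw [one_sub_div h0, inv_div]
    rw [h2]
    simp only [g]
    split_ifs
    · have : (rz K (σ p.1) - rz K (σ p.2)) * (rz K (σ p.2) / (rz K (σ p.2) - rz K (σ p.1))) =
          - rz K (σ p.2) := by
        field_simp; ring
      rw [this]
      exact neg_mem (rz_mem (hbox p hpU).2)
    · have : (rz K (σ p.2) - rz K (σ p.1)) * (rz K (σ p.2) / (rz K (σ p.2) - rz K (σ p.1))) =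
          rz K (σ p.2) := by
        field_simp
      rw [this]
      exact rz_mem (hbox p hpU).2

/-- The shuffle product of two symmetric Laurent polynomials is a symmetric Laurent polynomial: the
simple poles at `z_{ia} = z_{ib}` cancel in the symmetrization. -/
theorem exists_shuffle [CharZero K] (ζ : ZetaDatum K I) {n n' : I → ℕ} {R R' : Laurent K I}
    (hR : R ∈ symLaurent K n) (hR' : R' ∈ symLaurent K n') :
    ∃ P ∈ symLaurent K (n + n'), ι P = ratShuffle ζ n n' R R' := by
  set Q := ratShuffle ζ n n' R R' with hQdef
  have hinv : ∀ σ ∈ colorPerm (n + n'), ratSubst K σ.toEmbedding Q = Q :=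
    fun σ hσ => ratSubst_sym hσ _
  have hmem : ι (discr K (pairs (n + n'))) * Q ∈ boxRing K (n + n') := by
    rw [hQdef, ratShuffle, sym_smul, mul_smul_comm, Algebra.smul_def]
    refine mul_mem (algebraMap_mem_boxRing _ _) ?_
    rw [sym, Finset.mul_sum]
    refine sum_mem fun σ _ => ?_
    rw [map_mul, map_mul, mul_left_comm, ratSubst_algebraMap, ratSubst_algebraMap]
    refine mul_mem (mul_mem (mem_boxRing ?_) (mem_boxRing ?_))
      (discr_mul_cross_mem ζ (by intro i; simp) σ.2)
    · refine subst_restrict hR fun x hx => ?_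
      change ((σ : Equiv.Perm (I × ℕ)) x).2 < (n + n') ((σ : Equiv.Perm (I × ℕ)) x).1
      rw [colorPerm_mem_box σ.2]
      exact lt_of_lt_of_le hx (by simp)
    · rw [subst_subst]
      refine subst_restrict hR' fun x hx => ?_
      change ((σ : Equiv.Perm (I × ℕ)) (shift n x)).2 <
        (n + n') ((σ : Equiv.Perm (I × ℕ)) (shift n x)).1
      rw [colorPerm_mem_box σ.2]
      simpa [shift_apply] using hx
  have hrange : Q ∈ RingHom.range ι := by
    refine mem_range_of_discr_mul Q hinv (pairs (n + n')) (fun p hp => ?_) ?_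
    · have := mem_pairs.mp hp
      exact ⟨this.2.1, this.2.2, this.1.2⟩
    · obtain ⟨P, -, hP⟩ := hmem
      exact ⟨P, hP⟩
  obtain ⟨P, hP⟩ := hrange
  refine ⟨P, ⟨?_, fun σ hσ => ?_⟩, hP⟩
  · rw [← restrict_eq_self_iff]
    obtain ⟨P₀, hP₀, h⟩ := hmem
    change restrict (n + n') P₀ = P₀ at hP₀
    rw [← hP, ← map_mul] at h
    have h' := iota_injective h
    rw [h', map_mul] at hP₀
    have hD : restrict (n + n') (discr K (pairs (n + n'))) = discr K (pairs (n + n')) := by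
      rw [discr, map_prod]
      refine Finset.prod_congr rfl fun p hp => ?_
      have := mem_pairs.mp hp
      rw [map_sub, z, z, restrict_monomial this.1.1, restrict_monomial this.1.2]
    rw [hD] at hP₀
    refine mul_left_cancel₀ ?_ hP₀
    rw [discr, Finset.prod_ne_zero_iff]
    intro p hp h0
    have := mem_pairs.mp hp
    have h1 := z_injective (sub_eq_zero.mp h0)
    rw [h1] at this
    exact lt_irrefl _ this.2.2
  · apply iota_injective
    have := hinv σ hσ
    rw [← hP, ratSubst_algebraMap] at this
    exact this

end Closure

section Algebras

open scoped DirectSum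

variable {K I : Type*} [Field K]

/-- The degree `n` component of the big shuffle algebra of the datum `ζ`. -/
def Component (_ζ : ZetaDatum K I) (n : I → ℕ) : Type _ := symLaurent K n

instance (ζ : ZetaDatum K I) (n : I → ℕ) : AddCommGroup (Component ζ n) :=
  inferInstanceAs (AddCommGroup (symLaurent K n))

instance (ζ : ZetaDatum K I) (n : I → ℕ) : Module K (Component ζ n) :=
  inferInstanceAs (Module K (symLaurent K n))

/-- The Laurent polynomial underlying an element of degree `n`. -/
def Component.val {ζ : ZetaDatum K I} {n : I → ℕ} : Component ζ n →ₗ[K] Laurent K I :=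
  (symLaurent K n).subtype

/-- A symmetric Laurent polynomial, as an element of degree `n`. -/
def Component.mk (ζ : ZetaDatum K I) {n : I → ℕ} (P : Laurent K I) (h : P ∈ symLaurent K n) :
    Component ζ n := ⟨P, h⟩

lemma Component.val_mk (ζ : ZetaDatum K I) {n : I → ℕ} (P : Laurent K I)
    (h : P ∈ symLaurent K n) : (Component.mk ζ P h).val = P := rfl

lemma Component.mem {ζ : ZetaDatum K I} {n : I → ℕ} (a : Component ζ n) :
    a.val ∈ symLaurent K n := a.2

lemma Component.ext {ζ : ZetaDatum K I} {n : I → ℕ} {a b : Component ζ n}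
    (h : algebraMap (Laurent K I) (Rational K I) a.val =
      algebraMap (Laurent K I) (Rational K I) b.val) : a = b :=
  Subtype.ext (iota_injective h)

lemma one_mem_symLaurent : (1 : Laurent K I) ∈ symLaurent K (0 : I → ℕ) := by
  refine ⟨fun m hm x _ => ?_, fun σ _ => map_one _⟩
  rw [AddMonoidAlgebra.one_def, AddMonoidAlgebra.coeff_single] at hm
  rw [Finset.mem_singleton.mp (Finsupp.support_single_subset hm)]
  rfl

/-- The constant `1`, in degree `0`. -/
def Component.one (ζ : ZetaDatum K I) : Component ζ 0 := Component.mk ζ 1 one_mem_symLaurent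

lemma Component.val_one (ζ : ZetaDatum K I) : (Component.one ζ).val = 1 := rfl

/-- The defining relations of the quadratic quantum loop group, between symbols `e_{i,d}`:
for `i, j ∈ I` the coefficients of all `z^{-a} w^{-b}` in
`e_i(z) e_j(w) ζ_{ji}(w/z) = e_j(w) e_i(z) ζ_{ij}(z/w)`, `e_i(z) = ∑_d e_{i,d} z^{-d}`, where for
`i = j` both sides are multiplied by `z - w`, that is
`e_i(z) e_i(w) z N(w/z) = - e_i(w) e_i(z) w N(z/w)` for the numerator `N` of `ζ_{ii}`. -/
inductive QuadRel (ζ : ZetaDatum K I) :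
    FreeAlgebra K (I × ℤ) → FreeAlgebra K (I × ℤ) → Prop
  | different (i j : I) (hij : i ≠ j) (a b : ℤ) : QuadRel ζ
      ((ζ.num j i).coeff.sum fun k c =>
        c • (FreeAlgebra.ι K (i, a - k) * FreeAlgebra.ι K (j, b + k)))
      ((ζ.num i j).coeff.sum fun k c =>
        c • (FreeAlgebra.ι K (j, b - k) * FreeAlgebra.ι K (i, a + k)))
  | same (i : I) (a b : ℤ) : QuadRel ζ
      ((ζ.num i i).coeff.sum fun k c =>
        c • (FreeAlgebra.ι K (i, a + 1 - k) * FreeAlgebra.ι K (i, b + k)))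
      (-(ζ.num i i).coeff.sum fun k c =>
        c • (FreeAlgebra.ι K (i, b + 1 - k) * FreeAlgebra.ι K (i, a + k)))

variable [Fintype I] [DecidableEq I]

/-- The big shuffle algebra `𝒱⁺` of the datum `ζ`, as a graded vector space.  The algebra `𝒱⁻` of
the datum `ζ` is the algebra `𝒱⁺` of the datum `ζ.op`: in its multiplication the factor
`ζ_{ij}(z_{ia} / z_{jb})` is replaced by `ζ_{ji}(z_{jb} / z_{ia})`. -/
abbrev BigShuffle (ζ : ZetaDatum K I) : Type _ := ⨁ n : I → ℕ, Component ζ n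

variable [CharZero K]

/-- The shuffle product of two homogeneous elements. -/
def Component.mul {ζ : ZetaDatum K I} {n n' : I → ℕ} (a : Component ζ n) (b : Component ζ n') :
    Component ζ (n + n') :=
  Component.mk ζ (exists_shuffle ζ a.mem b.mem).choose
    (exists_shuffle ζ a.mem b.mem).choose_spec.1

lemma Component.mul_val {ζ : ZetaDatum K I} {n n' : I → ℕ} (a : Component ζ n)
    (b : Component ζ n') :
    algebraMap (Laurent K I) (Rational K I) (a.mul b).val = ratShuffle ζ n n' a.val b.val :=
  (exists_shuffle ζ a.mem b.mem).choose_spec.2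

lemma ratShuffle_add_left (ζ : ZetaDatum K I) (n n' : I → ℕ) (R S T : Laurent K I) :
    ratShuffle ζ n n' (R + S) T = ratShuffle ζ n n' R T + ratShuffle ζ n n' S T := by
  simp only [ratShuffle, map_add, add_mul, smul_add, sym_add]

lemma ratShuffle_add_right (ζ : ZetaDatum K I) (n n' : I → ℕ) (R S T : Laurent K I) :
    ratShuffle ζ n n' R (S + T) = ratShuffle ζ n n' R S + ratShuffle ζ n n' R T := by
  simp only [ratShuffle, map_add, add_mul, mul_add, smul_add, sym_add]

lemma algebraMap_smul' (c : K) (R : Laurent K I) :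
    algebraMap (Laurent K I) (Rational K I) (c • R) =
      c • algebraMap (Laurent K I) (Rational K I) R :=
  map_smul (IsScalarTower.toAlgHom K (Laurent K I) (Rational K I)) c R

lemma ratShuffle_smul_left (ζ : ZetaDatum K I) (n n' : I → ℕ) (c : K) (R S : Laurent K I) :
    ratShuffle ζ n n' (c • R) S = c • ratShuffle ζ n n' R S := by
  simp only [ratShuffle, algebraMap_smul', smul_mul_assoc, sym_smul]
  rw [smul_comm]

lemma ratShuffle_smul_right (ζ : ZetaDatum K I) (n n' : I → ℕ) (c : K) (R S : Laurent K I) :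
    ratShuffle ζ n n' R (c • S) = c • ratShuffle ζ n n' R S := by
  simp only [ratShuffle, map_smul, algebraMap_smul', smul_mul_assoc, mul_smul_comm, sym_smul]
  rw [smul_comm]

lemma sym_algebraMap {n : I → ℕ} {R : Laurent K I} (hR : R ∈ symLaurent K n) :
    sym n (algebraMap (Laurent K I) (Rational K I) R) =
      ((∏ i, (n i).factorial : ℕ) : K) • algebraMap (Laurent K I) (Rational K I) R :=
  sym_of_invariant _ fun σ hσ => by
    rw [ratSubst_algebraMap]
    exact congrArg _ (hR.2 σ hσ)

lemma box_zero : box (0 : I → ℕ) = ∅ := by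
  ext x; simp [mem_box]

lemma ratShuffle_one_left (ζ : ZetaDatum K I) {n : I → ℕ} {R : Laurent K I}
    (hR : R ∈ symLaurent K n) :
    ratShuffle ζ 0 n 1 R = algebraMap (Laurent K I) (Rational K I) R := by
  have h1 : subst K (shift (0 : I → ℕ)) R = R := by
    have : (shift (0 : I → ℕ) : I × ℕ → I × ℕ) = id := by
      funext x; simp [shift_apply]
    rw [this, subst_id]
  rw [ratShuffle, sym_smul, h1, box_zero]
  simp only [zero_add, map_one, one_mul, cross, Finset.prod_empty, mul_one]
  rw [sym_algebraMap hR, smul_smul]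
  simp only [Pi.zero_apply, Nat.factorial_zero, Finset.prod_const_one, one_mul]
  rw [inv_mul_cancel₀ (factorial_ne_zero n), one_smul]

lemma ratShuffle_one_right (ζ : ZetaDatum K I) {n : I → ℕ} {R : Laurent K I}
    (hR : R ∈ symLaurent K n) :
    ratShuffle ζ n 0 R 1 = algebraMap (Laurent K I) (Rational K I) R := by
  rw [ratShuffle, sym_smul]
  simp only [add_zero, map_one, mul_one, cross, sdiff_self, Finset.bot_eq_empty,
    Finset.prod_empty, Finset.prod_const_one]
  rw [sym_algebraMap hR, smul_smul]
  simp only [Pi.zero_apply, Nat.factorial_zero, Finset.prod_const_one, mul_one]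
  rw [inv_mul_cancel₀ (factorial_ne_zero n), one_smul]

lemma mk_eq_mk {ζ : ZetaDatum K I} {n m : I → ℕ} {a : Component ζ n} {b : Component ζ m}
    (h : n = m) (h' : algebraMap (Laurent K I) (Rational K I) a.val =
      algebraMap (Laurent K I) (Rational K I) b.val) :
    GradedMonoid.mk n a = GradedMonoid.mk m b := by
  subst h
  rw [Component.ext h']

instance (ζ : ZetaDatum K I) : GradedMonoid.GMul (Component ζ) where
  mul a b := a.mul b

instance (ζ : ZetaDatum K I) : GradedMonoid.GOne (Component ζ) where
  one := Component.one ζ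

instance (ζ : ZetaDatum K I) : GradedMonoid.GMonoid (Component ζ) where
  one_mul := by
    rintro ⟨n, a⟩
    refine mk_eq_mk (zero_add n) ?_
    exact (Component.mul_val _ _).trans (ratShuffle_one_left ζ a.mem)
  mul_one := by
    rintro ⟨n, a⟩
    refine mk_eq_mk (add_zero n) ?_
    exact (Component.mul_val _ _).trans (ratShuffle_one_right ζ a.mem)
  mul_assoc := by
    rintro ⟨n, a⟩ ⟨n', b⟩ ⟨n'', c⟩
    refine mk_eq_mk (add_assoc n n' n'') ?_
    refine (Component.mul_val (a.mul b) c).trans ?_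
    refine Eq.trans ?_ (Component.mul_val a (b.mul c)).symm
    rw [ratShuffle_assoc_left ζ n n' n'' a.val b.val c.val _ (Component.mul_val a b),
      ratShuffle_assoc_right ζ n n' n'' a.val b.val c.val _ a.mem (Component.mul_val b c)]

instance (ζ : ZetaDatum K I) : DirectSum.GRing (Component ζ) where
  mul_zero a := Component.ext (by
    refine (Component.mul_val _ _).trans ?_
    simp [ratShuffle, sym_zero])
  zero_mul a := Component.ext (by
    refine (Component.mul_val _ _).trans ?_
    simp [ratShuffle, sym_zero])
  mul_add a b c := Component.ext (by
    refine (Component.mul_val _ _).trans ?_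
    rw [map_add, map_add, map_add, ratShuffle_add_right, ← Component.mul_val,
      ← Component.mul_val]
    rfl)
  add_mul a b c := Component.ext (by
    refine (Component.mul_val _ _).trans ?_
    rw [map_add, map_add, map_add, ratShuffle_add_left, ← Component.mul_val,
      ← Component.mul_val]
    rfl)
  natCast k := (k : K) • Component.one ζ
  natCast_zero := by rw [Nat.cast_zero, zero_smul]
  natCast_succ k := by rw [Nat.cast_succ, add_smul, one_smul]; rfl
  intCast k := (k : K) • Component.one ζ
  intCast_ofNat k := by rw [Int.cast_natCast]
  intCast_negSucc_ofNat k := by rw [Int.cast_negSucc, neg_smul]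

lemma Component.mul_smul_left {ζ : ZetaDatum K I} {n n' : I → ℕ} (c : K) (a : Component ζ n)
    (b : Component ζ n') : (c • a).mul b = c • a.mul b := Component.ext (by
  simp only [map_smul, Component.mul_val, ratShuffle_smul_left, algebraMap_smul'])

lemma Component.mul_smul_right {ζ : ZetaDatum K I} {n n' : I → ℕ} (c : K) (a : Component ζ n)
    (b : Component ζ n') : a.mul (c • b) = c • a.mul b := Component.ext (by
  simp only [map_smul, Component.mul_val, ratShuffle_smul_right, algebraMap_smul'])

instance (ζ : ZetaDatum K I) : DirectSum.GAlgebra K (Component ζ) where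
  toFun := (LinearMap.toSpanSingleton K (Component ζ 0) (Component.one ζ)).toAddMonoidHom
  map_one := one_smul K _
  map_mul r s := by
    refine mk_eq_mk (add_zero 0).symm ?_
    refine Eq.trans ?_ (Component.mul_val _ _).symm
    change algebraMap _ _ (Component.val ((r * s) • Component.one ζ)) =
      ratShuffle ζ 0 0 (Component.val (r • Component.one ζ)) (Component.val (s • Component.one ζ))
    rw [LinearMap.map_smul, LinearMap.map_smul, LinearMap.map_smul, ratShuffle_smul_left, ratShuffle_smul_right,
      Component.val_one, ratShuffle_one_left ζ one_mem_symLaurent, algebraMap_smul', mul_smul]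
  commutes := by
    rintro r ⟨n, a⟩
    refine mk_eq_mk (add_comm 0 n) ?_
    refine (Component.mul_val _ _).trans (Eq.trans ?_ (Component.mul_val _ _).symm)
    change ratShuffle ζ 0 n (Component.val (r • Component.one ζ)) a.val =
      ratShuffle ζ n 0 a.val (Component.val (r • Component.one ζ))
    rw [map_smul, ratShuffle_smul_left, ratShuffle_smul_right, Component.val_one,
      ratShuffle_one_left ζ a.mem, ratShuffle_one_right ζ a.mem]
  smul_def := by
    rintro r ⟨n, a⟩
    refine mk_eq_mk (zero_add n).symm ?_
    refine Eq.trans ?_ (Component.mul_val _ _).symm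
    change algebraMap _ _ (Component.val (r • a)) =
      ratShuffle ζ 0 n (Component.val (r • Component.one ζ)) a.val
    rw [LinearMap.map_smul, LinearMap.map_smul, ratShuffle_smul_left, Component.val_one,
      ratShuffle_one_left ζ a.mem, algebraMap_smul']

lemma monomial_mem (i : I) (d : ℤ) :
    (AddMonoidAlgebra.single (Finsupp.single (i, 0) d) 1 : Laurent K I) ∈
      symLaurent K (Pi.single i 1) := by
  refine ⟨fun m hm x hx => ?_, fun σ hσ => ?_⟩
  · rw [AddMonoidAlgebra.coeff_single] at hm
    rw [Finset.mem_singleton.mp (Finsupp.support_single_subset hm)]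
    refine Finsupp.single_eq_of_ne ?_
    rintro rfl
    simp at hx
  · rw [subst_single, Finsupp.mapDomain_single]
    have h1 := hσ.1 (i, 0)
    have h2 := (colorPerm_mem_box hσ (i, 0)).mpr (by simp)
    rw [h1] at h2
    have : σ (i, 0) = (i, 0) := Prod.ext h1 (by simpa using h2)
    rw [this]

/-- The element `z_{i1}^d` of the big shuffle algebra. -/
def zgen (ζ : ZetaDatum K I) (i : I) (d : ℤ) : BigShuffle ζ :=
  DirectSum.of (Component ζ) (Pi.single i 1) (Component.mk ζ
    (AddMonoidAlgebra.single (Finsupp.single (i, 0) d) 1) (monomial_mem i d))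

/-- The quadratic quantum loop group `Ũ⁺` of the datum `ζ`.  The algebra `Ũ⁻` of the datum `ζ` is
the algebra `Ũ⁺` of the datum `ζ.op`, with generators called `f_{i,d}`: its relations read
`f_i(z) f_j(w) ζ_{ij}(z/w) = f_j(w) f_i(z) ζ_{ji}(w/z)`. -/
abbrev QuadAlg (ζ : ZetaDatum K I) : Type _ := RingQuot (QuadRel ζ)

/-- The generator `e_{i,d}` (for the datum `ζ.op`: `f_{i,d}`). -/
def QuadAlg.gen (ζ : ZetaDatum K I) (i : I) (d : ℤ) : QuadAlg ζ :=
  RingQuot.mkAlgHom K (QuadRel ζ) (FreeAlgebra.ι K (i, d))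

lemma box_single (i : I) : box (Pi.single i 1) = {(i, 0)} := by
  ext ⟨j, b⟩
  rw [mem_box, Finset.mem_singleton, Pi.single_apply]
  by_cases h : j = i
  · subst h; simp
  · simp [h]

lemma algebraMap_monomial (x : I × ℕ) (d : ℤ) :
    algebraMap (Laurent K I) (Rational K I)
      (AddMonoidAlgebra.single (Finsupp.single x d) 1) = rz K x ^ d := by
  have key : ∀ k : ℕ, algebraMap (Laurent K I) (Rational K I)
      (AddMonoidAlgebra.single (Finsupp.single x (k : ℤ)) 1) = rz K x ^ k := by
    intro k
    rw [rz, z, ← map_pow, AddMonoidAlgebra.single_pow]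
    simp
  cases d with
  | ofNat k => rw [Int.ofNat_eq_natCast, zpow_natCast]; exact key k
  | negSucc k =>
    rw [zpow_negSucc]
    refine eq_inv_of_mul_eq_one_left ?_
    rw [← key, ← map_mul, AddMonoidAlgebra.single_mul_single, ← Finsupp.single_add,
      Int.negSucc_eq]
    simp [← AddMonoidAlgebra.one_def]

lemma zgen_mul_zgen (ζ : ZetaDatum K I) (i j : I) (d f : ℤ) {n : I → ℕ}
    (hn : Pi.single i 1 + Pi.single j 1 = n) {y : I × ℕ}
    (hy : y = (j, if i = j then 1 else 0)) :
    ∃ e : Component ζ n, zgen ζ i d * zgen ζ j f = DirectSum.of (Component ζ) n e ∧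
      algebraMap (Laurent K I) (Rational K I) e.val =
        sym n (rz K (i, 0) ^ d * rz K y ^ f * ζ.eval i j (rz K (i, 0) / rz K y)) := by
  subst hn
  have hsh : shift (Pi.single i 1) (j, 0) = y := by
    rw [shift_apply, hy, Pi.single_apply]
    simp [eq_comm]
  refine ⟨_, DirectSum.of_mul_of _ _, ?_⟩
  refine (Component.mul_val _ _).trans ?_
  change ratShuffle ζ _ _ (AddMonoidAlgebra.single (Finsupp.single (i, 0) d) 1)
    (AddMonoidAlgebra.single (Finsupp.single (j, 0) f) 1) = _
  rw [ratShuffle, ← box_map_shift, box_single, box_single, Finset.map_singleton, hsh, cross,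
    Finset.prod_singleton, Finset.prod_singleton, subst_single, Finsupp.mapDomain_single, hsh,
    algebraMap_monomial, algebraMap_monomial]
  have hf : ∀ k : I, ∏ l, ((Pi.single k 1 : I → ℕ) l).factorial = 1 := fun k =>
    Finset.prod_eq_one fun l _ => by
      rw [Pi.single_apply]; split_ifs <;> rfl
  rw [hf, hf]
  simp only [mul_one, Nat.cast_one, inv_one, one_smul]
  rw [hy]

lemma sum_shift {F : Type*} [Field F] [Algebra K F] {x y : F} (hx : x ≠ 0) (hy : y ≠ 0)
    (p : LaurentPolynomial K) (a b : ℤ) (c : F) :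
    (p.coeff.sum fun k t => t • (x ^ (a - k) * y ^ (b + k) * c)) =
      x ^ a * y ^ b * laurentEval (y / x) p * c := by
  simp only [laurentEval, Finsupp.sum, Finset.mul_sum, Finset.sum_mul]
  refine Finset.sum_congr rfl fun k _ => ?_
  rw [Algebra.smul_def, zpow_sub₀ hx, zpow_add₀ hy, div_zpow]
  ring

lemma zgen_relation (ζ : ZetaDatum K I) {x y : FreeAlgebra K (I × ℤ)} (h : QuadRel ζ x y) :
    FreeAlgebra.lift K (fun p : I × ℤ => zgen ζ p.1 p.2) x =
      FreeAlgebra.lift K (fun p : I × ℤ => zgen ζ p.1 p.2) y := by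
  have key : ∀ (i j : I) (n : I → ℕ) (hn : Pi.single i 1 + Pi.single j 1 = n) (y : I × ℕ)
      (hy : y = (j, if i = j then 1 else 0)) (p : LaurentPolynomial K) (a b : ℤ),
      ∃ e : Component ζ n, FreeAlgebra.lift K (fun p : I × ℤ => zgen ζ p.1 p.2)
        (p.coeff.sum fun k c =>
          c • (FreeAlgebra.ι K (i, a - k) * FreeAlgebra.ι K (j, b + k))) =
        DirectSum.of (Component ζ) n e ∧ algebraMap (Laurent K I) (Rational K I) e.val =
          sym n (rz K (i, 0) ^ a * rz K y ^ b * laurentEval (rz K y / rz K (i, 0)) p *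
            ζ.eval i j (rz K (i, 0) / rz K y)) := by
    intro i j n hn y hy p a b
    choose e he he' using fun k : ℤ => zgen_mul_zgen ζ i j (a - k) (b + k) hn hy
    refine ⟨p.coeff.sum fun k c => c • e k, ?_, ?_⟩
    · simp only [Finsupp.sum, map_sum, map_smul, map_mul, FreeAlgebra.lift_ι_apply, he]
      refine Finset.sum_congr rfl fun k _ => ?_
      exact (DirectSum.of_smul K n _ (e k)).symm
    · rw [← sum_shift (rz_ne_zero _) (rz_ne_zero _)]
      simp only [Finsupp.sum, map_sum, map_smul, algebraMap_smul', he', sym_sum, sym_smul]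
  cases h with
  | different i j hij a b =>
    obtain ⟨e, he, he'⟩ := key i j _ rfl (j, 0) (by rw [if_neg hij]) (ζ.num j i) a b
    obtain ⟨e₂, he₂, he₂'⟩ := key j i _ (add_comm _ _) (i, 0) (by rw [if_neg hij.symm])
      (ζ.num i j) b a
    rw [he, he₂]
    congr 1
    apply Component.ext
    rw [he', he₂', ZetaDatum.eval, ZetaDatum.eval, if_neg hij, if_neg hij.symm]
    congr 1
    ring
  | same i a b =>
    obtain ⟨e, he, he'⟩ := key i i _ rfl (i, 1) (by rw [if_pos rfl]) (ζ.num i i) (a + 1) b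
    obtain ⟨e₂, he₂, he₂'⟩ := key i i _ rfl (i, 1) (by rw [if_pos rfl]) (ζ.num i i) (b + 1) a
    rw [map_neg, he, he₂, ← map_neg]
    congr 1
    apply Component.ext
    rw [he', map_neg, map_neg, he₂']
    have hs : Equiv.swap ((i, 0) : I × ℕ) (i, 1) ∈
        colorPerm (Pi.single i 1 + Pi.single i 1 : I → ℕ) := by
      refine ⟨fun w => ?_, fun w hw => ?_⟩
      · rw [Equiv.swap_apply_def]; split_ifs with h1 h2 <;> simp [*]
      · refine Equiv.swap_apply_of_ne_of_ne ?_ ?_ <;> rintro rfl <;> simp at hw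
    rw [← sym_ratSubst hs, ← sym_neg]
    congr 1
    simp only [map_mul, map_zpow₀, map_laurentEval, map_zeta, map_div₀, ratSubst_rz,
      Equiv.coe_toEmbedding, Equiv.swap_apply_left, Equiv.swap_apply_right]
    have hx := rz_ne_zero (K := K) ((i, 0) : I × ℕ)
    have hy := rz_ne_zero (K := K) ((i, 1) : I × ℕ)
    have hxy : rz K ((i, 0) : I × ℕ) ≠ rz K (i, 1) := fun h => by
      simpa using z_injective (iota_injective h)
    simp only [ZetaDatum.eval, if_true]
    generalize laurentEval (rz K ((i, 0) : I × ℕ) / rz K (i, 1)) (ζ.num i i) = u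
    generalize laurentEval (rz K ((i, 1) : I × ℕ) / rz K (i, 0)) (ζ.num i i) = v
    generalize rz K ((i, 0) : I × ℕ) = X at *
    generalize rz K ((i, 1) : I × ℕ) = Y at *
    have h1 : Y - X ≠ 0 := sub_ne_zero.mpr hxy.symm
    have h2 : X - Y ≠ 0 := sub_ne_zero.mpr hxy
    rw [zpow_add_one₀ hx, zpow_add_one₀ hy, one_sub_div hx, one_sub_div hy]
    field_simp
    ring

/-- The homomorphism `Υ̃⁺ : Ũ⁺ → 𝒱⁺`, `e_{i,d} ↦ z_{i1}^d` (for the datum `ζ.op`: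
`Υ̃⁻ : Ũ⁻ → 𝒱⁻`, `f_{i,d} ↦ z_{i1}^d`). -/
def upsilon (ζ : ZetaDatum K I) : QuadAlg ζ →ₐ[K] BigShuffle ζ :=
  RingQuot.liftAlgHom K
    ⟨FreeAlgebra.lift K fun p : I × ℤ => zgen ζ p.1 p.2, fun _ _ h => zgen_relation ζ h⟩

lemma upsilon_gen (ζ : ZetaDatum K I) (i : I) (d : ℤ) :
    upsilon ζ (QuadAlg.gen ζ i d) = zgen ζ i d := by
  rw [upsilon, QuadAlg.gen, RingQuot.liftAlgHom_mkAlgHom_apply, FreeAlgebra.lift_ι_apply]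

end Algebras

section Expansion

variable {K : Type*} [Field K]

/-- The field in which rational functions of `z_1, …, z_n` (here: `z_0, …, z_{n-1}`) are expanded:
Hahn series in infinitely many variables, for the lexicographic order on exponents. -/
abbrev Series (K : Type*) [Field K] := HahnSeries (Lex (ℕ → ℤ)) K

variable (K) in
/-- The variable `z_a` of the expansion.  For `s = -1` the variable `z_a` is recorded by the exponent
`-1` in position `a`, so that `z_b / z_a` has positive exponent for `a < b` and the expansion is a
power series in `z_2 / z_1, z_3 / z_2, …`, that is in the region `|z_1| ≫ |z_2| ≫ …`.  For `s = 1`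
it is the opposite one, in the region `|z_1| ≪ |z_2| ≪ …`. -/
def sv (s : ℤˣ) (a : ℕ) : Series K := HahnSeries.single (toLex (Pi.single a (s : ℤ))) 1

lemma sv_ne_zero (s : ℤˣ) (a : ℕ) : sv K s a ≠ 0 :=
  HahnSeries.single_ne_zero one_ne_zero

lemma single_zpow (γ : Lex (ℕ → ℤ)) (k : ℤ) :
    (HahnSeries.single γ (1 : K)) ^ k = HahnSeries.single (k • γ) 1 := by
  cases k with
  | ofNat k => rw [Int.ofNat_eq_natCast, zpow_natCast, HahnSeries.single_pow, one_pow,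
      natCast_zsmul]
  | negSucc k =>
    rw [zpow_negSucc, HahnSeries.single_pow, HahnSeries.inv_single, one_pow, inv_one,
      negSucc_zsmul]

/-- A weight on exponents. -/
def wt (n : ℕ) : Lex (ℕ → ℤ) →+ ℤ where
  toFun γ := -∑ a ∈ Finset.range n, (a : ℤ) * ofLex γ a
  map_zero' := by
    rw [neg_eq_zero]
    exact Finset.sum_eq_zero fun a _ => mul_zero (a : ℤ)
  map_add' γ δ := by
    rw [← neg_add, ← Finset.sum_add_distrib]
    exact congrArg _ (Finset.sum_congr rfl fun a _ => mul_add (a : ℤ) (ofLex γ a) (ofLex δ a))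

/-- Series all of whose exponents have weight at least `m`. -/
def fil (K : Type*) [Field K] (n : ℕ) (m : ℤ) : AddSubgroup (Series K) where
  carrier := {f | ∀ γ, f.coeff γ ≠ 0 → m ≤ wt n γ}
  add_mem' := by
    intro f g hf hg γ h
    by_cases h1 : f.coeff γ = 0
    · refine hg γ fun h2 => h ?_
      rw [HahnSeries.coeff_add, h1, h2, add_zero]
    · exact hf γ h1
  zero_mem' := by intro γ h; simp at h
  neg_mem' := by
    intro f hf γ h
    refine hf γ fun h1 => h ?_
    rw [HahnSeries.coeff_neg, h1, neg_zero]

lemma fil_mono (n : ℕ) {m m' : ℤ} (h : m ≤ m') {f : Series K} (hf : f ∈ fil K n m') :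
    f ∈ fil K n m := fun γ hγ => h.trans (hf γ hγ)

lemma fil_mul {n : ℕ} {m m' : ℤ} {f g : Series K} (hf : f ∈ fil K n m) (hg : g ∈ fil K n m') :
    f * g ∈ fil K n (m + m') := by
  intro γ h
  obtain ⟨a, ha, b, hb, rfl⟩ := Set.mem_add.mp (HahnSeries.support_mul_subset h)
  rw [map_add]
  exact add_le_add (hf a ha) (hg b hb)

lemma fil_single {n : ℕ} {γ : Lex (ℕ → ℤ)} {m : ℤ} (h : m ≤ wt n γ) (c : K) :
    HahnSeries.single γ c ∈ fil K n m := by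
  intro δ hδ
  have := HahnSeries.support_single_subset hδ
  rw [Set.mem_singleton_iff.mp this]
  exact h

lemma coeff_zero_of_fil {n : ℕ} {f : Series K} (hf : f ∈ fil K n 1) : f.coeff 0 = 0 := by
  by_contra h
  have := hf 0 h
  rw [map_zero] at this
  omega

lemma fil_prod {α : Type*} (J : Finset α) {n : ℕ} {B : ℤ} {f : α → Series K}
    (hf : ∀ j ∈ J, f j ∈ fil K n (-B)) : ∏ j ∈ J, f j ∈ fil K n (-(B * J.card)) := by
  classical
  induction J using Finset.induction_on with
  | empty =>
    rw [Finset.prod_empty]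
    exact fil_single (by simp) 1
  | insert j J hj ih =>
    rw [Finset.prod_insert hj, Finset.card_insert_of_notMem hj]
    refine fil_mono n ?_ (fil_mul (hf j (Finset.mem_insert_self _ _))
      (ih fun i hi => hf i (Finset.mem_insert_of_mem hi)))
    push_cast
    linarith

lemma fil_prod_sub {α : Type*} (J : Finset α) {n : ℕ} {B M : ℤ} (hB : 0 ≤ B)
    {f g : α → Series K}
    (hf : ∀ j ∈ J, f j ∈ fil K n (-B)) (hg : ∀ j ∈ J, g j ∈ fil K n (-B))
    (h : ∀ j ∈ J, f j - g j ∈ fil K n M) :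
    ∏ j ∈ J, f j - ∏ j ∈ J, g j ∈ fil K n (M - B * J.card) := by
  classical
  induction J using Finset.induction_on with
  | empty => simp only [Finset.prod_empty, sub_self]; exact zero_mem _
  | insert j J hj ih =>
    rw [Finset.prod_insert hj, Finset.prod_insert hj, Finset.card_insert_of_notMem hj]
    have e : f j * ∏ i ∈ J, f i - g j * ∏ i ∈ J, g i =
        f j * (∏ i ∈ J, f i - ∏ i ∈ J, g i) + (f j - g j) * ∏ i ∈ J, g i := by ring
    rw [e]
    refine add_mem (fil_mono n ?_ (fil_mul (hf j (Finset.mem_insert_self _ _))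
      (ih (fun i hi => hf i (Finset.mem_insert_of_mem hi))
        (fun i hi => hg i (Finset.mem_insert_of_mem hi))
        (fun i hi => h i (Finset.mem_insert_of_mem hi)))))
      (fil_mono n ?_ (fil_mul (h j (Finset.mem_insert_self _ _))
        (fil_prod J fun i hi => hg i (Finset.mem_insert_of_mem hi))))
    · push_cast; linarith
    · push_cast; linarith

/-- The embedding of series in one variable, sending the variable to a small monomial. -/
def embOne (γ : Lex (ℕ → ℤ)) (hγ : 0 < γ) : HahnSeries ℤ K →+* Series K :=
  HahnSeries.embDomainRingHom (zmultiplesHom (Lex (ℕ → ℤ)) γ)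
    (fun a b h => by
      simp only [zmultiplesHom_apply] at h
      exact (zsmul_left_strictMono hγ).injective h)
    (fun a b => by
      simp only [zmultiplesHom_apply]
      exact (zsmul_left_strictMono hγ).le_iff_le)

lemma embOne_coeff {γ : Lex (ℕ → ℤ)} (hγ : 0 < γ) (f : HahnSeries ℤ K) {δ : Lex (ℕ → ℤ)}
    (h : (embOne γ hγ f).coeff δ ≠ 0) : ∃ k : ℤ, δ = k • γ ∧ f.coeff k ≠ 0 := by
  obtain ⟨k, hk, rfl⟩ := HahnSeries.support_embDomain_subset h
  exact ⟨k, rfl, hk⟩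

lemma hahn_algebraMap (c : K) :
    algebraMap K (HahnSeries ℤ K) c = HahnSeries.C c := by
  rw [HahnSeries.algebraMap_apply']
  exact HahnSeries.ofPowerSeries_C c

lemma embOne_laurentEval {γ : Lex (ℕ → ℤ)} (hγ : 0 < γ) (p : LaurentPolynomial K) :
    embOne γ hγ (laurentEval (HahnSeries.single (1 : ℤ) (1 : K)) p) =
      laurentEval (HahnSeries.single γ (1 : K)) p := by
  have h1 : ∀ c : K, embOne γ hγ (algebraMap K (HahnSeries ℤ K) c) = algebraMap K (Series K) c := by
    intro c
    rw [hahn_algebraMap, ← HahnSeries.C_eq_algebraMap]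
    exact HahnSeries.embDomainRingHom_C
  have h2 : embOne γ hγ (HahnSeries.single (1 : ℤ) (1 : K)) = HahnSeries.single γ (1 : K) := by
    refine HahnSeries.embDomain_single.trans ?_
    change HahnSeries.single ((1 : ℤ) • γ) (1 : K) = _
    rw [one_zsmul]
  simp only [laurentEval, Finsupp.sum, map_sum, map_mul, map_zpow₀, h1, h2]

lemma laurentEval_coeff (p : LaurentPolynomial K) (k : ℤ) :
    (laurentEval (HahnSeries.single (1 : ℤ) (1 : K)) p).coeff k = p.coeff k := by
  have hz : ∀ j : ℤ, (HahnSeries.single (1 : ℤ) (1 : K)) ^ j = HahnSeries.single j 1 := by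
    intro j
    cases j with
    | ofNat j => rw [Int.ofNat_eq_natCast, zpow_natCast, HahnSeries.single_pow, one_pow]; simp
    | negSucc j =>
      rw [zpow_negSucc, HahnSeries.single_pow, HahnSeries.inv_single, one_pow, inv_one,
        Int.negSucc_eq]
      simp
  simp only [laurentEval, Finsupp.sum, HahnSeries.coeff_sum, hahn_algebraMap, hz,
    HahnSeries.C_mul_eq_smul, HahnSeries.coeff_smul,
    HahnSeries.coeff_single, smul_eq_mul]
  rw [Finset.sum_eq_single k]
  · simp
  · intro j _ hj; simp [hj.symm]
  · intro h; simp [Finsupp.notMem_support_iff.mp h]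

lemma exists_truncation (n : ℕ) (Q : LaurentPolynomial K) :
    ∃ B : ℤ, 0 ≤ B ∧ ∀ M : ℤ, ∃ T : LaurentPolynomial K, ∀ γ : Lex (ℕ → ℤ), 0 < γ →
      1 ≤ wt n γ → wt n γ ≤ n →
      (laurentEval (HahnSeries.single γ (1 : K)) Q)⁻¹ ∈ fil K n (-B) ∧
      laurentEval (HahnSeries.single γ (1 : K)) T ∈ fil K n (-B) ∧
      (laurentEval (HahnSeries.single γ (1 : K)) Q)⁻¹ -
        laurentEval (HahnSeries.single γ (1 : K)) T ∈ fil K n M := by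
  set f : HahnSeries ℤ K := (laurentEval (HahnSeries.single (1 : ℤ) (1 : K)) Q)⁻¹ with hf
  have hord : ∀ k, f.coeff k ≠ 0 → f.order ≤ k := fun k hk =>
    HahnSeries.order_le_of_coeff_ne_zero hk
  have key : ∀ (k : ℤ) (γ : Lex (ℕ → ℤ)), 1 ≤ wt n γ → wt n γ ≤ n → f.order ≤ k →
      -(|f.order| * n) ≤ wt n (k • γ) := by
    intro k γ h1 h2 h3
    rw [map_zsmul, smul_eq_mul]
    have h4 := neg_abs_le f.order
    have h5 := abs_nonneg f.order
    nlinarith [mul_le_mul_of_nonneg_left h2 h5]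
  refine ⟨|f.order| * n, by positivity, fun M => ?_⟩
  set T : LaurentPolynomial K := AddMonoidAlgebra.ofCoeff
    (Finsupp.onFinset (Finset.Ico f.order (max M 0))
      (fun k => if k < max M 0 then f.coeff k else 0) (by
        intro k hk
        rw [Finset.mem_Ico]
        by_cases h : k < max M 0
        · rw [if_pos h] at hk; exact ⟨hord k hk, h⟩
        · rw [if_neg h] at hk; exact absurd rfl hk)) with hT
  have hTc : ∀ k, T.coeff k = if k < max M 0 then f.coeff k else 0 := fun k => rfl
  refine ⟨T, fun γ hγ h1 h2 => ?_⟩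
  have e1 : (laurentEval (HahnSeries.single γ (1 : K)) Q)⁻¹ = embOne γ hγ f := by
    rw [hf, map_inv₀, embOne_laurentEval]
  have e2 : laurentEval (HahnSeries.single γ (1 : K)) T =
      embOne γ hγ (laurentEval (HahnSeries.single (1 : ℤ) (1 : K)) T) := by
    rw [embOne_laurentEval]
  rw [e1, e2, ← map_sub]
  refine ⟨fun δ hδ => ?_, fun δ hδ => ?_, fun δ hδ => ?_⟩
  · obtain ⟨k, rfl, hk⟩ := embOne_coeff hγ _ hδ
    exact key k γ h1 h2 (hord k hk)
  · obtain ⟨k, rfl, hk⟩ := embOne_coeff hγ _ hδ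
    rw [laurentEval_coeff, hTc] at hk
    refine key k γ h1 h2 (hord k ?_)
    split_ifs at hk with h
    · exact hk
    · exact absurd rfl hk
  · obtain ⟨k, rfl, hk⟩ := embOne_coeff hγ _ hδ
    rw [HahnSeries.coeff_sub, laurentEval_coeff, hTc] at hk
    have hkM : max M 0 ≤ k := by
      by_contra h
      rw [if_pos (not_le.mp h), sub_self] at hk
      exact hk rfl
    rw [map_zsmul, smul_eq_mul]
    have h3 : M ≤ k := (le_max_left _ _).trans hkM
    have h4 : 0 ≤ k := (le_max_right _ _).trans hkM
    nlinarith

/-- The expansion of Laurent polynomials. -/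
def expand (s : ℤˣ) : AddMonoidAlgebra K (ℕ →₀ ℤ) →ₐ[K] Series K :=
  AddMonoidAlgebra.lift K _ _
    { toFun := fun m => HahnSeries.single (toLex fun a => (s : ℤ) * m.toAdd a) 1
      map_one' := by
        simp only [toAdd_one, Finsupp.coe_zero, Pi.zero_apply, mul_zero]
        rfl
      map_mul' := fun m m' => by
        rw [HahnSeries.single_mul_single, mul_one, ← toLex_add]
        congr 2
        funext a
        simp [mul_add] }

lemma expand_single (s : ℤˣ) (m : ℕ →₀ ℤ) (c : K) :
    expand s (AddMonoidAlgebra.single m c) =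
      HahnSeries.single (toLex fun a => (s : ℤ) * m a) c := by
  rw [expand, AddMonoidAlgebra.lift_single]
  change c • HahnSeries.single (toLex fun a => (s : ℤ) * m a) (1 : K) = _
  rw [← HahnSeries.C_mul_eq_smul, HahnSeries.C_apply, HahnSeries.single_mul_single, zero_add,
    mul_one]

/-- Permutation of the variables. -/
def permVar (σ : Equiv.Perm ℕ) : AddMonoidAlgebra K (ℕ →₀ ℤ) →ₐ[K] AddMonoidAlgebra K (ℕ →₀ ℤ) :=
  AddMonoidAlgebra.mapDomainAlgHom K K (Finsupp.mapDomain.addMonoidHom σ)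

lemma permVar_single (σ : Equiv.Perm ℕ) (m : ℕ →₀ ℤ) (c : K) :
    permVar σ (AddMonoidAlgebra.single m c) = AddMonoidAlgebra.single (m.mapDomain σ) c := by
  simp [permVar]

/-- Pairs of expansions of a Laurent polynomial and of its image under a permutation. -/
def swp (K : Type*) [Field K] (s : ℤˣ) (σ : Equiv.Perm ℕ) : Subalgebra K (Series K × Series K) :=
  ((expand s).prod ((expand s).comp (permVar σ))).range

lemma coeff_zero_of_swp {s : ℤˣ} {σ : Equiv.Perm ℕ} {f g : Series K} (h : (f, g) ∈ swp K s σ) :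
    f.coeff 0 = g.coeff 0 := by
  obtain ⟨P, hP⟩ := h
  obtain ⟨rfl, rfl⟩ := Prod.mk.inj hP
  change (expand s P).coeff 0 = (expand s (permVar σ P)).coeff 0
  clear hP
  induction P using AddMonoidAlgebra.induction_linear with
  | zero => simp
  | add P Q hP hQ =>
    simp only [map_add, HahnSeries.coeff_add]
    rw [hP, hQ]
  | single m c =>
    rw [permVar_single, expand_single, expand_single]
    by_cases hm : m = 0
    · subst hm; simp
    · have h1 : ∀ m : ℕ →₀ ℤ, m ≠ 0 → (0 : Lex (ℕ → ℤ)) ≠ toLex fun a => (s : ℤ) * m a := by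
        intro m hm h0
        apply hm
        ext a
        have h2 : (0 : ℤ) = (s : ℤ) * m a := congrFun (congrArg ofLex h0) a
        exact (mul_eq_zero.mp h2.symm).resolve_left s.ne_zero
      rw [HahnSeries.coeff_single_of_ne (h1 m hm), HahnSeries.coeff_single_of_ne (h1 _ ?_)]
      intro h0
      apply hm
      exact Finsupp.mapDomain_injective σ.injective (h0.trans Finsupp.mapDomain_zero.symm)

lemma exists_fil (n : ℕ) (f : AddMonoidAlgebra K (ℕ →₀ ℤ)) (s : ℤˣ) :
    ∃ m, expand s f ∈ fil K n m := by
  induction f using AddMonoidAlgebra.induction_linear with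
  | zero => exact ⟨0, by rw [map_zero]; exact zero_mem _⟩
  | add P Q hP hQ =>
    obtain ⟨m, hm⟩ := hP
    obtain ⟨m', hm'⟩ := hQ
    refine ⟨min m m', ?_⟩
    rw [map_add]
    exact add_mem (fil_mono n (min_le_left _ _) hm) (fil_mono n (min_le_right _ _) hm')
  | single m c => exact ⟨_, by rw [expand_single]; exact fil_single le_rfl c⟩

lemma sv_zpow (s : ℤˣ) (a : ℕ) (k : ℤ) :
    sv K s a ^ k = expand s (AddMonoidAlgebra.single (Finsupp.single a k) 1) := by
  rw [sv, single_zpow, expand_single]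
  have : k • toLex (Pi.single a (s : ℤ)) = toLex fun b => (s : ℤ) * Finsupp.single a k b := ?_
  · rw [this]
  funext b
  change k * Pi.single (M := fun _ => ℤ) a (s : ℤ) b = (s : ℤ) * Finsupp.single a k b
  rw [Pi.single_apply, Finsupp.single_apply]
  by_cases h : b = a
  · subst h; simp [mul_comm]
  · simp [h, Ne.symm h]

lemma sv_mem_swp (s : ℤˣ) (σ : Equiv.Perm ℕ) (a : ℕ) (k : ℤ) :
    (sv K s a ^ k, sv K s (σ a) ^ k) ∈ swp K s σ := by
  refine ⟨AddMonoidAlgebra.single (Finsupp.single a k) 1, ?_⟩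
  rw [sv_zpow, sv_zpow]
  change (expand s _, expand s (permVar σ _)) = _
  rw [permVar_single, Finsupp.mapDomain_single]

lemma laurentEval_mem_swp (s : ℤˣ) (σ : Equiv.Perm ℕ) (a b : ℕ) (p : LaurentPolynomial K) :
    (laurentEval (sv K s b / sv K s a) p, laurentEval (sv K s (σ b) / sv K s (σ a)) p) ∈
      swp K s σ := by
  have : (laurentEval (sv K s b / sv K s a) p, laurentEval (sv K s (σ b) / sv K s (σ a)) p) =
      ∑ k ∈ p.coeff.support, p.coeff k •
        ((sv K s b ^ k, sv K s (σ b) ^ k) * (sv K s a ^ (-k), sv K s (σ a) ^ (-k))) := by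
    simp only [laurentEval, Finsupp.sum]
    ext1
    · rw [Prod.fst_sum]
      refine Finset.sum_congr rfl fun k _ => ?_
      simp [Algebra.smul_def, div_eq_mul_inv, mul_zpow]
    · rw [Prod.snd_sum]
      refine Finset.sum_congr rfl fun k _ => ?_
      simp [Algebra.smul_def, div_eq_mul_inv, mul_zpow]
  rw [this]
  exact sum_mem fun k _ => Subalgebra.smul_mem _
    (mul_mem (sv_mem_swp s σ b k) (sv_mem_swp s σ a (-k))) _

lemma ratio_eq (s : ℤˣ) (a b : ℕ) :
    sv K s b / sv K s a =
      HahnSeries.single (toLex (Pi.single b (s : ℤ)) - toLex (Pi.single a (s : ℤ))) 1 := by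
  rw [sv, sv, div_eq_mul_inv, HahnSeries.inv_single, HahnSeries.single_mul_single, inv_one,
    mul_one, sub_eq_add_neg]

/-- The small exponent `e_a - e_b` for `a < b`. -/
def smallExp (a b : ℕ) : Lex (ℕ → ℤ) := toLex (Pi.single a 1 - Pi.single b 1)

lemma smallExp_pos {a b : ℕ} (h : a < b) : 0 < smallExp a b := by
  refine ⟨a, fun j hj => ?_, ?_⟩
  · change (0 : ℤ) = Pi.single (M := fun _ => ℤ) a 1 j - Pi.single (M := fun _ => ℤ) b 1 j
    rw [Pi.single_eq_of_ne (by omega), Pi.single_eq_of_ne (by omega)]; rfl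
  · change (0 : ℤ) < Pi.single (M := fun _ => ℤ) a 1 a - Pi.single (M := fun _ => ℤ) b 1 a
    rw [Pi.single_eq_same, Pi.single_eq_of_ne (by omega)]; norm_num

lemma wt_smallExp {n a b : ℕ} (ha : a < n) (hb : b < n) : wt n (smallExp a b) = b - a := by
  change -∑ c ∈ Finset.range n, (c : ℤ) *
    (Pi.single (M := fun _ => ℤ) a 1 c - Pi.single (M := fun _ => ℤ) b 1 c) = _
  simp only [mul_sub, Finset.sum_sub_distrib, Pi.single_apply, mul_ite, mul_one, mul_zero]
  rw [Finset.sum_ite_eq', Finset.sum_ite_eq', if_pos (Finset.mem_range.mpr ha),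
    if_pos (Finset.mem_range.mpr hb)]
  ring

lemma ratio_eq_smallExp (s : ℤˣ) (a b : ℕ) (p : LaurentPolynomial K) :
    laurentEval (sv K s b / sv K s a) p =
      laurentEval (HahnSeries.single (smallExp a b) (1 : K))
        (if s = 1 then LaurentPolynomial.invert p else p) := by
  rw [ratio_eq]
  rcases Int.units_eq_one_or s with rfl | rfl
  · rw [if_pos rfl, laurentEval_invert, HahnSeries.inv_single, inv_one]
    congr 2
    rw [smallExp]
    simp
  · rw [if_neg (by decide)]
    congr 2
    rw [smallExp]
    simp only [Units.val_neg, Units.val_one, Pi.single_neg]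
    rw [← toLex_sub]
    congr 1
    exact (neg_sub_neg _ _)

/-- Constant terms do not change under a permutation of the variables that keeps all expansions
of the denominators in the same region. -/
theorem coeff_zero_div_eq (s : ℤˣ) (σ : Equiv.Perm ℕ) (n : ℕ) (J : Finset (ℕ × ℕ))
    (hJ : ∀ j ∈ J, j.1 < j.2 ∧ j.2 < n) (hJσ : ∀ j ∈ J, σ j.1 < σ j.2 ∧ σ j.2 < n)
    (Q : ℕ × ℕ → LaurentPolynomial K) {f g : Series K}
    (hfg : (f, g) ∈ swp K s σ) :
    (f / ∏ j ∈ J, laurentEval (sv K s j.2 / sv K s j.1) (Q j)).coeff 0 =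
      (g / ∏ j ∈ J, laurentEval (sv K s (σ j.2) / sv K s (σ j.1)) (Q j)).coeff 0 := by
  set Q' : ℕ × ℕ → LaurentPolynomial K := fun j =>
    if s = 1 then LaurentPolynomial.invert (Q j) else Q j with hQ'
  choose B hB0 hB using fun j => exists_truncation n (Q' j)
  obtain ⟨P, hP⟩ := hfg
  obtain ⟨rfl, rfl⟩ := Prod.mk.inj hP
  change ((expand s P) / _).coeff 0 = ((expand s (permVar σ P)) / _).coeff 0
  obtain ⟨m₁, hm₁⟩ := exists_fil n P s
  obtain ⟨m₂, hm₂⟩ := exists_fil n (permVar σ P) s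
  set C := ∑ j ∈ J, B j with hC
  have hC0 : 0 ≤ C := Finset.sum_nonneg fun j _ => hB0 j
  have hBC : ∀ j ∈ J, B j ≤ C := fun j hj => Finset.single_le_sum (fun i _ => hB0 i) hj
  choose T hT using fun j => hB j (1 + C * J.card - min m₁ m₂)
  set T' : ℕ × ℕ → LaurentPolynomial K := fun j =>
    if s = 1 then LaurentPolynomial.invert (T j) else T j with hT'
  have hTT : ∀ j, T j = if s = 1 then LaurentPolynomial.invert (T' j) else T' j := by
    intro j
    simp only [hT']
    split_ifs
    · exact (LaurentPolynomial.involutive_invert (T j)).symm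
    · rfl
  have main : ∀ (τ : Equiv.Perm ℕ) (h : Series K) (m : ℤ), h ∈ fil K n m → min m₁ m₂ ≤ m →
      (∀ j ∈ J, τ j.1 < τ j.2 ∧ τ j.2 < n) →
      (h / ∏ j ∈ J, laurentEval (sv K s (τ j.2) / sv K s (τ j.1)) (Q j)).coeff 0 =
      (h * ∏ j ∈ J, laurentEval (sv K s (τ j.2) / sv K s (τ j.1)) (T' j)).coeff 0 := by
    intro τ h m hm hmm hτ
    rw [div_eq_mul_inv, ← Finset.prod_inv_distrib, ← sub_eq_zero, ← HahnSeries.coeff_sub,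
      ← mul_sub]
    refine coeff_zero_of_fil (n := n) ?_
    have hj : ∀ j ∈ J,
        (laurentEval (sv K s (τ j.2) / sv K s (τ j.1)) (Q j))⁻¹ ∈ fil K n (-C) ∧
        laurentEval (sv K s (τ j.2) / sv K s (τ j.1)) (T' j) ∈ fil K n (-C) ∧
        (laurentEval (sv K s (τ j.2) / sv K s (τ j.1)) (Q j))⁻¹ -
          laurentEval (sv K s (τ j.2) / sv K s (τ j.1)) (T' j) ∈
          fil K n (1 + C * J.card - min m₁ m₂) := by
      intro j hj
      obtain ⟨h1, h2⟩ := hτ j hj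
      rw [ratio_eq_smallExp, ratio_eq_smallExp, ← hTT]
      have h3 := wt_smallExp (h1.trans h2) h2
      obtain ⟨g1, g2, g3⟩ := hT j (smallExp (τ j.1) (τ j.2)) (smallExp_pos h1)
        (by rw [h3]; omega) (by rw [h3]; omega)
      have h4 := hBC j hj
      exact ⟨fil_mono n (by omega) g1, fil_mono n (by omega) g2, g3⟩
    refine fil_mono n ?_ (fil_mul hm (fil_prod_sub J hC0 (fun j h => (hj j h).1)
      (fun j h => (hj j h).2.1) (fun j h => (hj j h).2.2)))
    linarith
  rw [main σ _ m₂ hm₂ (min_le_right _ _) hJσ]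
  have h1 := main 1 _ m₁ hm₁ (min_le_left _ _) hJ
  simp only [Equiv.Perm.one_apply] at h1
  rw [h1]
  apply coeff_zero_of_swp (s := s) (σ := σ)
  have h2 : (expand s P, expand s (permVar σ P)) ∈ swp K s σ := ⟨P, rfl⟩
  have h3 := mul_mem h2 (prod_mem fun j (_ : j ∈ J) => laurentEval_mem_swp s σ j.1 j.2 (T' j))
  convert h3 using 1
  ext1
  · simp [Prod.fst_prod]
  · simp [Prod.snd_prod]

end Expansion

section ConstantTerms

variable {K I : Type*} [Field K] [CharZero K] [DecidableEq I]

/-- The pairs `(a, b)` with `a < b < n`. -/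
def placePairs (n : ℕ) : Finset (ℕ × ℕ) :=
  (Finset.range n ×ˢ Finset.range n).filter fun p => p.1 < p.2

lemma mem_placePairs {n : ℕ} {p : ℕ × ℕ} : p ∈ placePairs n ↔ p.1 < p.2 ∧ p.2 < n := by
  simp only [placePairs, Finset.mem_filter, Finset.mem_product, Finset.mem_range]
  omega

/-- The index of the variable of color `c a` at the place `a`. -/
def label (c : ℕ → I) (a : ℕ) : I × ℕ := (c a, ((Finset.range a).filter fun b => c b = c a).card)

/-- Evaluation of a Laurent polynomial at the variables of colors `c 0, …, c (n - 1)`. -/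
def evalVars (F : Type*) [Field F] [Algebra K F] (t : ℕ → F) (n : ℕ) (c : ℕ → I)
    (R : Laurent K I) : F :=
  R.coeff.sum fun m x => algebraMap K F x * ∏ a ∈ Finset.range n, t a ^ m (label c a)

/-- The constant term that defines the pairing, with words given by sequences. -/
def seqPairing (s : ℤˣ) (ζ : ZetaDatum K I) (n : ℕ) (c : ℕ → I) (d : ℕ → ℤ) (R : Laurent K I) : K :=
  ((∏ a ∈ Finset.range n, sv K s a ^ d a) * evalVars (Series K) (sv K s) n c R /
    ∏ p ∈ placePairs n, ζ.eval (c p.2) (c p.1) (sv K s p.2 / sv K s p.1)).coeff 0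

lemma laurentEval_ratio_ne_zero (s : ℤˣ) {a b : ℕ} (hab : a < b) {p : LaurentPolynomial K}
    (hp : p ≠ 0) : laurentEval (sv K s b / sv K s a) p ≠ 0 := by
  rw [ratio_eq_smallExp]
  have hq : (if s = 1 then LaurentPolynomial.invert p else p) ≠ 0 := by
    split_ifs
    · simpa using hp
    · exact hp
  generalize (if s = 1 then LaurentPolynomial.invert p else p) = q at hq
  rw [← embOne_laurentEval (smallExp_pos hab)]
  intro h
  have h1 := (embOne (K := K) _ (smallExp_pos hab)).injective (h.trans (map_zero _).symm)
  apply hq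
  ext k
  rw [← laurentEval_coeff, h1]
  rfl

lemma ratio_ne_one (s : ℤˣ) {a b : ℕ} (hab : a < b) : 1 - sv K s b / sv K s a ≠ 0 := by
  have h := laurentEval_ratio_ne_zero (K := K) s hab
    (p := LaurentPolynomial.T 0 - LaurentPolynomial.T 1) (by
      intro h
      have := congrArg (fun p : LaurentPolynomial K => p.coeff 0) h
      simp only [LaurentPolynomial.T, AddMonoidAlgebra.coeff_sub, AddMonoidAlgebra.coeff_single,
        Finsupp.sub_apply, Finsupp.single_apply, AddMonoidAlgebra.coeff_zero] at this
      norm_num at this)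
  have hx : sv K s b / sv K s a ≠ 0 := div_ne_zero (sv_ne_zero _ _) (sv_ne_zero _ _)
  rwa [laurentEval_eq_lift hx, map_sub, ← laurentEval_eq_lift hx, ← laurentEval_eq_lift hx,
    laurentEval_T, laurentEval_T, zpow_zero, zpow_one] at h

lemma eval_ratio_ne_zero (s : ℤˣ) (ζ : ZetaDatum K I) (i j : I) {a b : ℕ} (hab : a < b) :
    ζ.eval i j (sv K s b / sv K s a) ≠ 0 := by
  refine div_ne_zero (laurentEval_ratio_ne_zero s hab (ζ.num_ne_zero i j)) ?_
  split_ifs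
  · exact ratio_ne_one s hab
  · exact one_ne_zero

/-- The transposition of the places `p` and `p + 1`. -/
def tr (p : ℕ) : Equiv.Perm ℕ := Equiv.swap p (p + 1)

lemma tr_left (p : ℕ) : tr p p = p + 1 := Equiv.swap_apply_left _ _
lemma tr_right (p : ℕ) : tr p (p + 1) = p := Equiv.swap_apply_right _ _
lemma tr_of_ne {p a : ℕ} (h1 : a ≠ p) (h2 : a ≠ p + 1) : tr p a = a :=
  Equiv.swap_apply_of_ne_of_ne h1 h2
lemma tr_tr (p a : ℕ) : tr p (tr p a) = a := Equiv.swap_apply_self _ _ _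

lemma tr_cases (p a : ℕ) : (a = p ∧ tr p a = p + 1) ∨ (a = p + 1 ∧ tr p a = p) ∨
    (a ≠ p ∧ a ≠ p + 1 ∧ tr p a = a) := by
  by_cases h1 : a = p
  · subst h1; exact Or.inl ⟨rfl, tr_left _⟩
  · by_cases h2 : a = p + 1
    · subst h2; exact Or.inr (Or.inl ⟨rfl, tr_right _⟩)
    · exact Or.inr (Or.inr ⟨h1, h2, tr_of_ne h1 h2⟩)

lemma tr_lt {p n : ℕ} (hp : p + 1 < n) (a : ℕ) : tr p a < n ↔ a < n := by
  rcases tr_cases p a with h | h | h <;> omega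

/-- The pairs of places other than `(p, p + 1)`. -/
def otherPairs (n p : ℕ) : Finset (ℕ × ℕ) := (placePairs n).erase (p, p + 1)

lemma mem_otherPairs {n p : ℕ} {x : ℕ × ℕ} :
    x ∈ otherPairs n p ↔ (x.1 < x.2 ∧ x.2 < n) ∧ ¬ (x.1 = p ∧ x.2 = p + 1) := by
  rw [otherPairs, Finset.mem_erase, mem_placePairs, and_comm, Ne, Prod.ext_iff]

lemma tr_otherPairs {n p : ℕ} (hp : p + 1 < n) {x : ℕ × ℕ} (hx : x ∈ otherPairs n p) :
    (tr p x.1, tr p x.2) ∈ otherPairs n p := by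
  rw [mem_otherPairs] at hx ⊢
  dsimp only
  rcases tr_cases p x.1 with h | h | h <;> rcases tr_cases p x.2 with h' | h' | h' <;> omega

lemma prod_otherPairs {F : Type*} [CommMonoid F] {n p : ℕ} (hp : p + 1 < n) (f : ℕ → ℕ → F) :
    ∏ x ∈ otherPairs n p, f (tr p x.1) (tr p x.2) = ∏ x ∈ otherPairs n p, f x.1 x.2 := by
  refine Finset.prod_bij' (fun x _ => (tr p x.1, tr p x.2)) (fun x _ => (tr p x.1, tr p x.2))
    (fun x hx => tr_otherPairs hp hx) (fun x hx => tr_otherPairs hp hx) ?_ ?_ ?_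
  · intro x _; simp [tr_tr]
  · intro x _; simp [tr_tr]
  · intro x _; rfl

lemma prod_placePairs {F : Type*} [CommMonoid F] {n p : ℕ} (hp : p + 1 < n) (f : ℕ × ℕ → F) :
    ∏ x ∈ placePairs n, f x = f (p, p + 1) * ∏ x ∈ otherPairs n p, f x :=
  (Finset.mul_prod_erase (placePairs n) f (mem_placePairs.mpr ⟨Nat.lt_succ_self p, hp⟩)).symm

lemma prod_pair_mem {F α : Type*} [Field F] [Algebra K F] (S : Subalgebra K (F × F))
    (t : Finset α) (f g : α → F) (h : ∀ a ∈ t, (f a, g a) ∈ S) :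
    (∏ a ∈ t, f a, ∏ a ∈ t, g a) ∈ S := by
  have e : (∏ a ∈ t, f a, ∏ a ∈ t, g a) = ∏ a ∈ t, (f a, g a) := by
    ext1
    · rw [Prod.fst_prod]
    · rw [Prod.snd_prod]
  rw [e]
  exact prod_mem h

/-- Exchanging two neighbours in a constant term without the corresponding factor. -/
lemma coeff_zero_tr (s : ℤˣ) (ζ : ZetaDatum K I) {n p : ℕ} (hp : p + 1 < n) (c : ℕ → I)
    {f g : Series K} (hfg : (f, g) ∈ swp K s (tr p)) :
    (f / ∏ x ∈ otherPairs n p, ζ.eval (c x.2) (c x.1) (sv K s x.2 / sv K s x.1)).coeff 0 =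
    (g / ∏ x ∈ otherPairs n p,
      ζ.eval (c (tr p x.2)) (c (tr p x.1)) (sv K s x.2 / sv K s x.1)).coeff 0 := by
  have e : ∏ x ∈ otherPairs n p,
      ζ.eval (c (tr p x.2)) (c (tr p x.1)) (sv K s x.2 / sv K s x.1) =
      ∏ x ∈ otherPairs n p,
        ζ.eval (c x.2) (c x.1) (sv K s (tr p x.2) / sv K s (tr p x.1)) := by
    refine (prod_otherPairs hp fun a b =>
      ζ.eval (c (tr p b)) (c (tr p a)) (sv K s b / sv K s a)).symm.trans ?_
    simp only [tr_tr]
  rw [e]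
  simp only [ZetaDatum.eval, Finset.prod_div_distrib]
  rw [div_div_eq_mul_div, div_div_eq_mul_div]
  refine coeff_zero_div_eq s (tr p) n (otherPairs n p) (fun j hj => (mem_otherPairs.mp hj).1)
    (fun j hj => (mem_otherPairs.mp (tr_otherPairs hp hj)).1)
    (fun j => ζ.num (c j.2) (c j.1)) ?_
  rw [← Prod.mk_mul_mk]
  refine mul_mem hfg (prod_pair_mem _ _ _ _ fun x _ => ?_)
  split_ifs
  · have h2 := laurentEval_mem_swp (K := K) s (tr p) x.1 x.2 (LaurentPolynomial.T 1)
    rw [laurentEval_T, laurentEval_T, zpow_one, zpow_one] at h2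
    exact sub_mem (one_mem _) h2
  · exact one_mem _

lemma label_inj {c : ℕ → I} {a b : ℕ} (h : label c a = label c b) : a = b := by
  have key : ∀ {a b : ℕ}, a < b → label c a ≠ label c b := by
    intro a b hab h
    simp only [label, Prod.mk.injEq] at h
    obtain ⟨h1, h2⟩ := h
    have : ((Finset.range a).filter fun x => c x = c a) ⊂
        (Finset.range b).filter fun x => c x = c b := by
      rw [Finset.ssubset_iff_of_subset]
      · refine ⟨a, ?_, ?_⟩
        · simp [hab, h1]
        · simp
      · intro x
        simp only [Finset.mem_filter, Finset.mem_range]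
        rintro ⟨h3, h4⟩
        exact ⟨h3.trans hab, h4.trans h1⟩
    have := Finset.card_lt_card this
    omega
  rcases lt_trichotomy a b with h' | h' | h'
  · exact absurd h (key h')
  · exact h'
  · exact absurd h.symm (key h')

/-- The degree of a word. -/
def seqDeg (n : ℕ) (c : ℕ → I) (i : I) : ℕ := ((Finset.range n).filter fun b => c b = i).card

lemma seqDeg_tr {n p : ℕ} (hp : p + 1 < n) (c : ℕ → I) :
    seqDeg n (fun a => c (tr p a)) = seqDeg n c := by
  funext i
  refine Finset.card_bij (fun a _ => tr p a) ?_ ?_ ?_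
  · intro a
    simp only [Finset.mem_filter, Finset.mem_range, tr_lt hp]
    exact id
  · intro a _ b _ h
    exact (tr p).injective h
  · intro a
    simp only [Finset.mem_filter, Finset.mem_range]
    intro h
    exact ⟨tr p a, ⟨(tr_lt hp a).mpr h.1, by rw [tr_tr]; exact h.2⟩, tr_tr _ _⟩

lemma label_lt {n a : ℕ} (ha : a < n) (c : ℕ → I) :
    (label c a).2 < seqDeg n c (label c a).1 := by
  change ((Finset.range a).filter fun b => c b = c a).card <
    ((Finset.range n).filter fun b => c b = c a).card
  refine Finset.card_lt_card ?_
  rw [Finset.ssubset_iff_of_subset]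
  · exact ⟨a, by simp [ha], by simp⟩
  · intro x
    simp only [Finset.mem_filter, Finset.mem_range]
    rintro ⟨h3, h4⟩
    exact ⟨h3.trans ha, h4⟩

lemma count_tr {c : ℕ → I} {p : ℕ} (h : c p ≠ c (p + 1)) (a : ℕ) (y : I)
    (hy : c (tr p a) = y) :
    ((Finset.range a).filter fun b => c (tr p b) = y).card =
      ((Finset.range (tr p a)).filter fun b => c b = y).card := by
  rcases tr_cases p a with ⟨rfl, h1⟩ | ⟨rfl, h1⟩ | ⟨h1, h2, h3⟩
  · rw [h1]
    congr 1
    ext x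
    simp only [Finset.mem_filter, Finset.mem_range]
    constructor
    · rintro ⟨h2, h3⟩
      rw [tr_of_ne (by omega) (by omega)] at h3
      exact ⟨by omega, h3⟩
    · rintro ⟨h2, h3⟩
      have : x ≠ a := by rintro rfl; rw [h1] at hy; exact h (h3.trans hy.symm)
      rw [tr_of_ne (by omega) (by omega)]
      exact ⟨by omega, h3⟩
  · rw [h1]
    congr 1
    ext x
    simp only [Finset.mem_filter, Finset.mem_range]
    constructor
    · rintro ⟨h2, h3⟩
      have : x ≠ p := by
        rintro rfl
        rw [tr_left] at h3
        rw [h1] at hy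
        exact h (hy.trans h3.symm)
      rw [tr_of_ne (by omega) (by omega)] at h3
      exact ⟨by omega, h3⟩
    · rintro ⟨h2, h3⟩
      rw [tr_of_ne (by omega) (by omega)]
      exact ⟨by omega, h3⟩
  · rw [h3]
    refine Finset.card_bij (fun x _ => tr p x) ?_ ?_ ?_
    · intro x
      simp only [Finset.mem_filter, Finset.mem_range]
      rintro ⟨h4, h5⟩
      refine ⟨?_, h5⟩
      rcases tr_cases p x with h | h | h <;> omega
    · intro x _ y _ h
      exact (tr p).injective h
    · intro x
      simp only [Finset.mem_filter, Finset.mem_range]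
      rintro ⟨h4, h5⟩
      refine ⟨tr p x, ⟨?_, ?_⟩, tr_tr _ _⟩
      · rcases tr_cases p x with h | h | h <;> omega
      · rw [tr_tr]; exact h5

lemma label_tr {c : ℕ → I} {p : ℕ} (h : c p ≠ c (p + 1)) (a : ℕ) :
    label (fun a => c (tr p a)) a = label c (tr p a) :=
  Prod.ext rfl (count_tr h a _ rfl)

lemma evalVars_swp (s : ℤˣ) (σ : Equiv.Perm ℕ) (n : ℕ) (c : ℕ → I) (R : Laurent K I) :
    (evalVars (Series K) (sv K s) n c R,
      evalVars (Series K) (fun a => sv K s (σ a)) n c R) ∈ swp K s σ := by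
  have : (evalVars (Series K) (sv K s) n c R,
      evalVars (Series K) (fun a => sv K s (σ a)) n c R) =
      ∑ m ∈ R.coeff.support, R.coeff m •
        ∏ a ∈ Finset.range n, (sv K s a ^ m (label c a), sv K s (σ a) ^ m (label c a)) := by
    simp only [evalVars, Finsupp.sum]
    ext1
    · rw [Prod.fst_sum]
      refine Finset.sum_congr rfl fun k _ => ?_
      rw [Prod.smul_fst, Prod.fst_prod, Algebra.smul_def]
    · rw [Prod.snd_sum]
      refine Finset.sum_congr rfl fun k _ => ?_
      rw [Prod.smul_snd, Prod.snd_prod, Algebra.smul_def]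
  rw [this]
  exact sum_mem fun m _ => Subalgebra.smul_mem _ (prod_mem fun a _ => sv_mem_swp s σ a _) _

lemma evalVars_tr {F : Type*} [Field F] [Algebra K F] (t : ℕ → F) {n p : ℕ} (hp : p + 1 < n)
    (c : ℕ → I) {R : Laurent K I} (hR : R ∈ symLaurent K (seqDeg n c)) :
    evalVars F (fun a => t (tr p a)) n c R = evalVars F t n (fun a => c (tr p a)) R := by
  have h0 : ∀ m : I × ℕ →₀ ℤ, ∏ a ∈ Finset.range n, t (tr p a) ^ m (label c a) =
      ∏ a ∈ Finset.range n, t a ^ m (label c (tr p a)) := by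
    intro m
    refine Finset.prod_bij' (fun a _ => tr p a) (fun a _ => tr p a) ?_ ?_ ?_ ?_ ?_
    · intro a ha; simpa [tr_lt hp] using ha
    · intro a ha; simpa [tr_lt hp] using ha
    · intro a _; exact tr_tr _ _
    · intro a _; exact tr_tr _ _
    · intro a _; rw [tr_tr]
  unfold evalVars
  simp only [h0]
  by_cases hc : c p = c (p + 1)
  · have hcc : (fun a => c (tr p a)) = c := by
      funext a
      rcases tr_cases p a with ⟨rfl, h⟩ | ⟨rfl, h⟩ | ⟨_, _, h⟩ <;> rw [h]
      · exact hc.symm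
      · exact hc
    rw [hcc]
    set τ : Equiv.Perm (I × ℕ) := Equiv.swap (label c p) (label c (p + 1)) with hτ
    have hτm : τ ∈ colorPerm (seqDeg n c) := by
      have l1 := label_lt (by omega : p < n) c
      have l2 := label_lt hp c
      refine ⟨fun w => ?_, fun w hw => ?_⟩
      · rw [hτ, Equiv.swap_apply_def]
        split_ifs with h1 h2
        · rw [h1]; exact hc.symm
        · rw [h2]; exact hc
        · rfl
      · refine Equiv.swap_apply_of_ne_of_ne ?_ ?_
        · rintro rfl; omega
        · rintro rfl; omega
    have hτl : ∀ a, τ (label c (tr p a)) = label c a := by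
      intro a
      rcases tr_cases p a with ⟨rfl, h⟩ | ⟨rfl, h⟩ | ⟨h1, h2, h⟩
      · rw [h]; exact Equiv.swap_apply_right _ _
      · rw [h]; exact Equiv.swap_apply_left _ _
      · rw [h]
        exact Equiv.swap_apply_of_ne_of_ne (fun h => h1 (label_inj h)) (fun h => h2 (label_inj h))
    have h1 : (subst K τ R).coeff = R.coeff.mapDomain (Finsupp.mapDomain τ) := rfl
    conv_rhs => rw [← hR.2 τ hτm, h1]
    rw [Finsupp.sum_mapDomain_index (by simp) (by intros; rw [map_add, add_mul])]
    refine Finsupp.sum_congr fun m _ => ?_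
    congr 1
    refine Finset.prod_congr rfl fun a _ => ?_
    rw [← hτl a, Finsupp.mapDomain_apply τ.injective]
  · refine Finsupp.sum_congr fun m _ => ?_
    congr 1
    refine Finset.prod_congr rfl fun a _ => ?_
    rw [label_tr hc]

/-- The exponents `d`, with the values at the places `p` and `p + 1` replaced. -/
def upd (d : ℕ → ℤ) (p : ℕ) (x y : ℤ) (a : ℕ) : ℤ :=
  if a = p then x else if a = p + 1 then y else d a

lemma prod_upd {F : Type*} [Field F] (t : ℕ → F) (d : ℕ → ℤ) {n p : ℕ} (hp : p + 1 < n)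
    (x y : ℤ) :
    ∏ a ∈ Finset.range n, t a ^ upd d p x y a =
      t p ^ x * t (p + 1) ^ y * ∏ a ∈ ((Finset.range n).erase p).erase (p + 1), t a ^ d a := by
  rw [← Finset.mul_prod_erase (Finset.range n) _ (Finset.mem_range.mpr (by omega : p < n)),
    ← Finset.mul_prod_erase ((Finset.range n).erase p) _
      (Finset.mem_erase.mpr ⟨Nat.succ_ne_self p, Finset.mem_range.mpr hp⟩), ← mul_assoc]
  congr 1
  · simp [upd]
  · refine Finset.prod_congr rfl fun a ha => ?_
    simp only [Finset.mem_erase] at ha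
    simp [upd, ha.1, ha.2.1]

lemma coeff_zero_smul_sum (S : Finset ℤ) (x : ℤ → K) (f : ℤ → Series K) :
    ∑ k ∈ S, x k • (f k).coeff 0 = (∑ k ∈ S, x k • f k).coeff 0 := by
  rw [HahnSeries.coeff_sum]
  rfl

lemma div_aux {F : Type*} [Field F] (u x y e t : F) :
    u * x * (y / (e * t)) = u * (x / e) * y / t := by
  simp only [div_eq_mul_inv, mul_inv]
  ring

/-- A linear combination of constant terms. -/
lemma sum_seqPairing (s : ℤˣ) (ζ : ZetaDatum K I) {n p : ℕ} (hp : p + 1 < n) (c : ℕ → I)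
    (d : ℕ → ℤ) (R : Laurent K I) (A B : ℤ) (N : LaurentPolynomial K) :
    (N.coeff.sum fun k x => x • seqPairing s ζ n c (upd d p (A - k) (B + k)) R) =
      ((sv K s p ^ A * sv K s (p + 1) ^ B *
        (laurentEval (sv K s (p + 1) / sv K s p) N /
          ζ.eval (c (p + 1)) (c p) (sv K s (p + 1) / sv K s p)) *
        ((∏ a ∈ ((Finset.range n).erase p).erase (p + 1), sv K s a ^ d a) *
          evalVars (Series K) (sv K s) n c R)) /
        ∏ x ∈ otherPairs n p, ζ.eval (c x.2) (c x.1) (sv K s x.2 / sv K s x.1)).coeff 0 := by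
  have h := sum_shift (K := K) (sv_ne_zero (K := K) s p) (sv_ne_zero s (p + 1)) N A B
    (((∏ a ∈ ((Finset.range n).erase p).erase (p + 1), sv K s a ^ d a) *
        evalVars (Series K) (sv K s) n c R) /
      ∏ x ∈ placePairs n, ζ.eval (c x.2) (c x.1) (sv K s x.2 / sv K s x.1))
  simp only [Finsupp.sum, seqPairing, coeff_zero_smul_sum, prod_upd _ d hp] at h ⊢
  have e : ∀ k, (sv K s p ^ (A - k) * sv K s (p + 1) ^ (B + k) *
      ∏ a ∈ ((Finset.range n).erase p).erase (p + 1), sv K s a ^ d a) *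
        evalVars (Series K) (sv K s) n c R /
      ∏ x ∈ placePairs n, ζ.eval (c x.2) (c x.1) (sv K s x.2 / sv K s x.1) =
      sv K s p ^ (A - k) * sv K s (p + 1) ^ (B + k) *
      (((∏ a ∈ ((Finset.range n).erase p).erase (p + 1), sv K s a ^ d a) *
        evalVars (Series K) (sv K s) n c R) /
      ∏ x ∈ placePairs n, ζ.eval (c x.2) (c x.1) (sv K s x.2 / sv K s x.1)) := by
    intro k
    ring
  simp only [e]
  rw [h, prod_placePairs hp, div_aux]

lemma erase_swp (s : ℤˣ) (n p : ℕ) (d : ℕ → ℤ) :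
    (∏ a ∈ ((Finset.range n).erase p).erase (p + 1), sv K s a ^ d a,
      ∏ a ∈ ((Finset.range n).erase p).erase (p + 1), sv K s a ^ d a) ∈ swp K s (tr p) := by
  refine prod_pair_mem _ _ _ _ fun a ha => ?_
  simp only [Finset.mem_erase] at ha
  have h := sv_mem_swp (K := K) s (tr p) a (d a)
  rwa [tr_of_ne ha.2.1 ha.1] at h

lemma seqPairing_different (s : ℤˣ) (ζ : ZetaDatum K I) {n p : ℕ} (hp : p + 1 < n) (c : ℕ → I)
    (d : ℕ → ℤ) {R : Laurent K I} (hR : R ∈ symLaurent K (seqDeg n c)) (A B : ℤ)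
    (hc : c p ≠ c (p + 1)) :
    ((ζ.num (c (p + 1)) (c p)).coeff.sum fun k x =>
        x • seqPairing s ζ n c (upd d p (A - k) (B + k)) R) =
      (ζ.num (c p) (c (p + 1))).coeff.sum fun k x =>
        x • seqPairing s ζ n (fun a => c (tr p a)) (upd d p (B - k) (A + k)) R := by
  rw [sum_seqPairing s ζ hp, sum_seqPairing s ζ hp]
  have e1 : laurentEval (sv K s (p + 1) / sv K s p) (ζ.num (c (p + 1)) (c p)) /
      ζ.eval (c (p + 1)) (c p) (sv K s (p + 1) / sv K s p) = 1 := by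
    rw [ZetaDatum.eval, if_neg hc.symm, div_one, div_self]
    exact laurentEval_ratio_ne_zero s (Nat.lt_succ_self p) (ζ.num_ne_zero _ _)
  have e2 : laurentEval (sv K s (p + 1) / sv K s p) (ζ.num (c p) (c (p + 1))) /
      ζ.eval (c (tr p (p + 1))) (c (tr p p)) (sv K s (p + 1) / sv K s p) = 1 := by
    rw [tr_left, tr_right, ZetaDatum.eval, if_neg hc, div_one, div_self]
    exact laurentEval_ratio_ne_zero s (Nat.lt_succ_self p) (ζ.num_ne_zero _ _)
  rw [e1, e2]
  refine coeff_zero_tr s ζ hp c ?_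
  have h1 := evalVars_swp s (tr p) n c R
  rw [evalVars_tr _ hp c hR] at h1
  have h2 := mul_mem (sv_mem_swp (K := K) s (tr p) p A) (sv_mem_swp s (tr p) (p + 1) B)
  rw [tr_left, tr_right] at h2
  have h3 := mul_mem h2 (mul_mem (erase_swp (K := K) s n p d) h1)
  convert h3 using 1
  ext1
  · simp only [Prod.mk_mul_mk, mul_one]
  · simp only [Prod.mk_mul_mk, mul_one]
    ring

lemma seqPairing_same (s : ℤˣ) (ζ : ZetaDatum K I) {n p : ℕ} (hp : p + 1 < n) (c : ℕ → I)
    (d : ℕ → ℤ) {R : Laurent K I} (hR : R ∈ symLaurent K (seqDeg n c)) (A B : ℤ)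
    (hc : c p = c (p + 1)) :
    ((ζ.num (c p) (c p)).coeff.sum fun k x =>
        x • seqPairing s ζ n c (upd d p (A + 1 - k) (B + k)) R) =
      -(ζ.num (c p) (c p)).coeff.sum fun k x =>
        x • seqPairing s ζ n c (upd d p (B + 1 - k) (A + k)) R := by
  rw [sum_seqPairing s ζ hp, sum_seqPairing s ζ hp]
  have hx := sv_ne_zero (K := K) s p
  have hcc : (fun a => c (tr p a)) = c := by
    funext a
    rcases tr_cases p a with ⟨rfl, h⟩ | ⟨rfl, h⟩ | ⟨_, _, h⟩ <;> rw [h]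
    · exact hc.symm
    · exact hc
  have e1 : laurentEval (sv K s (p + 1) / sv K s p) (ζ.num (c p) (c p)) /
      ζ.eval (c (p + 1)) (c p) (sv K s (p + 1) / sv K s p) = 1 - sv K s (p + 1) / sv K s p := by
    have h1 := laurentEval_ratio_ne_zero (K := K) s (Nat.lt_succ_self p)
      (ζ.num_ne_zero (c p) (c p))
    rw [ZetaDatum.eval, if_pos hc.symm, ← hc, div_div_eq_mul_div, mul_comm]
    exact mul_div_cancel_right₀ _ h1
  have e3 : ∀ C E : ℤ, sv K s p ^ (C + 1) * sv K s (p + 1) ^ E *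
      (1 - sv K s (p + 1) / sv K s p) =
      sv K s p ^ C * sv K s (p + 1) ^ E * (sv K s p - sv K s (p + 1)) := by
    intro C E
    rw [zpow_add_one₀ hx]
    field_simp
  rw [e1, e3, e3, ← HahnSeries.coeff_neg, ← neg_div]
  have key := coeff_zero_tr s ζ hp c (f := sv K s p ^ A * sv K s (p + 1) ^ B *
      (sv K s p - sv K s (p + 1)) *
      ((∏ a ∈ ((Finset.range n).erase p).erase (p + 1), sv K s a ^ d a) *
          evalVars (Series K) (sv K s) n c R))
    (g := -(sv K s p ^ B * sv K s (p + 1) ^ A *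
      (sv K s p - sv K s (p + 1)) *
      ((∏ a ∈ ((Finset.range n).erase p).erase (p + 1), sv K s a ^ d a) *
          evalVars (Series K) (sv K s) n c R))) (by
    have h1 := evalVars_swp s (tr p) n c R
    rw [evalVars_tr _ hp c hR, hcc] at h1
    have h2 := mul_mem (sv_mem_swp (K := K) s (tr p) p A) (sv_mem_swp s (tr p) (p + 1) B)
    have h4 := sub_mem (sv_mem_swp (K := K) s (tr p) p 1) (sv_mem_swp s (tr p) (p + 1) 1)
    simp only [tr_left, tr_right, zpow_one] at h2 h4
    have h3 := mul_mem (mul_mem h2 h4) (mul_mem (erase_swp (K := K) s n p d) h1)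
    convert h3 using 1
    ext1
    · simp only [Prod.mk_mul_mk, Prod.mk_sub_mk]
    · simp only [Prod.mk_mul_mk, Prod.mk_sub_mk]
      ring)
  have hcc' : ∀ a, c (tr p a) = c a := congrFun hcc
  simp only [hcc'] at key
  exact key

end ConstantTerms

section Pairing

open scoped DirectSum

variable {K I : Type*} [Field K] [DecidableEq I]

/-- A word `e_{i_1,d_1} ⋯ e_{i_n,d_n}` is recorded as the list of the pairs `(i_a, d_a)`.  This is
the degree of a word: the number of letters of each color. -/
def wordDeg (w : List (I × ℤ)) (i : I) : ℕ :=
  (Finset.univ.filter fun a : Fin w.length => (w.get a).1 = i).card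

/-- The index of the variable that belongs to the letter number `a`: it is `z_{i_a, m}`, where the
letter is the `m`-th one of its color. -/
def letterVar (w : List (I × ℤ)) (a : Fin w.length) : I × ℕ :=
  ((w.get a).1,
    (Finset.univ.filter fun b : Fin w.length => b < a ∧ (w.get b).1 = (w.get a).1).card)

/-- The constant term of
`z_1^{d_1} ⋯ z_n^{d_n} R(z_1, …, z_n) / ∏_{a < b} ζ_{i_b i_a}(z_b / z_a)`,
expanded in the region `|z_1| ≫ ⋯ ≫ |z_n|` for `s = -1` and in the region
`|z_1| ≪ ⋯ ≪ |z_n|` for `s = 1`, where the variable `z_a` is plugged into `R` in the place of the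
variable `letterVar w a` of color `i_a`. -/
def wordPairing (s : ℤˣ) (ζ : ZetaDatum K I) (w : List (I × ℤ)) (R : Laurent K I) : K :=
  ((∏ a : Fin w.length, sv K s a ^ (w.get a).2) *
      (R.coeff.sum fun m x => algebraMap K (Series K) x *
        ∏ a : Fin w.length, sv K s a ^ m (letterVar w a)) /
    ∏ p : Fin w.length × Fin w.length with p.1 < p.2,
      ζ.eval (w.get p.2).1 (w.get p.1).1 (sv K s p.2 / sv K s p.1)).coeff 0

lemma card_fin_filter (n : ℕ) (P : ℕ → Prop) [DecidablePred P] :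
    (Finset.univ.filter fun a : Fin n => P a).card = ((Finset.range n).filter P).card := by
  refine Finset.card_bij (fun a _ => (a : ℕ)) ?_ ?_ ?_
  · intro a
    simp
  · intro a _ b _ h
    exact Fin.ext h
  · intro b hb
    rw [Finset.mem_filter, Finset.mem_range] at hb
    exact ⟨⟨b, hb.1⟩, by simpa using hb.2, rfl⟩

section Seq

variable (w : List (I × ℤ)) (x₀ : I × ℤ)

lemma getD_fin (a : Fin w.length) : w.getD a x₀ = w.get a := by
  simp

lemma wordDeg_eq : wordDeg w = seqDeg w.length fun a => (w.getD a x₀).1 := by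
  funext i
  rw [seqDeg, ← card_fin_filter]
  simp only [getD_fin]
  rfl

lemma letterVar_eq (a : Fin w.length) : letterVar w a = label (fun a => (w.getD a x₀).1) a := by
  refine Prod.ext ?_ ?_
  · simp [letterVar, label]
  · dsimp only [letterVar, label]
    rw [← getD_fin w x₀ a]
    have h : ((Finset.range (a : ℕ)).filter fun b => (w.getD b x₀).1 = (w.getD a x₀).1) =
        (Finset.range w.length).filter fun b : ℕ => b < (a : ℕ) ∧ (w.getD b x₀).1 = (w.getD a x₀).1 := by
      ext b
      simp only [Finset.mem_filter, Finset.mem_range]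
      have := a.2
      constructor
      · rintro ⟨h1, h2⟩; exact ⟨by omega, h1, h2⟩
      · rintro ⟨_, h1, h2⟩; exact ⟨h1, h2⟩
    rw [h, ← card_fin_filter]
    simp only [getD_fin]
    rfl

lemma wordPairing_eq (s : ℤˣ) (ζ : ZetaDatum K I) (R : Laurent K I) :
    wordPairing s ζ w R = seqPairing s ζ w.length (fun a => (w.getD a x₀).1)
      (fun a => (w.getD a x₀).2) R := by
  have h : ∏ p ∈ placePairs w.length,
      ζ.eval (w.getD p.2 x₀).1 (w.getD p.1 x₀).1 (sv K s p.2 / sv K s p.1) =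
      ∏ p : Fin w.length × Fin w.length with p.1 < p.2,
        ζ.eval (w.get p.2).1 (w.get p.1).1 (sv K s p.2 / sv K s p.1) := by
    symm
    refine Finset.prod_bij (fun p _ => ((p.1 : ℕ), (p.2 : ℕ))) ?_ ?_ ?_ ?_
    · intro p hp
      rw [mem_placePairs]
      exact ⟨(Finset.mem_filter.mp hp).2, p.2.2⟩
    · rintro ⟨a, b⟩ _ ⟨a', b'⟩ _ h
      simp only [Prod.mk.injEq, Fin.val_inj] at h
      exact Prod.ext h.1 h.2
    · rintro ⟨a, b⟩ hp
      rw [mem_placePairs] at hp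
      exact ⟨(⟨a, hp.1.trans hp.2⟩, ⟨b, hp.2⟩), by simpa using hp.1, rfl⟩
    · intro p _
      simp only [getD_fin]
  rw [wordPairing, seqPairing, h]
  simp only [evalVars, Finset.prod_range, getD_fin, letterVar_eq w x₀]

end Seq

section Cong

variable {n : ℕ} {c c' : ℕ → I} {d d' : ℕ → ℤ}

lemma label_congr (h : ∀ a < n, c a = c' a) {a : ℕ} (ha : a < n) : label c a = label c' a := by
  refine Prod.ext (h a ha) ?_
  dsimp only [label]
  congr 1
  refine Finset.filter_congr fun b hb => ?_
  rw [Finset.mem_range] at hb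
  rw [h a ha, h b (hb.trans ha)]

lemma seqDeg_congr (h : ∀ a < n, c a = c' a) : seqDeg n c = seqDeg n c' := by
  funext i
  refine congrArg Finset.card (Finset.filter_congr fun b hb => ?_)
  rw [h b (Finset.mem_range.mp hb)]

lemma seqPairing_congr (s : ℤˣ) (ζ : ZetaDatum K I) (R : Laurent K I)
    (h : ∀ a < n, c a = c' a) (h' : ∀ a < n, d a = d' a) :
    seqPairing s ζ n c d R = seqPairing s ζ n c' d' R := by
  have h1 : ∏ a ∈ Finset.range n, sv K s a ^ d a = ∏ a ∈ Finset.range n, sv K s a ^ d' a :=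
    Finset.prod_congr rfl fun a ha => by rw [h' a (Finset.mem_range.mp ha)]
  have h2 : evalVars (Series K) (sv K s) n c R = evalVars (Series K) (sv K s) n c' R := by
    unfold evalVars
    refine Finsupp.sum_congr fun m _ => ?_
    congr 1
    refine Finset.prod_congr rfl fun a ha => ?_
    rw [label_congr h (Finset.mem_range.mp ha)]
  have h3 : ∏ p ∈ placePairs n, ζ.eval (c p.2) (c p.1) (sv K s p.2 / sv K s p.1) =
      ∏ p ∈ placePairs n, ζ.eval (c' p.2) (c' p.1) (sv K s p.2 / sv K s p.1) := by
    refine Finset.prod_congr rfl fun p hp => ?_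
    rw [mem_placePairs] at hp
    rw [h _ hp.2, h _ (hp.1.trans hp.2)]
  rw [seqPairing, seqPairing, h1, h2, h3]

end Cong

lemma getD_mid (u v : List (I × ℤ)) (x y x₀ : I × ℤ) (a : ℕ) :
    (u ++ x :: y :: v).getD a x₀ = if a = u.length then x else if a = u.length + 1 then y else
      if a < u.length then u.getD a x₀ else v.getD (a - (u.length + 2)) x₀ := by
  by_cases h : a < u.length
  · rw [List.getD_append _ _ _ _ h, if_neg (by omega), if_neg (by omega), if_pos h]
  · rw [List.getD_append_right _ _ _ _ (by omega)]
    obtain ⟨k, rfl⟩ := Nat.exists_eq_add_of_le (not_lt.mp h)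
    rw [Nat.add_sub_cancel_left]
    rcases k with _ | _ | k
    · simp
    · simp
    · rw [if_neg (by omega), if_neg (by omega), if_neg (by omega)]
      simp only [List.getD_cons_succ]
      congr 1
      omega

variable [CharZero K]

/-- The colors of the letters of `u ++ x :: y :: v`. -/
def midColor (u v : List (I × ℤ)) (i j : I) (a : ℕ) : I :=
  ((u ++ (i, 0) :: (j, 0) :: v).getD a (i, 0)).1

/-- The exponents of the letters of `u ++ x :: y :: v`. -/
def midExp (u v : List (I × ℤ)) (i : I) (a : ℕ) : ℤ :=
  ((u ++ (i, 0) :: (i, 0) :: v).getD a (i, 0)).2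

lemma midColor_length (u v : List (I × ℤ)) (i j : I) : midColor u v i j u.length = i := by
  rw [midColor, getD_mid, if_pos rfl]

lemma midColor_length_succ (u v : List (I × ℤ)) (i j : I) :
    midColor u v i j (u.length + 1) = j := by
  rw [midColor, getD_mid, if_neg (by omega), if_pos rfl]

lemma wordDeg_mid (u v : List (I × ℤ)) (i j : I) (x y : ℤ) :
    wordDeg (u ++ (i, x) :: (j, y) :: v) =
      seqDeg (u ++ (i, (0 : ℤ)) :: (j, 0) :: v).length (midColor u v i j) := by
  rw [wordDeg_eq _ (i, 0)]
  have hl : (u ++ (i, x) :: (j, y) :: v).length =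
    (u ++ (i, (0 : ℤ)) :: (j, 0) :: v).length := by simp
  rw [hl]
  refine seqDeg_congr fun a _ => ?_
  rw [midColor, getD_mid, getD_mid]
  split_ifs <;> rfl

lemma wordPairing_mid (s : ℤˣ) (ζ : ZetaDatum K I) (u v : List (I × ℤ)) (i j k : I) (x y : ℤ)
    (R : Laurent K I) :
    wordPairing s ζ (u ++ (i, x) :: (j, y) :: v) R =
      seqPairing s ζ (u ++ (i, (0 : ℤ)) :: (j, 0) :: v).length (midColor u v i j)
        (upd (midExp u v k) u.length x y) R := by
  rw [wordPairing_eq _ (i, 0)]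
  have hl : (u ++ (i, x) :: (j, y) :: v).length =
    (u ++ (i, (0 : ℤ)) :: (j, 0) :: v).length := by simp
  rw [hl]
  refine seqPairing_congr s ζ R (fun a _ => ?_) (fun a ha => ?_)
  · rw [midColor, getD_mid, getD_mid]
    split_ifs <;> rfl
  · rw [upd, midExp, getD_mid, getD_mid]
    split_ifs with h1 h2 h3
    · rfl
    · rfl
    · rw [List.getD_eq_getElem _ _ h3, List.getD_eq_getElem _ _ h3]
    · rw [List.length_append, List.length_cons, List.length_cons] at ha
      rw [List.getD_eq_getElem _ _ (by omega), List.getD_eq_getElem _ _ (by omega)]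

lemma midColor_swap (u v : List (I × ℤ)) (i j : I) {a : ℕ}
    (ha : a < (u ++ (i, (0 : ℤ)) :: (j, 0) :: v).length) :
    midColor u v j i a = midColor u v i j (tr u.length a) := by
  rcases tr_cases u.length a with ⟨h1, h⟩ | ⟨h1, h⟩ | ⟨h1, h2, h⟩
  · rw [h, h1, midColor_length, midColor_length_succ]
  · rw [h, h1, midColor_length, midColor_length_succ]
  · rw [h, midColor, midColor, getD_mid, getD_mid, if_neg h1, if_neg h2, if_neg h1, if_neg h2]
    rw [List.length_append, List.length_cons, List.length_cons] at ha
    split_ifs with h3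
    · rw [List.getD_eq_getElem _ _ h3, List.getD_eq_getElem _ _ h3]
    · rw [List.getD_eq_getElem _ _ (by omega), List.getD_eq_getElem _ _ (by omega)]

lemma wordDeg_swap (u v : List (I × ℤ)) (i j : I) (x y x' y' : ℤ) :
    wordDeg (u ++ (j, x') :: (i, y') :: v) = wordDeg (u ++ (i, x) :: (j, y) :: v) := by
  rw [wordDeg_mid, wordDeg_mid, ← seqDeg_tr (p := u.length) (by simp) (midColor u v i j)]
  have hl : (u ++ (j, (0 : ℤ)) :: (i, 0) :: v).length =
    (u ++ (i, (0 : ℤ)) :: (j, 0) :: v).length := by simp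
  rw [hl]
  exact seqDeg_congr fun a ha => midColor_swap u v i j ha

lemma wordPairing_different (s : ℤˣ) (ζ : ZetaDatum K I) (u v : List (I × ℤ)) {i j : I}
    (hij : i ≠ j) (a b : ℤ) {R : Laurent K I}
    (hR : R ∈ symLaurent K (wordDeg (u ++ (i, 0) :: (j, 0) :: v))) :
    ((ζ.num j i).coeff.sum fun k x =>
        x • wordPairing s ζ (u ++ (i, a - k) :: (j, b + k) :: v) R) =
      (ζ.num i j).coeff.sum fun k x =>
        x • wordPairing s ζ (u ++ (j, b - k) :: (i, a + k) :: v) R := by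
  have hl : (u ++ (j, (0 : ℤ)) :: (i, 0) :: v).length =
    (u ++ (i, (0 : ℤ)) :: (j, 0) :: v).length := by simp
  rw [wordDeg_mid] at hR
  have h := seqPairing_different s ζ (p := u.length) (by simp) (midColor u v i j)
    (midExp u v i) hR a b (by rwa [midColor_length, midColor_length_succ])
  rw [midColor_length, midColor_length_succ] at h
  simp only [wordPairing_mid s ζ u v _ _ i]
  refine h.trans ?_
  refine Finsupp.sum_congr fun k _ => ?_
  rw [hl]
  congr 1
  exact seqPairing_congr s ζ R (fun a ha => (midColor_swap u v i j ha).symm) fun _ _ => rfl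

lemma wordPairing_same (s : ℤˣ) (ζ : ZetaDatum K I) (u v : List (I × ℤ)) (i : I) (a b : ℤ)
    {R : Laurent K I} (hR : R ∈ symLaurent K (wordDeg (u ++ (i, 0) :: (i, 0) :: v))) :
    ((ζ.num i i).coeff.sum fun k x =>
        x • wordPairing s ζ (u ++ (i, a + 1 - k) :: (i, b + k) :: v) R) =
      -(ζ.num i i).coeff.sum fun k x =>
        x • wordPairing s ζ (u ++ (i, b + 1 - k) :: (i, a + k) :: v) R := by
  rw [wordDeg_mid] at hR
  have h := seqPairing_same s ζ (p := u.length) (by simp) (midColor u v i i)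
    (midExp u v i) hR a b (by rw [midColor_length, midColor_length_succ])
  rw [midColor_length] at h
  simp only [wordPairing_mid s ζ u v _ _ i]
  exact h

/-- The constant term pairing with a word, as a linear map. -/
def wordPairingLin (s : ℤˣ) (ζ : ZetaDatum K I) (w : List (I × ℤ)) : Laurent K I →ₗ[K] K where
  toFun := wordPairing s ζ w
  map_add' R S := by
    unfold wordPairing
    rw [AddMonoidAlgebra.coeff_add,
      Finsupp.sum_add_index' (by simp) (by intros; rw [map_add, add_mul]), mul_add, add_div,
      HahnSeries.coeff_add]
  map_smul' r R := by
    unfold wordPairing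
    rw [AddMonoidAlgebra.coeff_smul, Finsupp.sum_smul_index' (by simp)]
    simp only [smul_eq_mul, map_mul, mul_assoc, ← Finsupp.mul_sum, RingHom.id_apply]
    rw [← HahnSeries.C_eq_algebraMap, mul_left_comm, mul_div_assoc, HahnSeries.C_mul_eq_smul,
      HahnSeries.coeff_smul, smul_eq_mul]

variable [Fintype I]

/-- The pairing between the free algebra on the `e_{i,d}` and a big shuffle algebra: a word of
degree `n` only pairs with the component of degree `n`, by `wordPairing`. -/
def freePairing (s : ℤˣ) (ζ ζ' : ZetaDatum K I) :
    FreeAlgebra K (I × ℤ) →ₗ[K] BigShuffle ζ' →ₗ[K] K :=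
  (FreeAlgebra.basisFreeMonoid K (I × ℤ)).constr K fun w =>
    wordPairingLin s ζ w.toList ∘ₗ Component.val ∘ₗ
      DirectSum.component K (I → ℕ) (Component ζ') (wordDeg w.toList)

/-- The word `w` in the free algebra. -/
def wordProd (w : List (I × ℤ)) : FreeAlgebra K (I × ℤ) := (w.map (FreeAlgebra.ι K)).prod

lemma basis_eq (w : FreeMonoid (I × ℤ)) :
    FreeAlgebra.basisFreeMonoid K (I × ℤ) w = wordProd w.toList := by
  rw [FreeAlgebra.basisFreeMonoid, Module.Basis.map_apply, Finsupp.coe_basisSingleOne]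
  change FreeAlgebra.equivMonoidAlgebraFreeMonoid.symm (MonoidAlgebra.single w 1) = _
  change MonoidAlgebra.lift K (FreeAlgebra K (I × ℤ)) (FreeMonoid (I × ℤ))
    (FreeMonoid.lift (FreeAlgebra.ι K)) (MonoidAlgebra.single w 1) = _
  rw [MonoidAlgebra.lift_single, one_smul, FreeMonoid.lift_apply]
  rfl

lemma freePairing_wordProd (s : ℤˣ) (ζ ζ' : ZetaDatum K I) (w : List (I × ℤ))
    (R : BigShuffle ζ') :
    freePairing s ζ ζ' (wordProd w) R = wordPairing s ζ w (R (wordDeg w)).val := by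
  rw [← FreeMonoid.toList_ofList w, ← basis_eq, freePairing, Module.Basis.constr_basis]
  rfl

lemma wordProd_append (u v : List (I × ℤ)) :
    (wordProd (u ++ v) : FreeAlgebra K (I × ℤ)) = wordProd u * wordProd v := by
  rw [wordProd, List.map_append, List.prod_append]
  rfl

lemma wordProd_cons (x : I × ℤ) (v : List (I × ℤ)) :
    (wordProd (x :: v) : FreeAlgebra K (I × ℤ)) = FreeAlgebra.ι K x * wordProd v := by
  rw [wordProd, List.map_cons, List.prod_cons]
  rfl

lemma freePairing_mid (s : ℤˣ) (ζ ζ' : ZetaDatum K I) (u v : List (I × ℤ)) (x y : I × ℤ)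
    (R : BigShuffle ζ') :
    freePairing s ζ ζ' (wordProd u * (FreeAlgebra.ι K x * FreeAlgebra.ι K y) * wordProd v) R =
      wordPairing s ζ (u ++ x :: y :: v) (R (wordDeg (u ++ x :: y :: v))).val := by
  rw [← freePairing_wordProd, wordProd_append, wordProd_cons, wordProd_cons]
  simp only [mul_assoc]

lemma val_congr {ζ : ZetaDatum K I} (R : BigShuffle ζ) {n m : I → ℕ} (h : n = m) :
    (R n).val = (R m).val := by rw [h]

lemma freePairing_rel_words (s : ℤˣ) (ζ ζ' : ZetaDatum K I) {x y : FreeAlgebra K (I × ℤ)}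
    (h : QuadRel ζ x y) (u v : List (I × ℤ)) :
    freePairing s ζ ζ' (wordProd u * x * wordProd v) =
      freePairing s ζ ζ' (wordProd u * y * wordProd v) := by
  refine LinearMap.ext fun R => ?_
  cases h with
  | different i j hij a b =>
    have h := wordPairing_different s ζ u v hij a b
      (R (wordDeg (u ++ (i, 0) :: (j, 0) :: v))).mem
    simp only [Finsupp.sum, Finset.mul_sum, Finset.sum_mul, map_sum, mul_smul_comm,
      smul_mul_assoc, map_smul, LinearMap.sum_apply, LinearMap.smul_apply, freePairing_mid]
    have e1 : ∀ x y : ℤ, (R (wordDeg (u ++ (i, x) :: (j, y) :: v))).val =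
        (R (wordDeg (u ++ (i, 0) :: (j, 0) :: v))).val := fun x y =>
      val_congr R (by rw [wordDeg_mid, wordDeg_mid])
    have e2 : ∀ x y : ℤ, (R (wordDeg (u ++ (j, x) :: (i, y) :: v))).val =
        (R (wordDeg (u ++ (i, 0) :: (j, 0) :: v))).val := fun x y =>
      val_congr R (wordDeg_swap u v i j 0 0 x y)
    simp only [e1, e2]
    exact h
  | same i a b =>
    have h := wordPairing_same s ζ u v i a b
      (R (wordDeg (u ++ (i, 0) :: (i, 0) :: v))).mem
    simp only [Finsupp.sum, mul_neg, neg_mul, map_neg, LinearMap.neg_apply,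
      Finset.mul_sum, Finset.sum_mul, map_sum, mul_smul_comm,
      smul_mul_assoc, map_smul, LinearMap.sum_apply, LinearMap.smul_apply, freePairing_mid]
    have e1 : ∀ x y : ℤ, (R (wordDeg (u ++ (i, x) :: (i, y) :: v))).val =
        (R (wordDeg (u ++ (i, 0) :: (i, 0) :: v))).val := fun x y =>
      val_congr R (by rw [wordDeg_mid, wordDeg_mid])
    simp only [e1]
    exact h

lemma free_induction {p : FreeAlgebra K (I × ℤ) → Prop} (u : FreeAlgebra K (I × ℤ))
    (h0 : p 0) (hw : ∀ w, p (wordProd w)) (hadd : ∀ a b, p a → p b → p (a + b))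
    (hsmul : ∀ (r : K) a, p a → p (r • a)) : p u := by
  have hu : u ∈ Submodule.span K (Set.range (FreeAlgebra.basisFreeMonoid K (I × ℤ))) := by
    rw [(FreeAlgebra.basisFreeMonoid K (I × ℤ)).span_eq]
    exact Submodule.mem_top
  induction hu using Submodule.span_induction with
  | mem x hx =>
    obtain ⟨w, rfl⟩ := hx
    rw [basis_eq]
    exact hw _
  | zero => exact h0
  | add a b _ _ ha hb => exact hadd a b ha hb
  | smul r a _ ha => exact hsmul r a ha

lemma freePairing_rel (s : ℤˣ) (ζ ζ' : ZetaDatum K I) {x y : FreeAlgebra K (I × ℤ)}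
    (h : QuadRel ζ x y) (u v : FreeAlgebra K (I × ℤ)) :
    freePairing s ζ ζ' (u * x * v) = freePairing s ζ ζ' (u * y * v) := by
  refine free_induction (p := fun u => freePairing s ζ ζ' (u * x * v) =
    freePairing s ζ ζ' (u * y * v)) u (by simp) (fun w => ?_) (fun a b ha hb => ?_)
    (fun r a ha => ?_)
  · refine free_induction (p := fun v => freePairing s ζ ζ' (wordProd w * x * v) =
      freePairing s ζ ζ' (wordProd w * y * v)) v (by simp)
      (fun w' => freePairing_rel_words s ζ ζ' h w w') (fun a b ha hb => ?_) (fun r a ha => ?_)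
    · simp only [mul_add, map_add, ha, hb]
    · simp only [mul_smul_comm, map_smul, ha]
  · simp only [add_mul, map_add, ha, hb]
  · simp only [smul_mul_assoc, map_smul, ha]

/-- Elements of the free algebra that the pairing does not distinguish. -/
def pairingCon (s : ℤˣ) (ζ ζ' : ZetaDatum K I) : RingCon (FreeAlgebra K (I × ℤ)) where
  r x y := ∀ u v, freePairing s ζ ζ' (u * x * v) = freePairing s ζ ζ' (u * y * v)
  iseqv := ⟨fun _ _ _ => rfl, fun h u v => (h u v).symm, fun h h' u v => (h u v).trans (h' u v)⟩
  add' h h' u v := by simp only [mul_add, add_mul, map_add, h u v, h' u v]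
  mul' {w x y z} h h' u v := by
    have h1 := h u (y * v)
    have h2 := h' (u * x) v
    simp only [mul_assoc] at h1 h2 ⊢
    exact h1.trans h2

lemma freePairing_mk (s : ℤˣ) (ζ ζ' : ZetaDatum K I) {x y : FreeAlgebra K (I × ℤ)}
    (h : RingQuot.mkAlgHom K (QuadRel ζ) x = RingQuot.mkAlgHom K (QuadRel ζ) y) :
    freePairing s ζ ζ' x = freePairing s ζ ζ' y := by
  have h0 : ∀ ⦃a b⦄, QuadRel ζ a b →
      (pairingCon s ζ ζ').mk' a = (pairingCon s ζ ζ').mk' b := fun a b hab =>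
    (RingCon.eq _).mpr fun u v => freePairing_rel s ζ ζ' hab u v
  have h1 : RingQuot.mkRingHom (QuadRel ζ) x = RingQuot.mkRingHom (QuadRel ζ) y := by
    rw [← RingQuot.mkAlgHom_coe K]
    exact h
  have h2 := congrArg (RingQuot.lift ⟨(pairingCon s ζ ζ').mk', h0⟩) h1
  rw [RingQuot.lift_mkRingHom_apply, RingQuot.lift_mkRingHom_apply] at h2
  have h3 := (RingCon.eq _).mp h2 1 1
  simpa using h3

/-- The pairing between the quadratic quantum loop group of the datum `ζ` and the big shuffle
algebra of a datum `ζ'` (of which only the underlying graded vector space matters), see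
`pairing_word`. -/
def pairing (s : ℤˣ) (ζ ζ' : ZetaDatum K I) : QuadAlg ζ →ₗ[K] BigShuffle ζ' →ₗ[K] K :=
  (LinearMap.ker (RingQuot.mkAlgHom K (QuadRel ζ)).toLinearMap).liftQ (freePairing s ζ ζ')
      (fun x hx => by
        have h : RingQuot.mkAlgHom K (QuadRel ζ) x = 0 := hx
        rw [LinearMap.mem_ker, ← map_zero (freePairing s ζ ζ')]
        exact freePairing_mk s ζ ζ' (h.trans (map_zero _).symm)) ∘ₗ
    ((RingQuot.mkAlgHom K (QuadRel ζ)).toLinearMap.quotKerEquivOfSurjective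
      (RingQuot.mkAlgHom_surjective K (QuadRel ζ))).symm.toLinearMap

lemma pairing_mk (s : ℤˣ) (ζ ζ' : ZetaDatum K I) (x : FreeAlgebra K (I × ℤ)) :
    pairing s ζ ζ' (RingQuot.mkAlgHom K (QuadRel ζ) x) = freePairing s ζ ζ' x := by
  rw [pairing, LinearMap.comp_apply]
  have : ((RingQuot.mkAlgHom K (QuadRel ζ)).toLinearMap.quotKerEquivOfSurjective
      (RingQuot.mkAlgHom_surjective K (QuadRel ζ))).symm.toLinearMap
      (RingQuot.mkAlgHom K (QuadRel ζ) x) = Submodule.Quotient.mk x := by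
    refine (LinearEquiv.symm_apply_eq _).mpr ?_
    rfl
  rw [this]
  rfl

/-- The defining formula of the pairing. -/
lemma pairing_word (s : ℤˣ) (ζ ζ' : ZetaDatum K I) (w : List (I × ℤ)) (R : BigShuffle ζ') :
    pairing s ζ ζ' (w.map fun x => QuadAlg.gen ζ x.1 x.2).prod R =
      wordPairing s ζ w (R (wordDeg w)).val := by
  have h : (w.map fun x => QuadAlg.gen ζ x.1 x.2).prod =
      RingQuot.mkAlgHom K (QuadRel ζ) (wordProd w) := by
    rw [wordProd, map_list_prod, List.map_map]
    rfl
  rw [← freePairing_wordProd, ← pairing_mk, h]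

end Pairing

section ShuffleAlgebras

variable {K I : Type*} [Field K] [CharZero K] [Fintype I] [DecidableEq I]

/-- The pairing `Ũ⁺ ⊗ 𝒱⁻ → K`:
`⟨e_{i_1,d_1} ⋯ e_{i_n,d_n}, R⟩` is the constant term, expanded for `|z_1| ≫ ⋯ ≫ |z_n|`, of
`z_1^{d_1} ⋯ z_n^{d_n} R(z_1, …, z_n) / ∏_{a < b} ζ_{i_b i_a}(z_b / z_a)`. -/
def pairPlus (ζ : ZetaDatum K I) : QuadAlg ζ →ₗ[K] BigShuffle ζ.op →ₗ[K] K :=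
  pairing (-1) ζ ζ.op

/-- The pairing `𝒱⁺ ⊗ Ũ⁻ → K`:
`⟨R, f_{i_1,d_1} ⋯ f_{i_n,d_n}⟩` is the constant term, expanded for `|z_1| ≪ ⋯ ≪ |z_n|`, of
`z_1^{d_1} ⋯ z_n^{d_n} R(z_1, …, z_n) / ∏_{a < b} ζ_{i_a i_b}(z_a / z_b)`; note that
`ζ.op` satisfies `ζ^{op}_{i_b i_a}(z_b / z_a) = ζ_{i_a i_b}(z_a / z_b)`. -/
def pairMinus (ζ : ZetaDatum K I) : BigShuffle ζ →ₗ[K] QuadAlg ζ.op →ₗ[K] K :=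
  (pairing 1 ζ.op ζ).flip

/-- The shuffle algebra `𝒮⁺ ⊆ 𝒱⁺`: the elements that pair trivially with `Ker Υ̃⁻`. -/
def shufflePlus (ζ : ZetaDatum K I) : Submodule K (BigShuffle ζ) where
  carrier := {R | ∀ y : QuadAlg ζ.op, upsilon ζ.op y = 0 → pairMinus ζ R y = 0}
  add_mem' h h' y hy := by rw [map_add, LinearMap.add_apply, h y hy, h' y hy, add_zero]
  zero_mem' y _ := by rw [map_zero, LinearMap.zero_apply]
  smul_mem' c R h y hy := by rw [map_smul, LinearMap.smul_apply, h y hy, smul_zero]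

/-- The shuffle algebra `𝒮⁻ ⊆ 𝒱⁻`: the elements that pair trivially with `Ker Υ̃⁺`. -/
def shuffleMinus (ζ : ZetaDatum K I) : Submodule K (BigShuffle ζ.op) where
  carrier := {R | ∀ x : QuadAlg ζ, upsilon ζ x = 0 → pairPlus ζ x R = 0}
  add_mem' h h' x hx := by rw [map_add, h x hx, h' x hx, add_zero]
  zero_mem' x _ := by rw [map_zero]
  smul_mem' c R h x hx := by rw [map_smul, h x hx, smul_zero]

/-- The reduced algebra `U⁺ = Ũ⁺ / Ker Υ̃⁺` (for the datum `ζ.op`: `U⁻ = Ũ⁻ / Ker Υ̃⁻`). -/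
abbrev LoopAlg (ζ : ZetaDatum K I) : Type _ := QuadAlg ζ ⧸ RingHom.ker (upsilon ζ)

/-- The class in `U⁺` of an element of `Ũ⁺`. -/
def LoopAlg.mk (ζ : ZetaDatum K I) : QuadAlg ζ →+* LoopAlg ζ :=
  Ideal.Quotient.mk (RingHom.ker (upsilon ζ))

end ShuffleAlgebras

end ShuffleAlgebra

end

/-!
The two pairings are the cases `s = ±1` of one construction for a sign `s` and two dual data `ζ` and
`ζ'`, that is `ζ'_{ij}(x) = ζ_{ji}(x⁻¹)`.

The image of a word in the shuffle algebra is an explicit symmetrization (`exists_upsilon_word`).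
So the pairing of a word with the image of a word is a sum over the matchings `ρ` of their letters,
one constant term each (`pairing_upsilon_word`). The denominator of such a constant term is a product
over the pairs of letters that `ρ` puts in different orders. For those pairs, both regions of
expansion prescribe the same order of the two variables, and a constant term depends on nothing
else (`coeff_zero_div_congr`). Hence the two pairings agree on images (`pairing_symm`). This gives the
compatibility of the pairings, and that the image of `upsilon` annihilates the kernel of its dual.

The converse is that an element annihilating the kernel is in the image (`mem_range_upsilon`). Two
facts reduce it to finite linear algebra in each degree.

* The quadratic relations rewrite a word whose exponents decrease too fast as a combination of
  words of smaller weight, and the weights of the words that pair non-trivially with a given element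
  are bounded below. So an element is determined by its pairings with nearly increasing words
  (`exists_nearIncr`).
* Write `g_a` for the exponents of a word up to the sign that depends on the side of the pairing. If
  the constant term of a matching does not vanish, then the sequences of the two words differ by
  transfers, bounded on one side, between exchanged places. Comparing prefix sums of exponents, the
  nearly increasing words in a region `-N - L m (n - m) ≤ g_1 + ⋯ + g_m`, `g_1 + ⋯ + g_n ≤ N`, pair
  non-trivially only with nearly increasing words in the same region if `L` is large, whatever `N` is
  (`exists_region_closed`). The strict convexity of the bound absorbs the constants: if `ρ` moves the
  first `m` places, then the `m`-th prefix sum of one word is, up to a constant, at least the mean of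
  the prefix sums number `m - 1` and `m + 1` of the other. Such regions are finite, and each element
  pairs non-trivially with nearly increasing words of one of them only (`exists_inRegion`).

Thus the pairing matrix of nearly increasing words has a finite block that contains the pairings of
the given element. A linear relation between the rows of this block is an element of the kernel of
`upsilon`, so it annihilates the given element, whose vector of pairings is therefore in the span of
the columns (`exists_upsilon_component`). Non-degeneracy of the reduced pairings follows from the
separation property and the symmetry.
-/

namespace ShuffleAlgebra

/-! ### Expansions of Laurent polynomials, constant terms, and exponents of series -/

section Expansions

variable {K : Type*} [Field K] {α : Type*}

/-- The expansion of a Laurent polynomial in variables `x_a`, `a ∈ α`, after the substitution of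
`z_{g a}` for `x_a`. The sign `s` selects the region of expansion, see `expand`. -/
noncomputable def relExpand (s : ℤˣ) (g : α → ℕ) :
    AddMonoidAlgebra K (α →₀ ℤ) →ₐ[K] Series K :=
  (expand s).comp (AddMonoidAlgebra.mapDomainAlgHom K K (Finsupp.mapDomain.addMonoidHom g))

lemma relExpand_single (s : ℤˣ) (g : α → ℕ) (m : α →₀ ℤ) (c : K) :
    relExpand s g (AddMonoidAlgebra.single m c) =
      HahnSeries.single (toLex fun b => (s : ℤ) * m.mapDomain g b) c := by
  rw [← expand_single]
  simp [relExpand]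

lemma relExpand_zpow (s : ℤˣ) (g : α → ℕ) (x : α) (k : ℤ) :
    relExpand s g (AddMonoidAlgebra.single (Finsupp.single x k) (1 : K)) = sv K s (g x) ^ k := by
  rw [relExpand_single, sv_zpow, expand_single, Finsupp.mapDomain_single]

lemma relExpand_coeff (s : ℤˣ) {g : α → ℕ} (hg : Function.Injective g)
    (P : AddMonoidAlgebra K (α →₀ ℤ)) (m : α →₀ ℤ) :
    (relExpand s g P).coeff (toLex fun b => (s : ℤ) * m.mapDomain g b) = P.coeff m := by
  classical
  induction P using AddMonoidAlgebra.induction_linear with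
  | zero => simp
  | add P Q hP hQ => simp only [map_add, HahnSeries.coeff_add, hP, hQ, AddMonoidAlgebra.coeff_add,
      Finsupp.add_apply]
  | single m' c =>
    rw [relExpand_single, AddMonoidAlgebra.coeff_single]
    by_cases h : m' = m
    · subst h; simp
    · rw [Finsupp.single_eq_of_ne (Ne.symm h), HahnSeries.coeff_single_of_ne]
      intro h0
      apply h
      refine Finsupp.mapDomain_injective hg (Finsupp.ext fun b => ?_)
      have h2 : (s : ℤ) * m.mapDomain g b = (s : ℤ) * m'.mapDomain g b :=
        congrFun (congrArg ofLex h0) b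
      exact (mul_left_cancel₀ s.ne_zero h2).symm

lemma relExpand_injective (s : ℤˣ) {g : α → ℕ} (hg : Function.Injective g) :
    Function.Injective (relExpand (K := K) s g) := by
  intro P Q h
  ext m
  rw [← relExpand_coeff s hg, ← relExpand_coeff s hg, h]

lemma relExpand_coeff_zero (s : ℤˣ) {g : α → ℕ} (hg : Function.Injective g)
    (P : AddMonoidAlgebra K (α →₀ ℤ)) : (relExpand s g P).coeff 0 = P.coeff 0 := by
  rw [← relExpand_coeff s hg P 0]
  have h : (fun b => (s : ℤ) * (0 : α →₀ ℤ).mapDomain g b) = 0 := funext fun b => by simp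
  rw [h, toLex_zero]

lemma relExpand_support (s : ℤˣ) (g : α → ℕ) (P : AddMonoidAlgebra K (α →₀ ℤ))
    {γ : Lex (ℕ → ℤ)} (h : (relExpand s g P).coeff γ ≠ 0) :
    ∃ m ∈ P.coeff.support, γ = toLex fun b => (s : ℤ) * m.mapDomain g b := by
  have hP : P = ∑ m ∈ P.coeff.support, AddMonoidAlgebra.single m (P.coeff m) := by
    apply AddMonoidAlgebra.ext
    rw [AddMonoidAlgebra.coeff_sum]
    simp only [AddMonoidAlgebra.coeff_single]
    exact (Finsupp.sum_single P.coeff).symm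
  rw [hP, map_sum, HahnSeries.coeff_sum] at h
  obtain ⟨m, hm, hne⟩ := Finset.exists_ne_zero_of_sum_ne_zero h
  refine ⟨m, hm, ?_⟩
  rw [relExpand_single] at hne
  by_contra hγ
  exact hne (HahnSeries.coeff_single_of_ne hγ)

/-- The Laurent polynomial `T(x_b / x_a)`. -/
noncomputable def pairLaurent (a b : α) (T : LaurentPolynomial K) :
    AddMonoidAlgebra K (α →₀ ℤ) :=
  T.coeff.sum fun k c =>
    c • (AddMonoidAlgebra.single (Finsupp.single b k) 1 *
      AddMonoidAlgebra.single (Finsupp.single a (-k)) 1)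

lemma relExpand_pairLaurent (s : ℤˣ) (g : α → ℕ) (a b : α) (T : LaurentPolynomial K) :
    relExpand s g (pairLaurent a b T) = laurentEval (sv K s (g b) / sv K s (g a)) T := by
  simp only [pairLaurent, laurentEval, Finsupp.sum, map_sum, map_smul, map_mul, relExpand_zpow]
  refine Finset.sum_congr rfl fun k _ => ?_
  rw [Algebra.smul_def, div_zpow, zpow_neg, div_eq_mul_inv]

lemma sv_neg (s : ℤˣ) (a : ℕ) : sv K (-s) a = (sv K s a)⁻¹ := by
  rw [sv, sv, HahnSeries.inv_single, inv_one]
  congr 2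
  rw [Units.val_neg, Pi.single_neg]
  rfl

lemma relExpand_fil (s : ℤˣ) (g : α → ℕ) (n : ℕ) (P : AddMonoidAlgebra K (α →₀ ℤ)) :
    ∃ m, relExpand s g P ∈ fil K n m :=
  exists_fil n _ s

/-- The constant term of a fraction does not depend on the region in which it is expanded, as long
as the factors of the denominator are expanded in the same way.  Both constant terms are those of
the Laurent polynomial in which the inverses of the denominators are truncated. -/
theorem coeff_zero_div_congr {ι : Type*} (J : Finset ι) (n : ℕ) {γ₁ γ₂ : ι → Lex (ℕ → ℤ)}
    (h₁ : ∀ j ∈ J, 0 < γ₁ j ∧ 1 ≤ wt n (γ₁ j) ∧ wt n (γ₁ j) ≤ n)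
    (h₂ : ∀ j ∈ J, 0 < γ₂ j ∧ 1 ≤ wt n (γ₂ j) ∧ wt n (γ₂ j) ≤ n)
    (Q : ι → LaurentPolynomial K) {f g : Series K} {m₁ m₂ : ℤ}
    (hf : f ∈ fil K n m₁) (hg : g ∈ fil K n m₂)
    (H : ∀ T : ι → LaurentPolynomial K,
      (f * ∏ j ∈ J, laurentEval (HahnSeries.single (γ₁ j) (1 : K)) (T j)).coeff 0 =
      (g * ∏ j ∈ J, laurentEval (HahnSeries.single (γ₂ j) (1 : K)) (T j)).coeff 0) :
    (f / ∏ j ∈ J, laurentEval (HahnSeries.single (γ₁ j) (1 : K)) (Q j)).coeff 0 =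
      (g / ∏ j ∈ J, laurentEval (HahnSeries.single (γ₂ j) (1 : K)) (Q j)).coeff 0 := by
  choose B hB0 hB using fun j => exists_truncation n (Q j)
  set C := ∑ j ∈ J, B j with hC
  have hC0 : 0 ≤ C := Finset.sum_nonneg fun j _ => hB0 j
  have hBC : ∀ j ∈ J, B j ≤ C := fun j hj => Finset.single_le_sum (fun i _ => hB0 i) hj
  choose T hT using fun j => hB j (1 + C * J.card - min m₁ m₂)
  have main : ∀ (γ : ι → Lex (ℕ → ℤ)) (h : Series K) (m : ℤ), h ∈ fil K n m → min m₁ m₂ ≤ m →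
      (∀ j ∈ J, 0 < γ j ∧ 1 ≤ wt n (γ j) ∧ wt n (γ j) ≤ n) →
      (h / ∏ j ∈ J, laurentEval (HahnSeries.single (γ j) (1 : K)) (Q j)).coeff 0 =
      (h * ∏ j ∈ J, laurentEval (HahnSeries.single (γ j) (1 : K)) (T j)).coeff 0 := by
    intro γ h m hm hmm hγ
    rw [div_eq_mul_inv, ← Finset.prod_inv_distrib, ← sub_eq_zero, ← HahnSeries.coeff_sub,
      ← mul_sub]
    refine coeff_zero_of_fil (n := n) ?_
    have hj : ∀ j ∈ J, _ := fun j hj => hT j (γ j) (hγ j hj).1 (hγ j hj).2.1 (hγ j hj).2.2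
    refine fil_mono n ?_ (fil_mul hm (fil_prod_sub J hC0
      (fun j h => fil_mono n (neg_le_neg (hBC j h)) (hj j h).1)
      (fun j h => fil_mono n (neg_le_neg (hBC j h)) (hj j h).2.1) (fun j h => (hj j h).2.2)))
    linarith
  rw [main γ₁ f m₁ hf (min_le_left _ _) h₁, main γ₂ g m₂ hg (min_le_right _ _) h₂, H T]

/-- Inverting all variables and reversing their order maps the region `|z_1| ≪ |z_2| ≪ ⋯` to the
region `|z_1| ≫ |z_2| ≫ ⋯`, without a change of the constant term. -/
theorem coeff_zero_reverse (s : ℤˣ) (n : ℕ) {g₁ g₂ : α → ℕ} (hg₁ : Function.Injective g₁)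
    (hg₂ : Function.Injective g₂) (J : Finset (α × α))
    (h₁ : ∀ j ∈ J, g₁ j.1 < g₁ j.2 ∧ g₁ j.2 < n) (h₂ : ∀ j ∈ J, g₂ j.2 < g₂ j.1 ∧ g₂ j.1 < n)
    (Q : α × α → LaurentPolynomial K) (P : AddMonoidAlgebra K (α →₀ ℤ)) :
    (relExpand s g₁ P /
        ∏ j ∈ J, laurentEval (sv K s (g₁ j.2) / sv K s (g₁ j.1)) (Q j)).coeff 0 =
      (relExpand (-s) g₂ P /
        ∏ j ∈ J, laurentEval (sv K (-s) (g₂ j.2) / sv K (-s) (g₂ j.1)) (Q j)).coeff 0 := by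
  obtain ⟨m₁, hm₁⟩ := relExpand_fil s g₁ n P
  obtain ⟨m₂, hm₂⟩ := relExpand_fil (-s) g₂ n P
  have e : ∀ a b, sv K (-s) b / sv K (-s) a = sv K s a / sv K s b := by
    intro a b
    rw [sv_neg, sv_neg, inv_div_inv]
  have key := coeff_zero_div_congr J n (γ₁ := fun j => smallExp (g₁ j.1) (g₁ j.2))
    (γ₂ := fun j => smallExp (g₂ j.2) (g₂ j.1))
    (fun j hj => by
      obtain ⟨h1, h2⟩ := h₁ j hj
      have h3 := wt_smallExp (h1.trans h2) h2
      exact ⟨smallExp_pos h1, by rw [h3]; omega, by rw [h3]; omega⟩)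
    (fun j hj => by
      obtain ⟨h1, h2⟩ := h₂ j hj
      have h3 := wt_smallExp (h1.trans h2) h2
      exact ⟨smallExp_pos h1, by rw [h3]; omega, by rw [h3]; omega⟩)
    (fun j => if s = 1 then LaurentPolynomial.invert (Q j) else Q j) hm₁ hm₂ ?_
  · simpa only [← ratio_eq_smallExp, e] using key
  · intro T
    set T' : α × α → LaurentPolynomial K := fun j =>
      if s = 1 then LaurentPolynomial.invert (T j) else T j with hT'
    have hTT : ∀ j, T j = if s = 1 then LaurentPolynomial.invert (T' j) else T' j := by
      intro j
      simp only [hT']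
      split_ifs
      · exact (LaurentPolynomial.involutive_invert (T j)).symm
      · rfl
    simp only [hTT, ← ratio_eq_smallExp]
    simp only [← e (g₂ _) (g₂ _), ← relExpand_pairLaurent, ← map_prod, ← map_mul,
      relExpand_coeff_zero _ hg₁, relExpand_coeff_zero _ hg₂]

end Expansions

section Supports

variable {K : Type*} [Field K]

/-- The exponents of a product of series in one variable each. -/
lemma prod_support {ι : Type*} (J : Finset ι) (c : ℤ) (γ : ι → Lex (ℕ → ℤ)) (f : ι → Series K)
    (hf : ∀ j ∈ J, ∀ δ, (f j).coeff δ ≠ 0 → ∃ k : ℤ, -c ≤ k ∧ δ = k • γ j) {δ : Lex (ℕ → ℤ)}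
    (hδ : (∏ j ∈ J, f j).coeff δ ≠ 0) :
    ∃ t : ι → ℤ, (∀ j ∈ J, -c ≤ t j) ∧ δ = ∑ j ∈ J, t j • γ j := by
  classical
  induction J using Finset.induction_on generalizing δ with
  | empty =>
    refine ⟨0, by simp, ?_⟩
    rw [Finset.prod_empty] at hδ
    rw [Finset.sum_empty]
    by_contra h
    exact hδ (HahnSeries.coeff_single_of_ne h)
  | insert j J hj ih =>
    rw [Finset.prod_insert hj] at hδ
    obtain ⟨a, ha, b, hb, rfl⟩ := Set.mem_add.mp (HahnSeries.support_mul_subset hδ)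
    obtain ⟨k, hk, rfl⟩ := hf j (Finset.mem_insert_self _ _) a ha
    obtain ⟨t, ht, rfl⟩ := ih (fun i hi => hf i (Finset.mem_insert_of_mem hi)) hb
    have hne : ∀ i ∈ J, i ≠ j := fun i hi h => hj (h ▸ hi)
    refine ⟨Function.update t j k, fun i hi => ?_, ?_⟩
    · rcases Finset.mem_insert.mp hi with rfl | hi
      · simpa using hk
      · rw [Function.update_of_ne (hne i hi)]
        exact ht i hi
    · rw [Finset.sum_insert hj, Function.update_self]
      congr 1
      exact Finset.sum_congr rfl fun i hi => by rw [Function.update_of_ne (hne i hi)]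

/-- A rational function of `z_b / z_a`, `a < b`, is expanded as a Laurent series in one small
monomial, and its order does not depend on `a` and `b`. -/
lemma exists_quotient_support (s : ℤˣ) (P Q : LaurentPolynomial K) :
    ∃ c : ℤ, 0 ≤ c ∧ ∀ a b : ℕ, a < b → ∀ δ,
      (laurentEval (sv K s b / sv K s a) P / laurentEval (sv K s b / sv K s a) Q).coeff δ ≠ 0 →
      ∃ k : ℤ, -c ≤ k ∧ δ = k • smallExp a b := by
  set P' := if s = 1 then LaurentPolynomial.invert P else P
  set Q' := if s = 1 then LaurentPolynomial.invert Q else Q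
  set f : HahnSeries ℤ K := laurentEval (HahnSeries.single (1 : ℤ) (1 : K)) P' /
    laurentEval (HahnSeries.single (1 : ℤ) (1 : K)) Q' with hf
  refine ⟨|f.order|, abs_nonneg _, fun a b hab δ hδ => ?_⟩
  rw [ratio_eq_smallExp, ratio_eq_smallExp, ← embOne_laurentEval (smallExp_pos hab),
    ← embOne_laurentEval (smallExp_pos hab), ← map_div₀] at hδ
  obtain ⟨k, hk, h⟩ := embOne_coeff _ _ hδ
  exact ⟨k, (neg_abs_le _).trans (HahnSeries.order_le_of_coeff_ne_zero h), hk⟩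

variable {I : Type*} [DecidableEq I]

/-- The quotient `ζ_{ij}(x⁻¹) / ζ_{ji}(x)`: the factor that appears when `z_p` and `z_q` of colors
`i` and `j` are exchanged, for `x = z_q / z_p`. -/
noncomputable def ZetaDatum.ratio (ζ : ZetaDatum K I) {F : Type*} [Field F] [Algebra K F]
    (i j : I) (x : F) : F := ζ.eval i j x⁻¹ / ζ.eval j i x

lemma ratio_eq_laurent (ζ : ZetaDatum K I) {F : Type*} [Field F] [Algebra K F]
    (i j : I) {x : F} (hx : x ≠ 0) (hx1 : 1 - x ≠ 0) :
    ζ.ratio i j x = laurentEval x (ζ.op.num j i) / laurentEval x (ζ.num j i) := by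
  rw [ZetaDatum.ratio, ← ZetaDatum.op_eval ζ j i hx, ZetaDatum.eval, ZetaDatum.eval]
  split_ifs
  · rw [div_div_div_cancel_right₀ hx1]
  · rw [div_one, div_one]

lemma inv_eval_eq_laurent (ζ : ZetaDatum K I) {F : Type*} [Field F] [Algebra K F]
    (i j : I) {x : F} (hx : x ≠ 0) :
    (ζ.eval i j x)⁻¹ = laurentEval x (if i = j then LaurentPolynomial.T 0 - LaurentPolynomial.T 1
      else LaurentPolynomial.T 0 : LaurentPolynomial K) / laurentEval x (ζ.num i j) := by
  rw [ZetaDatum.eval, inv_div]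
  congr 1
  split_ifs
  · rw [laurentEval_eq_lift hx, map_sub, ← laurentEval_eq_lift hx, ← laurentEval_eq_lift hx,
      laurentEval_T, laurentEval_T, zpow_zero, zpow_one]
  · rw [laurentEval_T, zpow_zero]

lemma ratio_sv_ne_zero (s : ℤˣ) (a b : ℕ) : sv K s b / sv K s a ≠ 0 :=
  div_ne_zero (sv_ne_zero _ _) (sv_ne_zero _ _)

variable [CharZero K] [Finite I]

lemma exists_uniform_support {β : Type*} [Finite β] (s : ℤˣ) (P Q : β → LaurentPolynomial K) :
    ∃ c : ℤ, 0 ≤ c ∧ ∀ i, ∀ a b : ℕ, a < b → ∀ δ,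
      (laurentEval (sv K s b / sv K s a) (P i) /
        laurentEval (sv K s b / sv K s a) (Q i)).coeff δ ≠ 0 →
      ∃ k : ℤ, -c ≤ k ∧ δ = k • smallExp a b := by
  choose c hc0 hc using fun i => exists_quotient_support s (P i) (Q i)
  obtain ⟨M, hM⟩ := (Set.finite_range c).bddAbove
  refine ⟨max M 0, le_max_right _ _, fun i a b hab δ hδ => ?_⟩
  obtain ⟨k, hk, h⟩ := hc i a b hab δ hδ
  have := hM ⟨i, rfl⟩
  exact ⟨k, by have := le_max_left M 0; omega, h⟩

lemma exists_ratio_support (s : ℤˣ) (ζ : ZetaDatum K I) :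
    ∃ c : ℤ, 0 ≤ c ∧ ∀ (i j : I) (a b : ℕ), a < b → ∀ δ,
      (ζ.ratio i j (sv K s b / sv K s a)).coeff δ ≠ 0 →
      ∃ k : ℤ, -c ≤ k ∧ δ = k • smallExp a b := by
  obtain ⟨c, hc, h⟩ := exists_uniform_support s (fun i : I × I => ζ.op.num i.2 i.1)
    (fun i : I × I => ζ.num i.2 i.1)
  refine ⟨c, hc, fun i j a b hab δ hδ => h (i, j) a b hab δ ?_⟩
  rwa [ratio_eq_laurent ζ i j (ratio_sv_ne_zero s a b) (ratio_ne_one s hab)] at hδ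

lemma exists_inv_eval_support (s : ℤˣ) (ζ : ZetaDatum K I) :
    ∃ c : ℤ, 0 ≤ c ∧ ∀ (i j : I) (a b : ℕ), a < b → ∀ δ,
      ((ζ.eval i j (sv K s b / sv K s a))⁻¹).coeff δ ≠ 0 →
      ∃ k : ℤ, -c ≤ k ∧ δ = k • smallExp a b := by
  obtain ⟨c, hc, h⟩ := exists_uniform_support s (fun i : I × I => if i.1 = i.2 then
    LaurentPolynomial.T 0 - LaurentPolynomial.T 1 else LaurentPolynomial.T 0)
    (fun i : I × I => ζ.num i.1 i.2)
  refine ⟨c, hc, fun i j a b hab δ hδ => h (i, j) a b hab δ ?_⟩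
  rwa [inv_eval_eq_laurent ζ i j (ratio_sv_ne_zero s a b)] at hδ

end Supports

/-! ### The image of a word in the shuffle algebra -/

section Words

variable {I : Type*} [DecidableEq I]

lemma wordDeg_nil : wordDeg ([] : List (I × ℤ)) = 0 := by
  funext i
  simp [wordDeg]

lemma wordDeg_cons (x : I × ℤ) (w : List (I × ℤ)) :
    wordDeg (x :: w) = Pi.single x.1 1 + wordDeg w := by
  funext i
  change (Finset.univ.filter fun a : Fin (w.length + 1) => ((x :: w).get a).1 = i).card = _
  rw [Fin.card_filter_univ_succ]
  by_cases h : x.1 = i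
  · refine (if_pos h).trans ?_
    rw [Pi.add_apply, Pi.single_apply, if_pos h.symm, add_comm]
    rfl
  · refine (if_neg h).trans ?_
    rw [Pi.add_apply, Pi.single_apply, if_neg (Ne.symm h), zero_add]
    rfl

lemma letterVar_cons_zero (x : I × ℤ) (w : List (I × ℤ)) :
    letterVar (x :: w) (0 : Fin (w.length + 1)) = (x.1, 0) := by
  refine Prod.ext rfl ?_
  change (Finset.univ.filter fun b : Fin (w.length + 1) => b < 0 ∧ _).card = 0
  simp

lemma letterVar_cons_succ [Fintype I] (x : I × ℤ) (w : List (I × ℤ)) (a : Fin w.length) :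
    letterVar (x :: w) (a.succ : Fin (w.length + 1)) =
      shift (Pi.single x.1 1) (letterVar w a) := by
  refine Prod.ext rfl ?_
  change (Finset.univ.filter fun b : Fin (w.length + 1) => b < a.succ ∧
    ((x :: w).get b).1 = ((x :: w).get a.succ).1).card = _
  rw [Fin.card_filter_univ_succ, shift_apply]
  have h : (Finset.univ.filter fun b : Fin w.length => b.succ < a.succ ∧
      ((x :: w).get b.succ).1 = ((x :: w).get a.succ).1).card = (letterVar w a).2 := by
    simp only [Fin.succ_lt_succ_iff]
    rfl
  change (if _ then (Finset.univ.filter fun b : Fin w.length => b.succ < a.succ ∧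
      ((x :: w).get b.succ).1 = ((x :: w).get a.succ).1).card + 1 else
      (Finset.univ.filter fun b : Fin w.length => b.succ < a.succ ∧
      ((x :: w).get b.succ).1 = ((x :: w).get a.succ).1).card) = _
  rw [h]
  have h2 : (letterVar w a).1 = (w.get a).1 := rfl
  have h3 : ((x :: w).get a.succ).1 = (w.get a).1 := rfl
  have h4 : ((x :: w).get (0 : Fin (w.length + 1))).1 = x.1 := rfl
  simp only [Pi.single_apply, h2]
  by_cases hc : x.1 = (w.get a).1
  · rw [if_pos ⟨Fin.succ_pos a, by rw [h3]; exact hc⟩, if_pos hc.symm, add_comm]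
  · rw [if_neg (fun h => hc (by rw [← h3]; exact h.2)), if_neg (Ne.symm hc), zero_add]

lemma letterVar_injective (w : List (I × ℤ)) : Function.Injective (letterVar w) := by
  intro a b h
  rw [letterVar_eq w (w.get a), letterVar_eq w (w.get a)] at h
  exact Fin.ext (label_inj h)

variable [Fintype I]

lemma letterVar_mem_box (w : List (I × ℤ)) (a : Fin w.length) :
    letterVar w a ∈ box (wordDeg w) := by
  rw [mem_box, letterVar_eq w (w.get a), wordDeg_eq w (w.get a)]
  exact label_lt a.2 _

lemma sum_wordDeg (w : List (I × ℤ)) : ∑ i, wordDeg w i = w.length := by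
  rw [← Finset.card_fin w.length]
  exact (Finset.card_eq_sum_card_fiberwise fun a _ => Finset.mem_coe.mpr (Finset.mem_univ _)).symm

lemma card_box (n : I → ℕ) : (box n).card = ∑ i, n i := by
  rw [box, Finset.card_map, Finset.card_sigma]
  simp

/-- The letters of a word correspond to the variables in the box of its degree. -/
noncomputable def letterEquiv (w : List (I × ℤ)) : Fin w.length ≃ {x // x ∈ box (wordDeg w)} :=
  Equiv.ofBijective (fun a => ⟨letterVar w a, letterVar_mem_box w a⟩) <| by
    rw [Fintype.bijective_iff_injective_and_card]
    refine ⟨fun a b h => letterVar_injective w (congrArg Subtype.val h), ?_⟩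
    rw [Fintype.card_coe, card_box, sum_wordDeg, Fintype.card_fin]

lemma letterEquiv_val (w : List (I × ℤ)) (a : Fin w.length) :
    (letterEquiv w a).1 = letterVar w a := rfl

lemma prod_box {M : Type*} [CommMonoid M] (w : List (I × ℤ)) (f : I × ℕ → M) :
    ∏ x ∈ box (wordDeg w), f x = ∏ a, f (letterVar w a) := by
  rw [← Finset.prod_coe_sort]
  exact (Fintype.prod_equiv (letterEquiv w) _ _ fun a => rfl).symm

lemma sum_box {M : Type*} [AddCommMonoid M] (w : List (I × ℤ)) (f : I × ℕ → M) :
    ∑ x ∈ box (wordDeg w), f x = ∑ a, f (letterVar w a) := by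
  rw [← Finset.sum_coe_sort]
  exact (Fintype.sum_equiv (letterEquiv w) _ _ fun a => rfl).symm

lemma exists_wordDeg (n : I → ℕ) : ∃ w : List (I × ℤ), wordDeg w = n := by
  obtain ⟨k, hk⟩ : ∃ k, ∑ i, n i = k := ⟨_, rfl⟩
  induction k generalizing n with
  | zero =>
    refine ⟨[], ?_⟩
    rw [wordDeg_nil]
    funext i
    exact (Finset.sum_eq_zero_iff.mp hk i (Finset.mem_univ i)).symm
  | succ k ih =>
    obtain ⟨i, -, hi⟩ := Finset.exists_ne_zero_of_sum_ne_zero (by omega : ∑ i, n i ≠ 0)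
    have hn : Pi.single i 1 + (n - Pi.single i 1) = n := by
      funext j
      simp only [Pi.add_apply, Pi.sub_apply, Pi.single_apply]
      split_ifs with h
      · subst h; omega
      · omega
    obtain ⟨w, hw⟩ := ih (n - Pi.single i 1) (by
      have h : ∑ j, (Pi.single i 1 + (n - Pi.single i 1) : I → ℕ) j = k + 1 := by rw [hn, hk]
      simp only [Pi.add_apply, Finset.sum_add_distrib, Finset.sum_pi_single', Finset.mem_univ,
        if_true] at h
      omega)
    exact ⟨(i, 0) :: w, by rw [wordDeg_cons, hw, hn]⟩

end Words

section UpsilonWord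

variable {K I : Type*} [Field K] [Fintype I] [DecidableEq I]

local notation "ι" => algebraMap (Laurent K I) (Rational K I)

lemma prod_lt_succ {M : Type*} [CommMonoid M] (n : ℕ) (f : Fin (n + 1) → Fin (n + 1) → M) :
    ∏ p : Fin (n + 1) × Fin (n + 1) with p.1 < p.2, f p.1 p.2 =
      (∏ b : Fin n, f 0 b.succ) *
        ∏ p : Fin n × Fin n with p.1 < p.2, f p.1.succ p.2.succ := by
  simp only [Finset.prod_filter, Fintype.prod_prod_type, Fin.prod_univ_succ,
    if_false, one_mul, Fin.succ_pos, if_true, Fin.not_lt_zero, Fin.succ_lt_succ_iff]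

/-- The rational function whose symmetrization is the image of a word in the shuffle algebra. -/
noncomputable def wordRat (ζ : ZetaDatum K I) (w : List (I × ℤ)) : Rational K I :=
  (∏ a, rz K (letterVar w a) ^ (w.get a).2) *
    ∏ p : Fin w.length × Fin w.length with p.1 < p.2,
      ζ.eval (w.get p.1).1 (w.get p.2).1 (rz K (letterVar w p.1) / rz K (letterVar w p.2))

lemma wordRat_cons (ζ : ZetaDatum K I) (x : I × ℤ) (w : List (I × ℤ)) :
    wordRat ζ (x :: w) = rz K (x.1, 0) ^ x.2 *
      ratSubst K (shift (Pi.single x.1 1)) (wordRat ζ w) *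
        cross ζ (box (Pi.single x.1 1)) (box (Pi.single x.1 1 + wordDeg w) \
          box (Pi.single x.1 1)) := by
  have h1 : ∏ a, rz K (letterVar (x :: w) a) ^ ((x :: w).get a).2 = rz K (x.1, 0) ^ x.2 *
      ∏ a, rz K (shift (Pi.single x.1 1) (letterVar w a)) ^ (w.get a).2 := by
    change ∏ a : Fin (w.length + 1), rz K (letterVar (x :: w) a) ^ ((x :: w).get a).2 = _
    rw [Fin.prod_univ_succ, letterVar_cons_zero]
    simp only [letterVar_cons_succ]
    rfl
  have h2 := prod_lt_succ w.length fun p q => ζ.eval ((x :: w).get p).1 ((x :: w).get q).1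
    (rz K (letterVar (x :: w) p) / rz K (letterVar (x :: w) q))
  simp only [letterVar_cons_zero, letterVar_cons_succ] at h2
  rw [wordRat, h1]
  refine (congrArg _ h2).trans ?_
  rw [← box_map_shift, cross, box_single, Finset.prod_singleton, Finset.prod_map, prod_box,
    wordRat]
  simp only [map_mul, map_prod, map_zpow₀, map_zeta, map_div₀, ratSubst_rz]
  change _ * ((∏ b : Fin w.length, ζ.eval x.1 (w.get b).1
    (rz K (x.1, 0) / rz K (shift (Pi.single x.1 1) (letterVar w b)))) *
    ∏ p : Fin w.length × Fin w.length with p.1 < p.2, ζ.eval (w.get p.1).1 (w.get p.2).1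
      (rz K (shift (Pi.single x.1 1) (letterVar w p.1)) /
        rz K (shift (Pi.single x.1 1) (letterVar w p.2)))) = _
  have h3 : ∀ b : Fin w.length, (shift (Pi.single x.1 1) (letterVar w b)).1 = (w.get b).1 :=
    fun b => rfl
  simp only [h3]
  ring

variable [CharZero K]

/-- The shuffle product with an element that is itself a symmetrization. -/
lemma ratShuffle_sym (ζ : ZetaDatum K I) (n n' : I → ℕ) {R Q : Laurent K I} {G : Rational K I}
    (hR : R ∈ symLaurent K n) (hQ : ι Q = sym n' G) :
    ratShuffle ζ n n' R Q = ((∏ i, (n i).factorial : ℕ) : K)⁻¹ •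
      sym (n + n') (ι R * ratSubst K (shift n) G * cross ζ (box n) (box (n + n') \ box n)) := by
  unfold ratShuffle
  rw [← ratSubst_algebraMap, hQ, sym_smul, sym.eq_def n', map_sum]
  set W := cross ζ (box n) (box (n + n') \ box n) with hW
  have hcomm : ∀ (σ : Equiv.Perm (I × ℕ)) (G : Rational K I),
      ratSubst K (shift n) (ratSubst K σ.toEmbedding G) =
      ratSubst K (σ.viaEmbedding (shift n)).toEmbedding (ratSubst K (shift n) G) := by
    intro σ G
    rw [ratSubst_ratSubst, ratSubst_ratSubst]
    congr 1
    have : σ.toEmbedding.trans (shift n) =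
        (shift n).trans (σ.viaEmbedding (shift n)).toEmbedding := by
      ext x : 1
      exact (Equiv.Perm.viaEmbedding_apply σ (shift n) x).symm
    rw [this]
  have hinv : ∀ σ ∈ colorPerm n',
      ratSubst K (σ.viaEmbedding (shift n)).toEmbedding (ι R * W) = ι R * W := by
    intro σ hσ
    obtain ⟨h1, h2⟩ := viaEmbedding_mem (n := n) hσ
    have hbn : (box n).map (σ.viaEmbedding (shift n)).toEmbedding = box n :=
      map_eq_self fun x hx => h2 x (mem_box.mp hx)
    rw [map_mul, ratSubst_algebraMap, hW, ratSubst_cross ζ _ h1.1]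
    congr 2
    · exact (subst_congr hR (g := id) fun x hx => h2 x hx).trans (subst_id R)
    · rw [Finset.map_sdiff, hbn, box_map_perm h1]
  have : ι R * (∑ σ : colorPerm n', ratSubst K (shift n)
      (ratSubst K (σ : Equiv.Perm (I × ℕ)).toEmbedding G)) * W =
      ∑ σ : colorPerm n',
        ratSubst K ((σ : Equiv.Perm (I × ℕ)).viaEmbedding (shift n)).toEmbedding
        (ι R * W * ratSubst K (shift n) G) := by
    rw [mul_right_comm, Finset.mul_sum]
    refine Finset.sum_congr rfl fun σ _ => ?_
    rw [map_mul, hinv σ σ.2, hcomm]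
  rw [this, sym_sum_ratSubst
    (fun σ : colorPerm n' => (σ : Equiv.Perm (I × ℕ)).viaEmbedding (shift n))
    (fun σ => (viaEmbedding_mem (n := n) σ.2).1), smul_smul, card_colorPerm]
  congr 1
  · have h1 := factorial_ne_zero (K := K) n
    have h2 := factorial_ne_zero (K := K) n'
    simp only [Nat.cast_mul]
    field_simp
  · congr 1; ring

/-- The image of a word under `Υ̃` is the symmetrization of `∏ z_a^{d_a} ∏_{a < b} ζ(z_a / z_b)`. -/
theorem exists_upsilon_word (ζ : ZetaDatum K I) (w : List (I × ℤ)) {n : I → ℕ}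
    (hn : wordDeg w = n) : ∃ e : Component ζ n,
      upsilon ζ (w.map fun x => QuadAlg.gen ζ x.1 x.2).prod = DirectSum.of (Component ζ) n e ∧
      ι e.val = sym n (wordRat ζ w) := by
  induction w generalizing n with
  | nil =>
    rw [wordDeg_nil] at hn
    subst hn
    refine ⟨Component.one ζ, ?_, ?_⟩
    · rw [List.map_nil, List.prod_nil, map_one]
      rfl
    · have h : wordRat ζ ([] : List (I × ℤ)) = ι 1 := by
        rw [map_one, wordRat]
        have : IsEmpty (Fin ([] : List (I × ℤ)).length) := Fin.isEmpty
        rw [Finset.univ_eq_empty, Finset.prod_empty, one_mul, Finset.univ_eq_empty,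
          Finset.filter_empty, Finset.prod_empty]
      rw [h, sym_algebraMap one_mem_symLaurent, Component.val_one]
      simp
  | cons x w ih =>
    rw [wordDeg_cons] at hn
    subst hn
    obtain ⟨e, he, he'⟩ := ih rfl
    refine ⟨(Component.mk ζ _ (monomial_mem x.1 x.2)).mul e, ?_, ?_⟩
    · rw [List.map_cons, List.prod_cons, map_mul, he, upsilon_gen, zgen]
      exact DirectSum.of_mul_of _ _
    · rw [Component.mul_val, Component.val_mk, ratShuffle_sym ζ _ _ (monomial_mem x.1 x.2) he',
        algebraMap_monomial, wordRat_cons]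
      have hf : ∏ l, ((Pi.single x.1 1 : I → ℕ) l).factorial = 1 :=
        Finset.prod_eq_one fun l _ => by
          rw [Pi.single_apply]; split_ifs <;> rfl
      rw [hf, Nat.cast_one, inv_one, one_smul]

end UpsilonWord

/-! ### The pairing of two words as a sum over matchings -/

section WordEval

variable {K I : Type*} [Field K] [Fintype I] [DecidableEq I]

local notation "ι" => algebraMap (Laurent K I) (Rational K I)

open Classical in
/-- An injective numbering of all variables, under which the letters of `w` get their positions as
numbers. -/
noncomputable def wordIndex (w : List (I × ℤ)) (x : I × ℕ) : ℕ :=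
  if h : x ∈ box (wordDeg w) then (letterEquiv w).symm ⟨x, h⟩
  else w.length + (exists_injective_nat (I × ℕ)).choose x

lemma wordIndex_letterVar (w : List (I × ℤ)) (a : Fin w.length) :
    wordIndex w (letterVar w a) = a := by
  rw [wordIndex, dif_pos (letterVar_mem_box w a)]
  congr 1
  exact (Equiv.symm_apply_eq _).mpr rfl

lemma wordIndex_injective (w : List (I × ℤ)) : Function.Injective (wordIndex w) := by
  intro x y h
  unfold wordIndex at h
  split_ifs at h with hx hy hy
  · have := (letterEquiv w).symm.injective (Fin.ext h)
    exact congrArg Subtype.val this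
  · have := ((letterEquiv w).symm ⟨x, hx⟩).2
    omega
  · have := ((letterEquiv w).symm ⟨y, hy⟩).2
    omega
  · exact (exists_injective_nat (I × ℕ)).choose_spec (Nat.add_left_cancel h)

/-- The expansion of rational functions that plugs in the variable `z_a` of the expansion for the
variable of the letter number `a` of the word `w`. -/
noncomputable def wordEval (s : ℤˣ) (w : List (I × ℤ)) : Rational K I →ₐ[K] Series K :=
  IsFractionRing.liftAlgHom (R := K) (A := Laurent K I) (K := Rational K I)
    (g := relExpand s (wordIndex w)) (relExpand_injective s (wordIndex_injective w))

lemma wordEval_algebraMap (s : ℤˣ) (w : List (I × ℤ)) (P : Laurent K I) :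
    wordEval s w (ι P) = relExpand s (wordIndex w) P :=
  IsFractionRing.lift_algebraMap (g := (relExpand (K := K) s (wordIndex w)).toRingHom)
    (relExpand_injective s (wordIndex_injective w)) P

lemma wordEval_rz (s : ℤˣ) (w : List (I × ℤ)) (x : I × ℕ) :
    wordEval s w (rz K x) = sv K s (wordIndex w x) := by
  rw [rz, wordEval_algebraMap, z, relExpand_zpow, zpow_one]

lemma single_sum_one {α β : Type*} (S : Finset β) (f : β → α →₀ ℤ) :
    (AddMonoidAlgebra.single (∑ x ∈ S, f x) 1 : AddMonoidAlgebra K (α →₀ ℤ)) =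
      ∏ x ∈ S, AddMonoidAlgebra.single (f x) 1 := by
  classical
  induction S using Finset.induction_on with
  | empty => rfl
  | insert x S hx ih =>
    rw [Finset.sum_insert hx, Finset.prod_insert hx, ← ih, AddMonoidAlgebra.single_mul_single,
      mul_one]

lemma sum_eq_wordEval (s : ℤˣ) (w : List (I × ℤ)) {R : Laurent K I}
    (hR : R ∈ symLaurent K (wordDeg w)) :
    (R.coeff.sum fun m x => algebraMap K (Series K) x *
        ∏ a : Fin w.length, sv K s a ^ m (letterVar w a)) = wordEval s w (ι R) := by
  have hsum : R = ∑ m ∈ R.coeff.support, R.coeff m • AddMonoidAlgebra.single m (1 : K) := by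
    apply AddMonoidAlgebra.ext
    rw [AddMonoidAlgebra.coeff_sum]
    simp only [AddMonoidAlgebra.coeff_smul, AddMonoidAlgebra.coeff_single, Finsupp.smul_single,
      smul_eq_mul, mul_one]
    exact (Finsupp.sum_single R.coeff).symm
  rw [wordEval_algebraMap]
  conv_rhs => rw [hsum]
  rw [map_sum, Finsupp.sum]
  refine Finset.sum_congr rfl fun m hm => ?_
  rw [map_smul, Algebra.smul_def]
  congr 1
  have hm' : m = ∑ x ∈ box (wordDeg w), Finsupp.single x (m x) := by
    rw [← Finsupp.sum_of_support_subset m (s := box (wordDeg w)) (fun x hx => ?_)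
      (fun x k => Finsupp.single x k) (by simp)]
    · exact (Finsupp.sum_single m).symm
    · rw [mem_box]
      by_contra h
      exact Finsupp.mem_support_iff.mp hx (hR.1 m hm x (not_lt.mp h))
  conv_rhs => rw [hm']
  rw [single_sum_one, map_prod, prod_box]
  refine Finset.prod_congr rfl fun a _ => ?_
  rw [relExpand_zpow, wordIndex_letterVar]

lemma wordPairing_eq_wordEval (s : ℤˣ) (ζ : ZetaDatum K I) (w : List (I × ℤ)) {R : Laurent K I}
    (hR : R ∈ symLaurent K (wordDeg w)) :
    wordPairing s ζ w R = ((∏ a : Fin w.length, sv K s a ^ (w.get a).2) * wordEval s w (ι R) /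
      ∏ p : Fin w.length × Fin w.length with p.1 < p.2,
        ζ.eval (w.get p.2).1 (w.get p.1).1 (sv K s p.2 / sv K s p.1)).coeff 0 := by
  rw [wordPairing, sum_eq_wordEval s w hR]

end WordEval

section Matchings

variable {I : Type*} [DecidableEq I]

/-- A bijection between the letters of two words that preserves the colors. -/
abbrev Matching (w w' : List (I × ℤ)) : Type :=
  {ρ : Fin w'.length ≃ Fin w.length // ∀ a, (w.get (ρ a)).1 = (w'.get a).1}

/-- The inverse matching. -/
def Matching.symm {w w' : List (I × ℤ)} (ρ : Matching w w') : Matching w' w :=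
  ⟨ρ.1.symm, fun a => by rw [← ρ.2, Equiv.apply_symm_apply]⟩

lemma Matching.wordDeg_eq {w w' : List (I × ℤ)} (ρ : Matching w w') :
    wordDeg w' = wordDeg w := by
  funext i
  refine Finset.card_equiv ρ.1 fun a => ?_
  rw [Finset.mem_filter, Finset.mem_filter, ρ.2 a]
  simp only [Finset.mem_univ]

variable [Fintype I]

/-- Permutations of the variables, as matchings between the letters of two words. -/
noncomputable def matchingEquiv {w w' : List (I × ℤ)} (h : wordDeg w' = wordDeg w) :
    colorPerm (wordDeg w) ≃ Matching w w' :=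
  (colorPermEquiv (wordDeg w)).trans <|
    Equiv.subtypeEquiv (Equiv.equivCongr
      ((letterEquiv w').trans (Equiv.subtypeEquivRight fun x => by rw [h])).symm
      (letterEquiv w).symm) fun g => by
    set e' := (letterEquiv w').trans (Equiv.subtypeEquivRight fun x => by rw [h])
    have h1 : ∀ b, ((letterEquiv w).symm b |> w.get).1 = b.1.1 := by
      intro b
      conv_rhs => rw [← (letterEquiv w).apply_symm_apply b]
      rfl
    rw [funext_iff]
    refine ⟨fun hg a => (h1 _).trans (hg (e' a)), fun hg x => ?_⟩
    have h2 := hg (e'.symm x)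
    have h3 : ((letterEquiv w).symm (g (e' (e'.symm x))) |> w.get).1 =
      (w'.get (e'.symm x)).1 := h2
    rw [h1, Equiv.apply_symm_apply] at h3
    refine h3.trans ?_
    conv_rhs => rw [← e'.apply_symm_apply x]
    rfl

lemma letterVar_matchingEquiv {w w' : List (I × ℤ)} (h : wordDeg w' = wordDeg w)
    (σ : colorPerm (wordDeg w)) (a : Fin w'.length) :
    letterVar w ((matchingEquiv h σ).1 a) = (σ : Equiv.Perm (I × ℕ)) (letterVar w' a) := by
  rw [← letterEquiv_val]
  have : (matchingEquiv h σ).1 a = (letterEquiv w).symm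
    ((colorPermEquiv (wordDeg w) σ).1 ⟨letterVar w' a, by
      rw [← h]; exact letterVar_mem_box w' a⟩) := rfl
  rw [this, Equiv.apply_symm_apply]
  rfl

end Matchings

section Exchange

/-- The pairs of places whose order is reversed by a bijection. -/
def exchanged {n n' : ℕ} (ρ : Fin n' ≃ Fin n) : Finset (Fin n × Fin n) :=
  Finset.univ.filter fun p => p.1 < p.2 ∧ ρ.symm p.2 < ρ.symm p.1

lemma mem_exchanged {n n' : ℕ} {ρ : Fin n' ≃ Fin n} {p : Fin n × Fin n} :
    p ∈ exchanged ρ ↔ p.1 < p.2 ∧ ρ.symm p.2 < ρ.symm p.1 := by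
  simp [exchanged]

lemma prod_lt_equiv {M : Type*} [CommMonoid M] {n n' : ℕ} (ρ : Fin n' ≃ Fin n)
    (H : Fin n → Fin n → M) :
    ∏ p : Fin n' × Fin n' with p.1 < p.2, H (ρ p.1) (ρ p.2) =
      ∏ p : Fin n × Fin n with p.1 < p.2,
        if ρ.symm p.2 < ρ.symm p.1 then H p.2 p.1 else H p.1 p.2 := by
  refine Finset.prod_bij' (fun p _ => if ρ p.1 < ρ p.2 then (ρ p.1, ρ p.2) else (ρ p.2, ρ p.1))
    (fun p _ => if ρ.symm p.1 < ρ.symm p.2 then (ρ.symm p.1, ρ.symm p.2) else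
      (ρ.symm p.2, ρ.symm p.1)) ?_ ?_ ?_ ?_ ?_
  · rintro ⟨a, b⟩ hp
    simp only [Finset.mem_filter, Finset.mem_univ, true_and] at hp ⊢
    have : ρ a ≠ ρ b := fun h => hp.ne (ρ.injective h)
    split_ifs with h
    · exact h
    · exact lt_of_le_of_ne (not_lt.mp h) this.symm
  · rintro ⟨a, b⟩ hp
    simp only [Finset.mem_filter, Finset.mem_univ, true_and] at hp ⊢
    have : ρ.symm a ≠ ρ.symm b := fun h => hp.ne (ρ.symm.injective h)
    split_ifs with h
    · exact h
    · exact lt_of_le_of_ne (not_lt.mp h) this.symm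
  · rintro ⟨a, b⟩ hp
    simp only [Finset.mem_filter, Finset.mem_univ, true_and] at hp
    by_cases h : ρ a < ρ b
    · simp [h, hp]
    · simp [h, hp.not_gt]
  · rintro ⟨a, b⟩ hp
    simp only [Finset.mem_filter, Finset.mem_univ, true_and] at hp
    by_cases h : ρ.symm a < ρ.symm b
    · simp [h, hp]
    · simp [h, hp.not_gt]
  · rintro ⟨a, b⟩ hp
    simp only [Finset.mem_filter, Finset.mem_univ, true_and] at hp
    by_cases h : ρ a < ρ b
    · simp [h, hp.not_gt]
    · simp [h, hp]

/-- In a quotient of two products over ordered pairs, only the exchanged pairs survive. -/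
lemma prod_div_prod_exchanged {F : Type*} [Field F] {n n' : ℕ} (ρ : Fin n' ≃ Fin n)
    (G : Fin n → Fin n → F) (hG : ∀ p q, p < q → G q p ≠ 0) :
    (∏ p : Fin n' × Fin n' with p.1 < p.2, G (ρ p.2) (ρ p.1)) /
        ∏ p : Fin n × Fin n with p.1 < p.2, G p.2 p.1 =
      ∏ p ∈ exchanged ρ, G p.1 p.2 / G p.2 p.1 := by
  rw [prod_lt_equiv ρ fun a b => G b a, ← Finset.prod_div_distrib, exchanged,
    ← Finset.filter_filter, Finset.prod_filter (fun p : Fin n × Fin n => ρ.symm p.2 < ρ.symm p.1)]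
  refine Finset.prod_congr rfl fun p hp => ?_
  split_ifs with h
  · rfl
  · exact div_self (hG _ _ (Finset.mem_filter.mp hp).2)

variable {K I : Type*} [Field K] [CharZero K] [DecidableEq I]

/-- Two data with `ζ'_{ij}(x) = ζ_{ji}(x⁻¹)`, as functions on series. -/
def IsDual (ζ ζ' : ZetaDatum K I) : Prop :=
  ∀ i j (x : Series K), x ≠ 0 → ζ'.eval i j x = ζ.eval j i x⁻¹

lemma IsDual.symm {ζ ζ' : ZetaDatum K I} (h : IsDual ζ ζ') : IsDual ζ' ζ := fun i j x hx => by
  rw [h j i x⁻¹ (inv_ne_zero hx), inv_inv]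

lemma isDual_op (ζ : ZetaDatum K I) : IsDual ζ ζ.op := fun i j _ hx => ζ.op_eval i j hx

/-- The contribution of a matching of the letters to the pairing of two words. -/
noncomputable def matchingTerm (s : ℤˣ) (ζ : ZetaDatum K I) {w w' : List (I × ℤ)}
    (ρ : Matching w w') : K :=
  ((∏ a : Fin w.length, sv K s a ^ (w.get a).2) *
      (∏ a : Fin w'.length, sv K s (ρ.1 a) ^ (w'.get a).2) *
    ∏ p ∈ exchanged ρ.1, ζ.ratio (w.get p.1).1 (w.get p.2).1 (sv K s p.2 / sv K s p.1)).coeff 0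

lemma one_sub_ratio_ne_zero (s : ℤˣ) {a b : ℕ} (hab : a ≠ b) :
    1 - sv K s b / sv K s a ≠ 0 := by
  rcases lt_or_gt_of_ne hab with h | h
  · exact ratio_ne_one s h
  · intro h0
    apply ratio_ne_one (K := K) s h
    rw [← inv_div, ← sub_eq_zero.mp h0, inv_one, sub_self]

/-- The contribution of a matching is the same in both pairings. -/
theorem matchingTerm_symm (s : ℤˣ) {ζ ζ' : ZetaDatum K I} (hd : IsDual ζ ζ')
    {w w' : List (I × ℤ)} (ρ : Matching w w') :
    matchingTerm s ζ ρ = matchingTerm (-s) ζ' ρ.symm := by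
  have hlen : w'.length = w.length := by
    simpa using Fintype.card_congr ρ.1
  let g₁ : Fin w.length → ℕ := fun a => a
  let g₂ : Fin w.length → ℕ := fun a => ρ.1.symm a
  have hg₂ : Function.Injective g₂ := fun a b h => ρ.1.symm.injective (Fin.ext h)
  let P : AddMonoidAlgebra K (Fin w.length →₀ ℤ) :=
    (∏ a, AddMonoidAlgebra.single (Finsupp.single a (w.get a).2) 1) *
      (∏ a, AddMonoidAlgebra.single (Finsupp.single (ρ.1 a) (w'.get a).2) 1) *
      ∏ p ∈ exchanged ρ.1, pairLaurent p.1 p.2 (ζ.op.num (w.get p.2).1 (w.get p.1).1)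
  have key := coeff_zero_reverse s w.length (g₁ := g₁) (g₂ := g₂) Fin.val_injective hg₂
    (exchanged ρ.1) (fun p hp => ⟨(mem_exchanged.mp hp).1, p.2.2⟩)
    (fun p hp => ⟨(mem_exchanged.mp hp).2, (ρ.1.symm p.1).2.trans_eq hlen⟩)
    (fun p => ζ.num (w.get p.2).1 (w.get p.1).1) P
  -- the exchange factors as quotients of Laurent polynomials, under either substitution
  have hE : ∀ (t : ℤˣ) (g : Fin w.length → ℕ), Function.Injective g →
      relExpand t g P / ∏ p ∈ exchanged ρ.1, laurentEval (sv K t (g p.2) / sv K t (g p.1))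
        (ζ.num (w.get p.2).1 (w.get p.1).1) =
      (∏ a, sv K t (g a) ^ (w.get a).2) * (∏ a, sv K t (g (ρ.1 a)) ^ (w'.get a).2) *
        ∏ p ∈ exchanged ρ.1,
          ζ.ratio (w.get p.1).1 (w.get p.2).1 (sv K t (g p.2) / sv K t (g p.1)) := by
    intro t g hg
    simp only [P, map_mul, map_prod, relExpand_zpow, relExpand_pairLaurent]
    rw [mul_div_assoc, ← Finset.prod_div_distrib]
    congr 1
    refine Finset.prod_congr rfl fun p hp => ?_
    rw [ratio_eq_laurent ζ _ _ (ratio_sv_ne_zero t _ _) (one_sub_ratio_ne_zero t fun h =>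
      (mem_exchanged.mp hp).1.ne (hg h))]
  rw [hE s g₁ Fin.val_injective, hE (-s) g₂ hg₂] at key
  refine key.trans ?_
  rw [matchingTerm]
  congr 2
  · rw [mul_comm]
    congr 1
    refine Finset.prod_congr rfl fun a _ => ?_
    simp only [g₂, Equiv.symm_apply_apply]
  · refine Finset.prod_bij' (fun p _ => (ρ.1.symm p.2, ρ.1.symm p.1))
      (fun p _ => (ρ.1 p.2, ρ.1 p.1)) ?_ ?_ ?_ ?_ ?_
    · intro p hp
      rw [mem_exchanged] at hp ⊢
      simpa [Matching.symm] using hp.symm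
    · intro p hp
      rw [mem_exchanged] at hp ⊢
      simpa [Matching.symm] using hp.symm
    · intro p _; simp
    · intro p _; simp
    · intro p _
      have hc : ∀ a, (w'.get (ρ.1.symm a)).1 = (w.get a).1 := ρ.symm.2
      simp only [hc, g₂]
      rw [ZetaDatum.ratio, ZetaDatum.ratio, hd _ _ _ (inv_ne_zero (ratio_sv_ne_zero _ _ _)),
        hd _ _ _ (ratio_sv_ne_zero _ _ _), inv_inv, inv_div, inv_div]

variable [Fintype I]

lemma wordPairing_zero (s : ℤˣ) (ζ : ZetaDatum K I) (w : List (I × ℤ)) :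
    wordPairing s ζ w 0 = 0 := by
  rw [wordPairing, AddMonoidAlgebra.coeff_zero, Finsupp.sum_zero_index, mul_zero, zero_div,
    HahnSeries.coeff_zero]

/-- The pairing of a word with the image of a word is a sum over the matchings of their letters. -/
theorem pairing_upsilon_word (s : ℤˣ) {ζ ζ' : ZetaDatum K I} (hd : IsDual ζ ζ')
    (w w' : List (I × ℤ)) :
    pairing s ζ ζ' (w.map fun x => QuadAlg.gen ζ x.1 x.2).prod
        (upsilon ζ' (w'.map fun x => QuadAlg.gen ζ' x.1 x.2).prod) =
      ∑ ρ : Matching w w', matchingTerm s ζ ρ := by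
  by_cases h : wordDeg w' = wordDeg w
  swap
  · obtain ⟨e, he, he'⟩ := exists_upsilon_word ζ' w' rfl
    rw [pairing_word, he, DirectSum.of_eq_of_ne _ _ _ (Ne.symm h), map_zero, wordPairing_zero]
    have : IsEmpty (Matching w w') := ⟨fun ρ => h ρ.wordDeg_eq⟩
    rw [Finset.univ_eq_empty, Finset.sum_empty]
  obtain ⟨e, he, he'⟩ := exists_upsilon_word ζ' w' h
  rw [pairing_word, he, DirectSum.of_eq_same, wordPairing_eq_wordEval s ζ w e.mem, he', sym,
    map_sum, Finset.mul_sum, Finset.sum_div, HahnSeries.coeff_sum]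
  refine Fintype.sum_equiv (matchingEquiv h) _ _ fun σ => ?_
  set ρ := matchingEquiv h σ with hρ
  have hnum : wordEval s w (ratSubst K (σ : Equiv.Perm (I × ℕ)).toEmbedding (wordRat ζ' w')) =
      (∏ a : Fin w'.length, sv K s (ρ.1 a) ^ (w'.get a).2) *
      ∏ p : Fin w'.length × Fin w'.length with p.1 < p.2,
        ζ.eval (w.get (ρ.1 p.2)).1 (w.get (ρ.1 p.1)).1 (sv K s (ρ.1 p.2) / sv K s (ρ.1 p.1)) := by
    simp only [wordRat, map_mul, map_prod, map_zpow₀, map_zeta, map_div₀, ratSubst_rz,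
      wordEval_rz, Equiv.coe_toEmbedding, ← letterVar_matchingEquiv h, wordIndex_letterVar, ρ.2]
    simp only [hd _ _ _ (ratio_sv_ne_zero _ _ _), inv_div, hρ]
  rw [hnum, ← mul_assoc, mul_div_assoc, prod_div_prod_exchanged ρ.1
    (fun p q => ζ.eval (w.get p).1 (w.get q).1 (sv K s p / sv K s q))
    fun p q hpq => eval_ratio_ne_zero s ζ _ _ hpq, matchingTerm]
  simp only [ZetaDatum.ratio, inv_div]

end Exchange

/-! ### Symmetry of the pairing and the exponents of pairing words -/

section PairingSymm

variable {K I : Type*} [Field K] [CharZero K] [Fintype I] [DecidableEq I]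

/-- The word `w` in the quadratic quantum loop group. -/
def wordElt (ζ : ZetaDatum K I) (w : List (I × ℤ)) : QuadAlg ζ :=
  (w.map fun x => QuadAlg.gen ζ x.1 x.2).prod

lemma wordElt_eq_mk (ζ : ZetaDatum K I) (w : List (I × ℤ)) :
    wordElt ζ w = RingQuot.mkAlgHom K (QuadRel ζ) (wordProd w) := by
  rw [wordElt, wordProd, map_list_prod, List.map_map]
  rfl

lemma quad_induction {ζ : ZetaDatum K I} {p : QuadAlg ζ → Prop} (x : QuadAlg ζ)
    (h0 : p 0) (hw : ∀ w, p (wordElt ζ w)) (hadd : ∀ a b, p a → p b → p (a + b))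
    (hsmul : ∀ (r : K) a, p a → p (r • a)) : p x := by
  obtain ⟨y, rfl⟩ := RingQuot.mkAlgHom_surjective K (QuadRel ζ) x
  refine free_induction (p := fun y => p (RingQuot.mkAlgHom K (QuadRel ζ) y)) y ?_ ?_ ?_ ?_
  · rwa [map_zero]
  · intro w
    rw [← wordElt_eq_mk]
    exact hw w
  · intro a b ha hb
    rw [map_add]
    exact hadd _ _ ha hb
  · intro r a ha
    rw [map_smul]
    exact hsmul r _ ha

/-- The inverse of a matching, as an equivalence. -/
def matchingSymm (w w' : List (I × ℤ)) : Matching w w' ≃ Matching w' w :=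
  ⟨Matching.symm, Matching.symm, fun _ => rfl, fun _ => rfl⟩

/-- The two pairings coincide under the homomorphisms to the shuffle algebras. -/
theorem pairing_symm (s : ℤˣ) {ζ ζ' : ZetaDatum K I} (hd : IsDual ζ ζ') (x : QuadAlg ζ)
    (y : QuadAlg ζ') :
    pairing s ζ ζ' x (upsilon ζ' y) = pairing (-s) ζ' ζ y (upsilon ζ x) := by
  refine quad_induction (p := fun x => pairing s ζ ζ' x (upsilon ζ' y) =
    pairing (-s) ζ' ζ y (upsilon ζ x)) x (by simp) (fun w => ?_)
    (fun a b ha hb => by simp only [map_add, LinearMap.add_apply, ha, hb])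
    (fun r a ha => by simp only [map_smul, LinearMap.smul_apply, ha])
  refine quad_induction (p := fun y => pairing s ζ ζ' (wordElt ζ w) (upsilon ζ' y) =
    pairing (-s) ζ' ζ y (upsilon ζ (wordElt ζ w))) y (by simp) (fun w' => ?_)
    (fun a b ha hb => by simp only [map_add, LinearMap.add_apply, ha, hb])
    (fun r a ha => by simp only [map_smul, LinearMap.smul_apply, ha])
  refine (pairing_upsilon_word s hd w w').trans ?_
  refine Eq.trans ?_ (pairing_upsilon_word (-s) hd.symm w' w).symm
  exact Fintype.sum_equiv (matchingSymm w w') _ _ fun ρ => matchingTerm_symm s hd ρ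

end PairingSymm

section WordSupports

variable {K I : Type*} [Field K] [CharZero K] [Fintype I] [DecidableEq I]

local notation "ι" => algebraMap (Laurent K I) (Rational K I)

/-- The exponent of the variable number `b`. -/
def lexEval (b : ℕ) : Lex (ℕ → ℤ) →+ ℤ where
  toFun γ := ofLex γ b
  map_zero' := rfl
  map_add' _ _ := rfl

lemma lexEval_single (b a : ℕ) (k : ℤ) :
    lexEval b (toLex (Pi.single a k)) = if b = a then k else 0 :=
  Pi.single_apply (M := ℤ) a k b

lemma lexEval_smallExp (b p q : ℕ) :
    lexEval b (smallExp p q) = (if b = p then 1 else 0) - (if b = q then 1 else 0) := by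
  rw [← lexEval_single b p 1, ← lexEval_single b q 1, ← map_sub]
  rfl

lemma prod_sv_zpow {β : Type*} (s : ℤˣ) (S : Finset β) (g : β → ℕ) (d : β → ℤ) :
    ∏ a ∈ S, sv K s (g a) ^ d a =
      HahnSeries.single (∑ a ∈ S, d a • toLex (Pi.single (g a) (s : ℤ))) 1 := by
  classical
  induction S using Finset.induction_on with
  | empty => rfl
  | insert x S hx ih =>
    rw [Finset.prod_insert hx, Finset.sum_insert hx, ih, sv, single_zpow,
      HahnSeries.single_mul_single, mul_one]

lemma coeff_single_mul_ne_zero {γ : Lex (ℕ → ℤ)} {f : Series K}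
    (h : (HahnSeries.single γ (1 : K) * f).coeff 0 ≠ 0) : f.coeff (-γ) ≠ 0 := by
  obtain ⟨a, ha, b, hb, hab⟩ := Set.mem_add.mp (HahnSeries.support_mul_subset h)
  rw [Set.mem_singleton_iff.mp (HahnSeries.support_single_subset ha)] at hab
  rwa [← eq_neg_of_add_eq_zero_right hab]

/-- The exponents of a matching that contributes to the pairing: up to the matching, those of the
two words are opposite, except that an exchanged pair `p < q` may transfer exponents, but not
arbitrarily many from `p` to `q`. -/
lemma exists_matchingTerm_support (s : ℤˣ) (ζ : ZetaDatum K I) : ∃ c : ℤ, 0 ≤ c ∧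
    ∀ (w w' : List (I × ℤ)) (ρ : Matching w w'), matchingTerm s ζ ρ ≠ 0 →
      ∃ t : Fin w.length × Fin w.length → ℤ, (∀ p ∈ exchanged ρ.1, -c ≤ t p) ∧
        ∀ a, -(s : ℤ) * (w.get a).2 = s * (w'.get (ρ.1.symm a)).2 +
          ∑ p ∈ exchanged ρ.1, t p * ((if a = p.1 then 1 else 0) - if a = p.2 then 1 else 0) := by
  obtain ⟨c, hc0, hc⟩ := exists_ratio_support s ζ
  refine ⟨c, hc0, fun w w' ρ h => ?_⟩
  rw [matchingTerm, prod_sv_zpow, prod_sv_zpow, HahnSeries.single_mul_single, mul_one] at h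
  obtain ⟨t, ht, hδ⟩ := prod_support (exchanged ρ.1) c (fun p => smallExp p.1 p.2) _
    (fun p hp δ hδ => hc _ _ _ _ (mem_exchanged.mp hp).1 δ hδ) (coeff_single_mul_ne_zero h)
  refine ⟨t, ht, fun a => ?_⟩
  have h1 := congrArg (lexEval a) hδ
  simp only [map_neg, map_add, map_sum, map_zsmul, lexEval_single, lexEval_smallExp, smul_eq_mul,
    mul_ite, mul_zero, Fin.val_inj] at h1
  rw [Finset.sum_ite_eq, if_pos (Finset.mem_univ a)] at h1
  have h2 : ∑ x : Fin w'.length, (if a = ρ.1 x then (w'.get x).2 * (s : ℤ) else 0) =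
      (w'.get (ρ.1.symm a)).2 * s := by
    rw [Finset.sum_eq_single (ρ.1.symm a)]
    · simp
    · intro b _ hb
      rw [if_neg]
      rintro rfl
      simp at hb
    · simp
  rw [h2] at h1
  linear_combination h1

lemma exists_fraction_support (s : ℤˣ) (ζ : ZetaDatum K I) : ∃ c : ℤ, 0 ≤ c ∧
    ∀ (w : List (I × ℤ)) (R : Laurent K I) (γ : Lex (ℕ → ℤ)),
      (wordEval s w (ι R) / ∏ p : Fin w.length × Fin w.length with p.1 < p.2,
        ζ.eval (w.get p.2).1 (w.get p.1).1 (sv K s p.2 / sv K s p.1)).coeff γ ≠ 0 →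
      ∃ m ∈ R.coeff.support, ∃ t : Fin w.length × Fin w.length → ℤ,
        (∀ p : Fin w.length × Fin w.length, p.1 < p.2 → -c ≤ t p) ∧
        ∀ b, lexEval b γ = s * m.mapDomain (wordIndex w) b +
          ∑ p : Fin w.length × Fin w.length with p.1 < p.2,
            t p * ((if b = p.1 then 1 else 0) - if b = p.2 then 1 else 0) := by
  obtain ⟨c, hc0, hc⟩ := exists_inv_eval_support s ζ
  refine ⟨c, hc0, fun w R γ h => ?_⟩
  rw [div_eq_mul_inv, ← Finset.prod_inv_distrib, wordEval_algebraMap] at h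
  obtain ⟨a, ha, b, hb, rfl⟩ := Set.mem_add.mp (HahnSeries.support_mul_subset h)
  obtain ⟨m, hm, rfl⟩ := relExpand_support s _ R ha
  obtain ⟨t, ht, rfl⟩ := prod_support _ c (fun p : Fin w.length × Fin w.length =>
    smallExp p.1 p.2) _ (fun p hp δ hδ => hc _ _ _ _ (Finset.mem_filter.mp hp).2 δ hδ) hb
  refine ⟨m, hm, t, fun p hp => ht p (Finset.mem_filter.mpr ⟨Finset.mem_univ _, hp⟩),
    fun b => ?_⟩
  simp only [map_add, map_sum, map_zsmul, lexEval_smallExp, smul_eq_mul]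
  rfl

/-- The exponents of a word that pairs non-trivially with a given element. -/
lemma exists_wordPairing_support (s : ℤˣ) (ζ : ZetaDatum K I) : ∃ c : ℤ, 0 ≤ c ∧
    ∀ (w : List (I × ℤ)) (R : Laurent K I), R ∈ symLaurent K (wordDeg w) →
      wordPairing s ζ w R ≠ 0 → ∃ m ∈ R.coeff.support, ∃ t : Fin w.length × Fin w.length → ℤ,
        (∀ p : Fin w.length × Fin w.length, p.1 < p.2 → -c ≤ t p) ∧
        ∀ a, -(s : ℤ) * (w.get a).2 = s * m (letterVar w a) +
          ∑ p : Fin w.length × Fin w.length with p.1 < p.2,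
            t p * ((if a = p.1 then 1 else 0) - if a = p.2 then 1 else 0) := by
  obtain ⟨c, hc0, hc⟩ := exists_fraction_support s ζ
  refine ⟨c, hc0, fun w R hR h => ?_⟩
  rw [wordPairing_eq_wordEval s ζ w hR, prod_sv_zpow, mul_div_assoc] at h
  obtain ⟨m, hm, t, ht, hγ⟩ := hc w R _ (coeff_single_mul_ne_zero h)
  refine ⟨m, hm, t, ht, fun a => ?_⟩
  have h1 := hγ a
  rw [← wordIndex_letterVar w a, Finsupp.mapDomain_apply (wordIndex_injective w),
    wordIndex_letterVar] at h1
  simp only [map_neg, map_sum, map_zsmul, lexEval_single, smul_eq_mul, mul_ite, mul_zero,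
    Fin.val_inj] at h1
  rw [Finset.sum_ite_eq, if_pos (Finset.mem_univ a)] at h1
  linear_combination h1

/-- The word with given colors and exponents. -/
def seqWord (n : ℕ) (c : ℕ → I) (d : ℕ → ℤ) : List (I × ℤ) :=
  (List.range n).map fun a => (c a, d a)

lemma seqWord_length (n : ℕ) (c : ℕ → I) (d : ℕ → ℤ) : (seqWord n c d).length = n := by
  simp [seqWord]

lemma seqWord_getD (n : ℕ) (c : ℕ → I) (d : ℕ → ℤ) (x₀ : I × ℤ) {a : ℕ} (ha : a < n) :
    (seqWord n c d).getD a x₀ = (c a, d a) := by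
  rw [List.getD_eq_getElem _ _ (by rwa [seqWord_length])]
  simp [seqWord]

lemma wordPairing_seqWord (s : ℤˣ) (ζ : ZetaDatum K I) (n : ℕ) (c : ℕ → I) (d : ℕ → ℤ)
    (R : Laurent K I) : wordPairing s ζ (seqWord n c d) R = seqPairing s ζ n c d R := by
  rw [wordPairing_eq _ (c 0, 0), seqWord_length]
  exact seqPairing_congr s ζ R (fun a ha => by rw [seqWord_getD n c d _ ha])
    fun a ha => by rw [seqWord_getD n c d _ ha]

lemma wordDeg_seqWord (n : ℕ) (c : ℕ → I) (d : ℕ → ℤ) :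
    wordDeg (seqWord n c d) = seqDeg n c := by
  rw [wordDeg_eq _ (c 0, 0), seqWord_length]
  exact seqDeg_congr fun a ha => by rw [seqWord_getD n c d _ ha]

end WordSupports

/-! ### Separation by nearly increasing words -/

section Separation

variable {K I : Type*} [Field K] [CharZero K] [Fintype I] [DecidableEq I]

local notation "ι" => algebraMap (Laurent K I) (Rational K I)

/-- The pairings of an element with the words of fixed colors are the coefficients of one series. -/
lemma seqPairing_eq_wordEval (s : ℤˣ) (ζ : ZetaDatum K I) (w : List (I × ℤ)) (x₀ : I × ℤ)
    {R : Laurent K I} (hR : R ∈ symLaurent K (wordDeg w)) (d : ℕ → ℤ) :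
    seqPairing s ζ w.length (fun a => (w.getD a x₀).1) d R =
      ((∏ a ∈ Finset.range w.length, sv K s a ^ d a) * (wordEval s w (ι R) /
        ∏ p : Fin w.length × Fin w.length with p.1 < p.2,
          ζ.eval (w.get p.2).1 (w.get p.1).1 (sv K s p.2 / sv K s p.1))).coeff 0 := by
  have h : ∏ p ∈ placePairs w.length,
      ζ.eval (w.getD p.2 x₀).1 (w.getD p.1 x₀).1 (sv K s p.2 / sv K s p.1) =
      ∏ p : Fin w.length × Fin w.length with p.1 < p.2,
        ζ.eval (w.get p.2).1 (w.get p.1).1 (sv K s p.2 / sv K s p.1) := by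
    symm
    refine Finset.prod_bij (fun p _ => ((p.1 : ℕ), (p.2 : ℕ))) ?_ ?_ ?_ ?_
    · intro p hp
      rw [mem_placePairs]
      exact ⟨(Finset.mem_filter.mp hp).2, p.2.2⟩
    · rintro ⟨a, b⟩ _ ⟨a', b'⟩ _ h
      simp only [Prod.mk.injEq, Fin.val_inj] at h
      exact Prod.ext h.1 h.2
    · rintro ⟨a, b⟩ hp
      rw [mem_placePairs] at hp
      exact ⟨(⟨a, hp.1.trans hp.2⟩, ⟨b, hp.2⟩), by simpa using hp.1, rfl⟩
    · intro p _
      simp only [getD_fin]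
  rw [← sum_eq_wordEval s w hR, seqPairing, h, mul_div_assoc]
  simp only [evalVars, Finset.prod_range, letterVar_eq w x₀]

/-- A non-zero element pairs non-trivially with some word: for any order of the colors, its
pairings with the words are the coefficients of a non-zero series. -/
lemma exists_wordPairing_ne_zero (s : ℤˣ) (ζ : ZetaDatum K I) {n : I → ℕ} {R : Laurent K I}
    (hR : R ∈ symLaurent K n) (h0 : R ≠ 0) :
    ∃ w, wordDeg w = n ∧ wordPairing s ζ w R ≠ 0 := by
  obtain ⟨w, rfl⟩ := exists_wordDeg n
  set F := wordEval s w (ι R) / ∏ p : Fin w.length × Fin w.length with p.1 < p.2,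
    ζ.eval (w.get p.2).1 (w.get p.1).1 (sv K s p.2 / sv K s p.1) with hF
  have hF0 : F ≠ 0 := by
    refine div_ne_zero ?_ (Finset.prod_ne_zero_iff.mpr fun p hp =>
      eval_ratio_ne_zero s ζ _ _ (Finset.mem_filter.mp hp).2)
    rw [Ne, map_eq_zero, map_eq_zero_iff _ iota_injective]
    exact h0
  obtain ⟨γ, hγ⟩ : ∃ γ, F.coeff γ ≠ 0 := by
    by_contra h
    push Not at h
    exact hF0 (HahnSeries.ext (funext h))
  have hγ0 : ∀ b, w.length ≤ b → lexEval b γ = 0 := by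
    obtain ⟨c, -, hc⟩ := exists_fraction_support s ζ
    obtain ⟨m, hm, t, -, ht⟩ := hc w R γ hγ
    intro b hb
    rw [ht b, Finset.sum_eq_zero, add_zero, mul_eq_zero]
    · right
      by_contra hne
      obtain ⟨x, hx, rfl⟩ := Finset.mem_image.mp
        (Finsupp.mapDomain_support (Finsupp.mem_support_iff.mpr hne))
      have hxb : x ∈ box (wordDeg w) := by
        rw [mem_box]
        by_contra h
        exact Finsupp.mem_support_iff.mp hx (hR.1 m hm x (not_lt.mp h))
      rw [wordIndex, dif_pos hxb] at hb
      exact absurd ((letterEquiv w).symm ⟨x, hxb⟩).2 (not_lt.mpr hb)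
    · intro p _
      have h1 := p.1.2
      have h2 := p.2.2
      rw [if_neg (by omega), if_neg (by omega), sub_zero, mul_zero]
  cases w with
  | nil =>
    refine ⟨[], rfl, ?_⟩
    have : γ = 0 := ofLex.injective (funext fun b => hγ0 b (Nat.zero_le b))
    rw [wordPairing_eq_wordEval s ζ [] hR, mul_div_assoc, ← hF]
    rw [this] at hγ
    simpa using hγ
  | cons x₀ w =>
    set w₀ := x₀ :: w
    refine ⟨seqWord w₀.length (fun a => (w₀.getD a x₀).1) fun a => -(s : ℤ) * lexEval a γ,
      ?_, ?_⟩
    · rw [wordDeg_seqWord, ← wordDeg_eq]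
    · rw [wordPairing_seqWord, seqPairing_eq_wordEval s ζ w₀ x₀ hR, ← hF, prod_sv_zpow]
      have hs : (s : ℤ) * s = 1 := by
        rcases Int.units_eq_one_or s with rfl | rfl <;> rfl
      have : ∑ a ∈ Finset.range w₀.length, (-(s : ℤ) * lexEval a γ) •
          toLex (Pi.single a (s : ℤ)) = -γ := by
        refine ofLex.injective (funext fun b => ?_)
        change lexEval b _ = lexEval b _
        simp only [map_sum, map_zsmul, map_neg, lexEval_single, smul_eq_mul, mul_ite, mul_zero]
        rw [Finset.sum_ite_eq]
        split_ifs with hb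
        · linear_combination -lexEval b γ * hs
        · rw [hγ0 b (by simpa using hb), neg_zero]
      rw [this, HahnSeries.coeff_single_mul, one_mul, zero_sub, neg_neg]
      exact hγ

/-- The weight `∑ (k + a) s d_a` of a word with exponents `d`. -/
def wordWt (s : ℤˣ) : ℕ → List (I × ℤ) → ℤ
  | _, [] => 0
  | k, x :: w => k * (s * x.2) + wordWt s (k + 1) w

lemma wordWt_append (s : ℤˣ) (k : ℕ) (u v : List (I × ℤ)) :
    wordWt s k (u ++ v) = wordWt s k u + wordWt s (k + u.length) v := by
  induction u generalizing k with
  | nil => simp [wordWt]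
  | cons x u ih =>
    rw [List.cons_append, wordWt, wordWt, ih, List.length_cons, add_assoc, add_comm u.length,
      add_assoc]

lemma wordWt_mid (s : ℤˣ) (u v : List (I × ℤ)) (x y : I × ℤ) :
    wordWt s 0 (u ++ x :: y :: v) = wordWt s 0 u + u.length * (s * (x.2 + y.2)) + s * y.2 +
      wordWt s (u.length + 2) v := by
  rw [wordWt_append, wordWt, wordWt, zero_add]
  push_cast
  ring

lemma wordWt_eq_sum (s : ℤˣ) (k : ℕ) (w : List (I × ℤ)) :
    wordWt s k w = ∑ a : Fin w.length, ((k : ℤ) + (a : ℕ)) * (s * (w.get a).2) := by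
  induction w generalizing k with
  | nil => rfl
  | cons x w ih =>
    rw [wordWt, ih]
    change _ = ∑ a : Fin (w.length + 1), ((k : ℤ) + (a : ℕ)) * (s * ((x :: w).get a).2)
    rw [Fin.sum_univ_succ]
    congr 1
    refine Finset.sum_congr rfl fun a _ => ?_
    change _ = ((k : ℤ) + (a.succ : ℕ)) * (s * (w.get a).2)
    rw [Fin.val_succ]
    push_cast
    ring

/-- A word is nearly increasing if the numbers `-s d_a` do not drop by more than `c` from a letter
to the next one. -/
def NearIncr (s : ℤˣ) (c : ℤ) (w : List (I × ℤ)) : Prop :=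
  ∀ u x y v, w = u ++ x :: y :: v → -(s : ℤ) * x.2 ≤ -(s : ℤ) * y.2 + c

lemma units_mul_add_le (s : ℤˣ) {c k l : ℤ} (hk : |k| ≤ c) (hl : |l| ≤ c) :
    (s : ℤ) * (k + l) ≤ 2 * c := by
  have h1 := abs_le.mp hk
  have h2 := abs_le.mp hl
  rcases Int.units_eq_one_or s with rfl | rfl <;> simp <;> linarith

/-- If a word that is not nearly increasing pairs non-trivially with an element, then the quadratic
relations yield such a word of smaller weight. -/
lemma exists_smaller_word (s : ℤˣ) (ζ : ZetaDatum K I) : ∃ c : ℤ, 0 ≤ c ∧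
    ∀ (w : List (I × ℤ)) (R : Laurent K I), R ∈ symLaurent K (wordDeg w) →
      wordPairing s ζ w R ≠ 0 → ¬ NearIncr s c w →
      ∃ w', wordDeg w' = wordDeg w ∧ wordPairing s ζ w' R ≠ 0 ∧ wordWt s 0 w' < wordWt s 0 w := by
  obtain ⟨c, hc⟩ : ∃ c : ℤ, ∀ (i j : I), ∀ k ∈ (ζ.num i j).coeff.support, |k| ≤ c := by
    obtain ⟨c, hc⟩ := (Finset.univ.biUnion fun p : I × I =>
      (ζ.num p.1 p.2).coeff.support.image fun k => |k|).bddAbove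
    exact ⟨c, fun i j k hk => hc (Finset.mem_coe.mpr (Finset.mem_biUnion.mpr
      ⟨(i, j), Finset.mem_univ _, Finset.mem_image_of_mem _ hk⟩))⟩
  refine ⟨2 * max c 0 + 1, by positivity, fun w R hR hw hn => ?_⟩
  replace hc : ∀ (i j : I), ∀ k ∈ (ζ.num i j).coeff.support, |k| ≤ max c 0 :=
    fun i j k hk => (hc i j k hk).trans (le_max_left _ _)
  generalize max c 0 = c at *
  unfold NearIncr at hn
  push Not at hn
  obtain ⟨u, ⟨i, a⟩, ⟨j, b⟩, v, rfl, hab⟩ := hn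
  simp only at hab
  by_contra hcon
  push Not at hcon
  -- the extremal term of the relation is isolated
  obtain ⟨k₀, hk₀, hmin⟩ := Finset.exists_min_image (ζ.num j i).coeff.support
    (fun k => -(s : ℤ) * k) (by
      rw [Finsupp.support_nonempty_iff]
      intro h
      exact ζ.num_ne_zero j i (AddMonoidAlgebra.ext h))
  have hdeg : ∀ x y : ℤ, wordDeg (u ++ (i, x) :: (j, y) :: v) =
      wordDeg (u ++ (i, a) :: (j, b) :: v) := fun x y => by rw [wordDeg_mid, wordDeg_mid]
  have hdeg' : ∀ x y : ℤ, wordDeg (u ++ (j, x) :: (i, y) :: v) =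
      wordDeg (u ++ (i, a) :: (j, b) :: v) := fun x y => wordDeg_swap u v i j a b x y
  have hzero : ∀ w', wordDeg w' = wordDeg (u ++ (i, a) :: (j, b) :: v) →
      wordWt s 0 w' < wordWt s 0 (u ++ (i, a) :: (j, b) :: v) → wordPairing s ζ w' R = 0 := by
    intro w' h1 h2
    by_contra h3
    exact absurd h2 (not_lt.mpr (hcon w' h1 h3))
  have hlow : ∀ k ∈ (ζ.num j i).coeff.support, k ≠ k₀ →
      wordPairing s ζ (u ++ (i, a + k₀ - k) :: (j, b - k₀ + k) :: v) R = 0 := by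
    intro k hk hne
    refine hzero _ (hdeg _ _) ?_
    rw [wordWt_mid, wordWt_mid]
    have h1 := hmin k hk
    have h2 : (s : ℤ) * k ≠ s * k₀ := fun h => hne (mul_left_cancel₀ s.ne_zero h)
    have h3 : (s : ℤ) * k < s * k₀ := lt_of_le_of_ne (by linarith) h2
    have h4 : a + k₀ - k + (b - k₀ + k) = a + b := by ring
    simp only [h4]
    linarith
  have hlow' : ∀ e k : ℤ, 0 ≤ e → e ≤ 1 → k ∈ (ζ.num i j).coeff.support →
      wordPairing s ζ (u ++ (j, b - k₀ + e - k) :: (i, a + k₀ - e + k) :: v) R = 0 := by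
    intro e k he0 he1 hk
    refine hzero _ (hdeg' _ _) ?_
    rw [wordWt_mid, wordWt_mid]
    have h1 := units_mul_add_le s (hc i j k hk) (hc j i k₀ hk₀)
    have h4 : b - k₀ + e - k + (a + k₀ - e + k) = a + b := by ring
    have h5 : -(s : ℤ) * e ≤ 1 := by
      rcases Int.units_eq_one_or s with rfl | rfl <;> simp <;> linarith
    simp only [h4]
    linarith
  have hmain : ((ζ.num j i).coeff.sum fun k x => x • wordPairing s ζ
      (u ++ (i, a + k₀ - k) :: (j, b - k₀ + k) :: v) R) = (ζ.num j i).coeff k₀ •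
        wordPairing s ζ (u ++ (i, a) :: (j, b) :: v) R := by
    rw [Finsupp.sum, Finset.sum_eq_single k₀]
    · rw [add_sub_cancel_right, sub_add_cancel]
    · intro k hk hne
      rw [hlow k hk hne, smul_zero]
    · intro h
      exact absurd hk₀ h
  have hcontra : (ζ.num j i).coeff k₀ •
      wordPairing s ζ (u ++ (i, a) :: (j, b) :: v) R = 0 := by
    rw [← hmain]
    by_cases hij : i = j
    · subst hij
      have h := wordPairing_same s ζ u v i (a + k₀ - 1) (b - k₀) (R := R) (by rwa [hdeg])
      rw [sub_add_cancel] at h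
      rw [h, neg_eq_zero]
      refine Finset.sum_eq_zero fun k hk => ?_
      have := hlow' 1 k zero_le_one le_rfl hk
      simp only [this, smul_zero]
    · rw [wordPairing_different s ζ u v hij (a + k₀) (b - k₀) (R := R) (by rwa [hdeg])]
      refine Finset.sum_eq_zero fun k hk => ?_
      have := hlow' 0 k le_rfl zero_le_one hk
      rw [add_zero, sub_zero] at this
      simp only [this, smul_zero]
  rcases smul_eq_zero.mp hcontra with h | h
  · exact Finsupp.mem_support_iff.mp hk₀ h
  · exact hw h

lemma sum_mul_transfer {n : ℕ} (J : Finset (Fin n × Fin n)) (t : Fin n × Fin n → ℤ)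
    (f : Fin n → ℤ) :
    ∑ a, f a * ∑ p ∈ J, t p * ((if a = p.1 then 1 else 0) - if a = p.2 then 1 else 0) =
      ∑ p ∈ J, t p * (f p.1 - f p.2) := by
  simp only [Finset.mul_sum]
  rw [Finset.sum_comm]
  refine Finset.sum_congr rfl fun p _ => ?_
  simp only [mul_sub, mul_ite, mul_one, mul_zero, Finset.sum_sub_distrib, Finset.sum_ite_eq',
    Finset.mem_univ, if_true]
  ring

/-- Lower bounds for decreasing linear functions of the exponents `-s d_a` of the words that pair
non-trivially with a given element. -/
lemma exists_weighted_bound (s : ℤˣ) (ζ : ZetaDatum K I) (n : I → ℕ) {R : Laurent K I}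
    (hR : R ∈ symLaurent K n) :
    ∃ B : ℤ, 0 ≤ B ∧ ∀ w, wordDeg w = n → wordPairing s ζ w R ≠ 0 →
      ∀ (f : ℕ → ℤ) (C : ℤ), Antitone f → 0 ≤ C → (∀ a < w.length, |f a| ≤ C) →
        -(B * C) ≤ ∑ a : Fin w.length, f a * (-(s : ℤ) * (w.get a).2) := by
  obtain ⟨c, hc0, hc⟩ := exists_wordPairing_support s ζ
  set N := ∑ i, n i with hN
  set M := ∑ m ∈ R.coeff.support, ∑ x ∈ box n, |m x| with hM
  have hM0 : 0 ≤ M := Finset.sum_nonneg fun m _ => Finset.sum_nonneg fun x _ => abs_nonneg _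
  refine ⟨M + 2 * c * (N * N), by positivity, fun w hw hwR f C hf hC hfC => ?_⟩
  have hlen : w.length = N := by rw [← sum_wordDeg, hw]
  obtain ⟨m, hm, t, ht, hg⟩ := hc w R (by rwa [hw]) hwR
  simp only [hg, mul_add, Finset.sum_add_distrib, sum_mul_transfer _ t fun a => f a]
  have h1 : -(M * C) ≤ ∑ a : Fin w.length, f a * (s * m (letterVar w a)) := by
    have h2 : ∑ a : Fin w.length, |m (letterVar w a)| ≤ M := by
      rw [← sum_box w fun x => |m x|, hw]
      exact Finset.single_le_sum (f := fun m => ∑ x ∈ box n, |m x|)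
        (fun m _ => Finset.sum_nonneg fun x _ => abs_nonneg _) hm
    have h3 : ∀ a : Fin w.length, -(C * |m (letterVar w a)|) ≤
        f a * (s * m (letterVar w a)) := by
      intro a
      refine (neg_le_neg ?_).trans (neg_abs_le _)
      rw [abs_mul, abs_mul]
      have : |(s : ℤ)| = 1 := by
        rcases Int.units_eq_one_or s with rfl | rfl <;> rfl
      rw [this, one_mul]
      exact mul_le_mul_of_nonneg_right (hfC a a.2) (abs_nonneg _)
    refine le_trans ?_ (Finset.sum_le_sum fun a _ => h3 a)
    rw [Finset.sum_neg_distrib, ← Finset.mul_sum, mul_comm M]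
    exact neg_le_neg (mul_le_mul_of_nonneg_left h2 hC)
  have h4 : -(2 * c * (N * N) * C) ≤
      ∑ p : Fin w.length × Fin w.length with p.1 < p.2, t p * (f p.1 - f p.2) := by
    have h5 : ∀ p ∈ (Finset.univ : Finset (Fin w.length × Fin w.length)).filter
        (fun p => p.1 < p.2), -(2 * c * C) ≤ t p * (f p.1 - f p.2) := by
      intro p hp
      have hlt := (Finset.mem_filter.mp hp).2
      have h6 : 0 ≤ f p.1 - f p.2 := sub_nonneg.mpr (hf (Fin.lt_def.mp hlt).le)
      have h7 : f p.1 - f p.2 ≤ 2 * C := by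
        have := abs_le.mp (hfC p.1 p.1.2)
        have := abs_le.mp (hfC p.2 p.2.2)
        linarith
      have h8 := mul_le_mul_of_nonneg_right (ht p hlt) h6
      have h9 := mul_le_mul_of_nonneg_left h7 hc0
      linarith
    have h6 := Finset.card_nsmul_le_sum _ _ _ h5
    refine le_trans ?_ h6
    have h7 : (((Finset.univ : Finset (Fin w.length × Fin w.length)).filter
        (fun p => p.1 < p.2)).card : ℤ) ≤ N * N := by
      have := Finset.card_filter_le (Finset.univ : Finset (Fin w.length × Fin w.length))
        (fun p => p.1 < p.2)
      rw [Finset.card_univ, Fintype.card_prod, Fintype.card_fin] at this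
      rw [← hlen]
      exact_mod_cast this
    rw [nsmul_eq_mul]
    have h8 : 0 ≤ 2 * c * C := by positivity
    have := mul_le_mul_of_nonneg_right h7 h8
    linarith
  linarith

/-- The words that pair non-trivially with a given element have weights bounded below. -/
lemma wordWt_bddBelow (s : ℤˣ) (ζ : ZetaDatum K I) (n : I → ℕ) {R : Laurent K I}
    (hR : R ∈ symLaurent K n) :
    ∃ B : ℤ, ∀ w, wordDeg w = n → wordPairing s ζ w R ≠ 0 → B ≤ wordWt s 0 w := by
  obtain ⟨B, -, hB⟩ := exists_weighted_bound s ζ n hR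
  refine ⟨-(B * (∑ i, n i : ℕ)), fun w hw hwR => ?_⟩
  refine (hB w hw hwR (fun a => -(a : ℤ)) (∑ i, n i : ℕ)
    (fun a b h => neg_le_neg (by exact_mod_cast h)) (by positivity) fun a ha => ?_).trans_eq ?_
  · rw [abs_neg, Nat.abs_cast, ← hw, sum_wordDeg]
    exact_mod_cast ha.le
  · rw [wordWt_eq_sum]
    refine Finset.sum_congr rfl fun a _ => ?_
    push_cast
    ring

/-- A non-zero element pairs non-trivially with some nearly increasing word. -/
theorem exists_nearIncr (s : ℤˣ) (ζ : ZetaDatum K I) : ∃ c : ℤ, 0 ≤ c ∧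
    ∀ (n : I → ℕ) (R : Laurent K I), R ∈ symLaurent K n → R ≠ 0 →
      ∃ w, wordDeg w = n ∧ NearIncr s c w ∧ wordPairing s ζ w R ≠ 0 := by
  obtain ⟨c, hc0, hc⟩ := exists_smaller_word s ζ
  refine ⟨c, hc0, fun n R hR h0 => ?_⟩
  obtain ⟨B, hB⟩ := wordWt_bddBelow s ζ n hR
  obtain ⟨w, hw, hwR⟩ := exists_wordPairing_ne_zero s ζ hR h0
  obtain ⟨k, ⟨w, hw, hwR, rfl⟩, hmin⟩ := Int.exists_least_of_bdd
    (P := fun k => ∃ w, wordDeg w = n ∧ wordPairing s ζ w R ≠ 0 ∧ wordWt s 0 w = k)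
    ⟨B, by rintro k ⟨w, h1, h2, rfl⟩; exact hB w h1 h2⟩ ⟨_, w, hw, hwR, rfl⟩
  refine ⟨w, hw, ?_, hwR⟩
  by_contra hn
  obtain ⟨w', h1, h2, h3⟩ := hc w R (by rwa [hw]) hwR hn
  exact absurd h3 (not_lt.mpr (hmin _ ⟨w', h1.trans hw, h2, rfl⟩))

end Separation

/-! ### Finite regions of words -/

section Regions

/-- The sum of the first `m` entries. -/
def prefixSum {n : ℕ} (g : Fin n → ℤ) (m : ℕ) : ℤ :=
  ∑ a : Fin n, if (a : ℕ) < m then g a else 0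

lemma prefixSum_succ {n : ℕ} (g : Fin n → ℤ) (a : Fin n) :
    prefixSum g (a + 1) = prefixSum g a + g a := by
  have h : g a = ∑ b : Fin n, if b = a then g b else 0 := by
    rw [Finset.sum_ite_eq', if_pos (Finset.mem_univ a)]
  rw [prefixSum, prefixSum, h, ← Finset.sum_add_distrib]
  refine Finset.sum_congr rfl fun b _ => ?_
  have hba : b = a ↔ (b : ℕ) = a := Fin.ext_iff
  by_cases h1 : (b : ℕ) < a
  · rw [if_pos (by omega), if_pos h1, if_neg (by omega), add_zero]
  · by_cases h2 : (b : ℕ) = a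
    · rw [if_pos (by omega), if_neg h1, if_pos (by omega), zero_add]
    · rw [if_neg (by omega), if_neg h1, if_neg (by omega), zero_add]

/-- The sequences whose prefix sums are bounded below by a convex function (strictly convex if `0 < L`)
that is `-N` at the ends, and whose total sum is at most `N`. -/
def InRegion (N L : ℤ) {n : ℕ} (g : Fin n → ℤ) : Prop :=
  (∀ m ≤ n, -N - L * (m * (n - m)) ≤ prefixSum g m) ∧ prefixSum g n ≤ N

/-- The sum of a nearly increasing sequence over a set of indices that is not a prefix is, up to a
constant, at least the mean of the sums over the next shorter and the next longer prefix. -/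
lemma two_mul_sum_ge {n : ℕ} (h : Fin n → ℤ) {c : ℤ} (hc : 0 ≤ c)
    (hh : ∀ a b : Fin n, a < b → h a ≤ h b + c) {m : ℕ} (A : Finset (Fin n))
    (hcard : A.card = (Finset.univ.filter fun a : Fin n => (a : ℕ) < m).card)
    (hA : A ≠ Finset.univ.filter fun a : Fin n => (a : ℕ) < m) :
    0 < m ∧ m < n ∧ prefixSum h (m - 1) + prefixSum h (m + 1) - 6 * n * c ≤
      2 * ∑ a ∈ A, h a := by
  set P := Finset.univ.filter fun a : Fin n => (a : ℕ) < m with hP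
  have hmem : ∀ a, a ∈ P ↔ (a : ℕ) < m := fun a => by simp [hP]
  have hr : (A \ P).card = (P \ A).card := Finset.card_sdiff_comm hcard
  obtain ⟨x, hx⟩ : (A \ P).Nonempty := by
    rw [Finset.sdiff_nonempty]
    intro hsub
    exact hA (Finset.eq_of_subset_of_card_le hsub hcard.ge)
  obtain ⟨y, hy⟩ : (P \ A).Nonempty := by
    rw [← Finset.card_pos, ← hr, Finset.card_pos]
    exact ⟨x, hx⟩
  have hxm : m ≤ x := by
    have := (Finset.mem_sdiff.mp hx).2
    rw [hmem] at this
    omega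
  have hym : (y : ℕ) < m := (hmem y).mp (Finset.mem_sdiff.mp hy).1
  have hmn : m < n := lt_of_le_of_lt hxm x.2
  have hm0 : 0 < m := by omega
  refine ⟨hm0, hmn, ?_⟩
  have hpre : prefixSum h m = ∑ a ∈ P, h a := by
    rw [prefixSum, hP, Finset.sum_filter]
  have e1 := prefixSum_succ h ⟨m, hmn⟩
  have e2 := prefixSum_succ h ⟨m - 1, by omega⟩
  simp only [Nat.sub_add_cancel hm0] at e1 e2
  set u := h ⟨m, hmn⟩
  set v := h ⟨m - 1, by omega⟩
  have huv : v ≤ u + c := hh _ _ (by rw [Fin.lt_def]; simp only; omega)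
  have hlow : ∀ a ∈ A \ P, u - c ≤ h a := by
    intro a ha
    have h1 := (Finset.mem_sdiff.mp ha).2
    rw [hmem, not_lt] at h1
    rcases h1.eq_or_lt with h2 | h2
    · have : (⟨m, hmn⟩ : Fin n) = a := Fin.ext h2
      simp only [u, this]
      linarith
    · have := hh ⟨m, hmn⟩ a h2
      linarith
  have hup : ∀ a ∈ P \ A, h a ≤ v + c := by
    intro a ha
    have h1 := (hmem a).mp (Finset.mem_sdiff.mp ha).1
    rcases (Nat.le_sub_one_of_lt h1).eq_or_lt with h2 | h2
    · have : a = (⟨m - 1, by omega⟩ : Fin n) := Fin.ext h2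
      simp only [v, this]
      linarith
    · exact hh a _ h2
  have s1 := Finset.card_nsmul_le_sum _ _ _ hlow
  have s2 := Finset.sum_le_card_nsmul _ _ _ hup
  have s3 := Finset.sum_sdiff_sub_sum_sdiff (f := h) (s₁ := A) (s₂ := P)
  rw [hr] at s1
  have hr1 : 1 ≤ ((P \ A).card : ℤ) := by
    exact_mod_cast Finset.card_pos.mpr ⟨y, hy⟩
  have hrn : ((P \ A).card : ℤ) ≤ n := by
    have := Finset.card_le_univ (P \ A)
    rw [Fintype.card_fin] at this
    exact_mod_cast this
  rw [nsmul_eq_mul] at s1 s2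
  rw [e1, hpre]
  rw [hpre] at e2
  generalize ((P \ A).card : ℤ) = r at *
  -- replacing `r ≥ 1` entries of the prefix, each at most `v + c`, by entries that are each at least
  -- `u - c` changes the sum by at least `r (u - v - 2 c)`
  have h1 : 0 ≤ (2 * r - 1) * (u - v + c) := mul_nonneg (by linarith) (by linarith)
  have h2 : r * c ≤ n * c := mul_le_mul_of_nonneg_right hrn hc
  nlinarith

/-- The relation between the exponents of two words that pair non-trivially preserves regions: if
the first `m` places are not matched with each other, then the `m`-th prefix sum is bounded by a
mean of the neighboring ones, and the bounds have second difference `2 L` in `m`, which exceeds the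
error terms. -/
lemma InRegion.of_matching {n n' : ℕ} (ρ : Fin n' ≃ Fin n) (g : Fin n → ℤ) (h : Fin n' → ℤ)
    {c c' : ℤ} (hc : 0 ≤ c) (hc' : 0 ≤ c') (hh : ∀ a b, a < b → h a ≤ h b + c)
    (t : Fin n × Fin n → ℤ) (ht : ∀ p ∈ exchanged ρ, -c' ≤ t p)
    (hg : ∀ a, g a = h (ρ.symm a) +
      ∑ p ∈ exchanged ρ, t p * ((if a = p.1 then 1 else 0) - if a = p.2 then 1 else 0))
    {N L : ℤ} (hL : 3 * n * c + c' * (n * n) ≤ L) (hreg : InRegion N L h) : InRegion N L g := by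
  obtain rfl : n' = n := by simpa using Fintype.card_congr ρ
  have hG : ∀ m, prefixSum g m =
      ∑ b ∈ (Finset.univ.filter fun a : Fin n' => (a : ℕ) < m).map ρ.symm.toEmbedding, h b +
      ∑ p ∈ exchanged ρ, t p * ((if (p.1 : ℕ) < m then 1 else 0) -
        if (p.2 : ℕ) < m then 1 else 0) := by
    intro m
    rw [← sum_mul_transfer _ t fun a : Fin n' => if (a : ℕ) < m then 1 else 0, Finset.sum_map,
      Finset.sum_filter, prefixSum, ← Finset.sum_add_distrib]
    refine Finset.sum_congr rfl fun a _ => ?_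
    rw [hg a]
    split_ifs
    · rw [one_mul]; rfl
    · rw [zero_mul, add_zero]
  have hsame : ∀ m, (Finset.univ.filter fun a : Fin n' => (a : ℕ) < m).map ρ.symm.toEmbedding =
      (Finset.univ.filter fun a : Fin n' => (a : ℕ) < m) → prefixSum g m = prefixSum h m := by
    intro m hA
    have hmem : ∀ a : Fin n', (ρ a : ℕ) < m ↔ (a : ℕ) < m := by
      intro a
      have := congrArg (a ∈ ·) hA
      simpa using this
    refine (hG m).trans ?_
    rw [hA, prefixSum, Finset.sum_filter]
    refine add_eq_left.mpr (Finset.sum_eq_zero fun p hp => ?_)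
    obtain ⟨h1, h2⟩ := mem_exchanged.mp hp
    have h3 := hmem (ρ.symm p.1)
    have h4 := hmem (ρ.symm p.2)
    rw [Equiv.apply_symm_apply] at h3 h4
    rw [Fin.lt_def] at h1 h2
    by_cases h5 : (p.1 : ℕ) < m
    · rw [if_pos h5, if_pos (h4.mpr (h2.trans (h3.mp h5))), sub_self, mul_zero]
    · rw [if_neg h5, if_neg (by omega), sub_self, mul_zero]
  have hfull : prefixSum g n' = prefixSum h n' := by
    refine hsame n' ?_
    simp
  refine ⟨fun m hm => ?_, hfull ▸ hreg.2⟩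
  by_cases hA : (Finset.univ.filter fun a : Fin n' => (a : ℕ) < m).map ρ.symm.toEmbedding =
      (Finset.univ.filter fun a : Fin n' => (a : ℕ) < m)
  · rw [hsame m hA]
    exact hreg.1 m hm
  · obtain ⟨hm0, hmn, key⟩ := two_mul_sum_ge h hc hh _ (Finset.card_map _) hA
    have h1 := hreg.1 (m - 1) (by omega)
    have h2 := hreg.1 (m + 1) (by omega)
    have h3 : -(c' * (n' * n')) ≤ ∑ p ∈ exchanged ρ, t p * ((if (p.1 : ℕ) < m then 1 else 0) -
        if (p.2 : ℕ) < m then 1 else 0) := by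
      have h4 : ∀ p ∈ exchanged ρ, -c' ≤ t p * ((if (p.1 : ℕ) < m then 1 else 0) -
          if (p.2 : ℕ) < m then 1 else 0) := by
        intro p hp
        have h5 := (mem_exchanged.mp hp).1
        rw [Fin.lt_def] at h5
        have h6 := ht p hp
        split_ifs
        · simpa using hc'
        · simpa using h6
        · omega
        · simpa using hc'
      refine le_trans ?_ (Finset.card_nsmul_le_sum _ _ _ h4)
      have h7 : ((exchanged ρ).card : ℤ) ≤ n' * n' := by
        have := Finset.card_le_univ (exchanged ρ)
        rw [Fintype.card_prod, Fintype.card_fin] at this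
        exact_mod_cast this
      rw [nsmul_eq_mul]
      have := mul_le_mul_of_nonneg_right h7 hc'
      linarith
    rw [hG m]
    have e1 : ((m - 1 : ℕ) : ℤ) = m - 1 := by omega
    rw [e1] at h1
    push_cast at h2
    nlinarith

/-- The prefix sums bound the last entry of a sequence in a region from above, hence all entries if
the sequence is nearly increasing; this bounds the entries from below, too. -/
lemma InRegion.abs_le {n : ℕ} {g : Fin n → ℤ} {c N L : ℤ} (hc : 0 ≤ c) (hN : 0 ≤ N)
    (hL : 0 ≤ L) (hh : ∀ a b, a < b → g a ≤ g b + c) (hreg : InRegion N L g) (a : Fin n) :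
    |g a| ≤ N + L * (n * n) + n * (2 * N + L * n + c) + (2 * N + L * n + c) := by
  have hn : 0 < n := a.pos
  set U := 2 * N + L * n + c with hU
  have hU0 : 0 ≤ U := by positivity
  have hup : ∀ b, g b ≤ U := by
    have e := prefixSum_succ g ⟨n - 1, by omega⟩
    simp only [Nat.sub_add_cancel hn] at e
    have h1 := hreg.1 (n - 1) (by omega)
    have e1 : ((n - 1 : ℕ) : ℤ) = n - 1 := by omega
    rw [e1] at h1
    have hlast : g ⟨n - 1, by omega⟩ ≤ 2 * N + L * n := by
      have := hreg.2
      nlinarith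
    intro b
    rcases (Nat.le_sub_one_of_lt b.2).eq_or_lt with h2 | h2
    · have : b = (⟨n - 1, by omega⟩ : Fin n) := Fin.ext h2
      rw [this]
      linarith
    · have := hh b ⟨n - 1, by omega⟩ h2
      linarith
  have hsum : prefixSum g a ≤ n * U := by
    have h1 : ∀ b ∈ (Finset.univ : Finset (Fin n)), (if (b : ℕ) < a then g b else 0) ≤ U := by
      intro b _
      split_ifs
      · exact hup b
      · exact hU0
    have h2 := Finset.sum_le_card_nsmul _ _ _ h1
    rw [Finset.card_fin, nsmul_eq_mul] at h2
    exact h2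
  have hlow := hreg.1 (a + 1) (by omega)
  rw [prefixSum_succ] at hlow
  have h3 : ((a + 1 : ℕ) : ℤ) * (n - (a + 1 : ℕ)) ≤ n * n := by
    have h4 : ((a + 1 : ℕ) : ℤ) ≤ n := by exact_mod_cast a.2
    have h5 : (0 : ℤ) ≤ ((a + 1 : ℕ) : ℤ) := by positivity
    nlinarith
  have h6 := mul_le_mul_of_nonneg_left h3 hL
  have h7 : 0 ≤ N + L * (n * n) + n * U := by positivity
  rw [_root_.abs_le]
  constructor
  · linarith
  · linarith [hup a]

variable {I : Type*}

/-- The numbers `-s d_a` of the letters of a word. -/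
def letterExp (s : ℤˣ) (w : List (I × ℤ)) (a : Fin w.length) : ℤ := -(s : ℤ) * (w.get a).2

lemma NearIncr.letterExp_le {s : ℤˣ} {c : ℤ} (hc : 0 ≤ c) {w : List (I × ℤ)}
    (h : NearIncr s c w) (a b : Fin w.length) (hab : a < b) :
    letterExp s w a ≤ letterExp s w b + w.length * c := by
  have key : ∀ (k i : ℕ) (hk : i + k < w.length),
      letterExp s w ⟨i, by omega⟩ ≤ letterExp s w ⟨i + k, hk⟩ + k * c := by
    intro k
    induction k with
    | zero => intro i hk; simp
    | succ k ih =>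
      intro i hk
      refine (ih i (by omega)).trans ?_
      have h1 := h (w.take (i + k)) (w[i + k]) (w[i + (k + 1)]) (w.drop (i + (k + 1) + 1)) (by
        rw [List.getElem_cons_drop]
        change w = w.take (i + k) ++ (w[i + k]'(by omega) :: w.drop (i + k + 1))
        rw [List.getElem_cons_drop, List.take_append_drop])
      change -(s : ℤ) * (w[i + k]).2 + k * c ≤ -(s : ℤ) * (w[i + (k + 1)]).2 + _
      push_cast
      linarith
  have h1 := key (b - a) a (by omega)
  have h2 : (⟨a + (b - a), by omega⟩ : Fin w.length) = b := Fin.ext (by simp only; omega)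
  rw [h2] at h1
  refine h1.trans ?_
  have h3 : ((b - a : ℕ) : ℤ) ≤ w.length := by omega
  have := mul_le_mul_of_nonneg_right h3 hc
  linarith

lemma finite_words [Finite I] (s : ℤˣ) (l : ℕ) (B : ℤ) :
    {w : List (I × ℤ) | w.length = l ∧ ∀ a, |letterExp s w a| ≤ B}.Finite := by
  refine (Set.finite_range fun f : Fin l → I × Set.Icc (-B) B =>
    List.ofFn fun a => ((f a).1, ((f a).2 : ℤ))).subset ?_
  rintro w ⟨rfl, hw⟩
  have h : ∀ a : Fin w.length, (w.get a).2 ∈ Set.Icc (-B) B := by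
    intro a
    have h1 := hw a
    rw [letterExp, abs_mul, abs_neg] at h1
    have : |(s : ℤ)| = 1 := by
      rcases Int.units_eq_one_or s with rfl | rfl <;> rfl
    rw [this, one_mul] at h1
    exact _root_.abs_le.mp h1
  exact ⟨fun a => ((w.get a).1, ⟨(w.get a).2, h a⟩), List.ofFn_get w⟩

/-- The nearly increasing words of degree `n` in a region. -/
def regionWords [DecidableEq I] (s : ℤˣ) (c : ℤ) (n : I → ℕ) (N L : ℤ) : Set (List (I × ℤ)) :=
  {w | wordDeg w = n ∧ NearIncr s c w ∧ InRegion N L (letterExp s w)}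

variable [DecidableEq I] [Fintype I]

lemma finite_regionWords (s : ℤˣ) {c : ℤ} (hc : 0 ≤ c) (n : I → ℕ) {N L : ℤ} (hN : 0 ≤ N)
    (hL : 0 ≤ L) : (regionWords s c n N L).Finite := by
  set l := ∑ i, n i
  refine (finite_words s l (N + L * (l * l) + l * (2 * N + L * l + l * c) +
    (2 * N + L * l + l * c))).subset ?_
  rintro w ⟨hw, hi, hr⟩
  have hlen : w.length = l := by rw [← sum_wordDeg, hw]
  refine ⟨hlen, fun a => ?_⟩
  have := hr.abs_le (by positivity) hN hL (hi.letterExp_le hc) a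
  rwa [hlen] at this

variable {K : Type*} [Field K] [CharZero K]

/-- Nearly increasing words that pair non-trivially lie in the same regions. -/
lemma exists_region_closed (s : ℤˣ) (ζ : ZetaDatum K I) {c : ℤ} (hc : 0 ≤ c) (n : I → ℕ) :
    ∃ L₀ : ℤ, 0 ≤ L₀ ∧ ∀ (w w' : List (I × ℤ)) (ρ : Matching w w') (N L : ℤ), L₀ ≤ L →
      matchingTerm s ζ ρ ≠ 0 → NearIncr s c w → w' ∈ regionWords (-s) c n N L →
      w ∈ regionWords s c n N L := by
  obtain ⟨c', hc0, hc'⟩ := exists_matchingTerm_support s ζ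
  set l := ∑ i, n i
  refine ⟨3 * l * (l * c) + c' * (l * l), by positivity,
    fun w w' ρ N L hL hρ hw ⟨hdeg, hi, hr⟩ => ?_⟩
  obtain ⟨t, ht, hg⟩ := hc' w w' ρ hρ
  have hlen' : w'.length = l := by rw [← sum_wordDeg, hdeg]
  have hlen : w.length = l := by rw [← sum_wordDeg, ← ρ.wordDeg_eq, hdeg]
  refine ⟨ρ.wordDeg_eq.symm.trans hdeg, hw, ?_⟩
  refine InRegion.of_matching ρ.1 _ _ (c := w'.length * c) (by positivity) hc0
    (hi.letterExp_le hc) t ht (fun a => ?_) (by rwa [hlen, hlen']) hr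
  rw [letterExp, hg a, letterExp]
  simp

end Regions

/-! ### The annihilator of the kernel -/

section Duality

variable {K I : Type*} [Field K] [CharZero K] [Fintype I] [DecidableEq I]

lemma NearIncr.mono {s : ℤˣ} {c c' : ℤ} (h : c ≤ c') {w : List (I × ℤ)} (hw : NearIncr s c w) :
    NearIncr s c' w := by
  intro u x y v huv
  have := hw u x y v huv
  linarith

lemma pairing_wordElt (s : ℤˣ) (ζ ζ' : ZetaDatum K I) (w : List (I × ℤ)) (R : BigShuffle ζ') :
    pairing s ζ ζ' (wordElt ζ w) R = wordPairing s ζ w (R (wordDeg w)).val :=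
  pairing_word s ζ ζ' w R

/-- A nearly increasing word that pairs non-trivially with a given element lies in a region. -/
lemma exists_inRegion (s : ℤˣ) (ζ : ZetaDatum K I) (n : I → ℕ) {R : Laurent K I}
    (hR : R ∈ symLaurent K n) :
    ∃ N : ℤ, 0 ≤ N ∧ ∀ (L c : ℤ) (w : List (I × ℤ)), 0 ≤ L → wordDeg w = n → NearIncr s c w →
      wordPairing s ζ w R ≠ 0 → w ∈ regionWords s c n N L := by
  obtain ⟨N, hN, hB⟩ := exists_weighted_bound s ζ n hR
  refine ⟨N, hN, fun L c w hL hw hi hwR => ⟨hw, hi, fun m hm => ?_, ?_⟩⟩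
  · have h := hB w hw hwR (fun a => if a < m then 1 else 0) 1 (fun a b hab => ?_) zero_le_one
      (fun a _ => by split_ifs <;> simp)
    · have h1 : 0 ≤ L * (m * (w.length - m)) := by
        have : (m : ℤ) ≤ w.length := by exact_mod_cast hm
        exact mul_nonneg hL (mul_nonneg (Nat.cast_nonneg m) (by linarith))
      rw [mul_one] at h
      refine le_trans (by linarith) (h.trans_eq ?_)
      refine Finset.sum_congr rfl fun a _ => ?_
      simp only [letterExp, ite_mul, one_mul, zero_mul]
    · beta_reduce
      split_ifs
      · exact le_rfl
      · omega
      · exact zero_le_one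
      · exact le_rfl
  · have h := hB w hw hwR (fun _ => -1) 1 (fun _ _ _ => le_rfl) zero_le_one (by simp)
    simp only [neg_one_mul, Finset.sum_neg_distrib, mul_one] at h
    refine le_of_eq_of_le (Finset.sum_congr rfl fun a _ => if_pos a.2) (neg_le_neg_iff.mp h)

/-- The span of the words of degree `n`. -/
def degreePart (ζ : ZetaDatum K I) (n : I → ℕ) : Submodule K (QuadAlg ζ) :=
  Submodule.span K (wordElt ζ '' {w | wordDeg w = n})

lemma upsilon_degreePart {ζ : ZetaDatum K I} {n : I → ℕ} {x : QuadAlg ζ}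
    (hx : x ∈ degreePart ζ n) :
    upsilon ζ x = DirectSum.of (Component ζ) n (upsilon ζ x n) := by
  induction hx using Submodule.span_induction with
  | mem x hx =>
    obtain ⟨w, hw, rfl⟩ := hx
    obtain ⟨e, he, -⟩ := exists_upsilon_word ζ w hw
    change upsilon ζ (wordElt ζ w) = _ at he
    rw [he, DirectSum.of_eq_same]
  | zero => simp
  | add x y _ _ hx hy =>
    rw [map_add, DirectSum.add_apply, map_add, ← hx, ← hy]
  | smul r x _ hx =>
    rw [map_smul, DirectSum.smul_apply]
    change _ = DirectSum.lof K (I → ℕ) (Component ζ) n _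
    rw [map_smul]
    exact congrArg (r • ·) hx

/-- An element that pairs trivially with everything vanishes. -/
lemma eq_zero_of_pairing (s : ℤˣ) (ζ : ZetaDatum K I) {ζ' : ZetaDatum K I} {R : BigShuffle ζ'}
    (h : ∀ x, pairing s ζ ζ' x R = 0) : R = 0 := by
  refine DFinsupp.ext fun n => ?_
  by_contra hne
  obtain ⟨w, rfl, hwR⟩ := exists_wordPairing_ne_zero s ζ (R n).mem
    (fun h0 => hne (Subtype.ext h0))
  exact hwR ((pairing_wordElt s ζ ζ' w R).symm.trans (h _))

lemma pairing_words_eq_zero (s : ℤˣ) {ζ ζ' : ZetaDatum K I} (hd : IsDual ζ ζ')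
    {w w' : List (I × ℤ)} (h : ∀ ρ : Matching w w', matchingTerm s ζ ρ = 0) :
    pairing s ζ ζ' (wordElt ζ w) (upsilon ζ' (wordElt ζ' w')) = 0 :=
  (pairing_upsilon_word s hd w w').trans (Finset.sum_eq_zero fun ρ _ => h ρ)

/-- A component of an element that pairs trivially with the kernel of `upsilon` lies in the image
of `upsilon`. Only finitely many nearly increasing words pair non-trivially with the component, and
they lie in a finite set of words that the pairing matrix separates from the other words. Thus the
claim is one on the range of a matrix with finitely many rows. -/
lemma exists_upsilon_component (s : ℤˣ) {ζ ζ' : ZetaDatum K I} (hd : IsDual ζ ζ')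
    (R : BigShuffle ζ') (hR : ∀ x, upsilon ζ x = 0 → pairing s ζ ζ' x R = 0) (n : I → ℕ) :
    ∃ y, upsilon ζ' y = DirectSum.of (Component ζ') n (R n) := by
  obtain ⟨c₁, h1, hc₁⟩ := exists_nearIncr s ζ
  obtain ⟨c₂, h2, hc₂⟩ := exists_nearIncr (-s) ζ'
  set c := max c₁ c₂
  have hc : 0 ≤ c := h1.trans (le_max_left _ _)
  obtain ⟨L₁, hL₁, hcl₁⟩ := exists_region_closed s ζ hc n
  obtain ⟨L₂, hL₂, hcl₂⟩ := exists_region_closed (-s) ζ' hc n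
  set L := max L₁ L₂
  have hL : 0 ≤ L := hL₁.trans (le_max_left _ _)
  obtain ⟨N, hN, hreg⟩ := exists_inRegion s ζ n (R n).mem
  set T := regionWords s c n N L
  set T' := regionWords (-s) c n N L
  have hclosed : ∀ w ∈ T, ∀ w', NearIncr (-s) c w' → w' ∉ T' →
      pairing s ζ ζ' (wordElt ζ w) (upsilon ζ' (wordElt ζ' w')) = 0 := by
    intro w hw w' hi hw'
    refine pairing_words_eq_zero s hd fun ρ => ?_
    by_contra hρ
    rw [matchingTerm_symm s hd] at hρ
    exact hw' (hcl₂ w' w ρ.symm N L (le_max_right _ _) hρ hi (by rwa [neg_neg]))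
  have hclosed' : ∀ w' ∈ T', ∀ w, NearIncr s c w → w ∉ T →
      pairing s ζ ζ' (wordElt ζ w) (upsilon ζ' (wordElt ζ' w')) = 0 := by
    intro w' hw' w hi hw
    refine pairing_words_eq_zero s hd fun ρ => ?_
    by_contra hρ
    exact hw (hcl₁ w w' ρ N L (le_max_left _ _) hρ hi hw')
  have : Finite T := finite_regionWords s hc n hN hL
  have := Fintype.ofFinite T
  let ev : BigShuffle ζ' →ₗ[K] T → K := LinearMap.pi fun w => pairing s ζ ζ' (wordElt ζ w)
  set W := (Submodule.span K (wordElt ζ' '' T')).map (ev ∘ₗ (upsilon ζ').toLinearMap)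
  -- a functional that vanishes on the columns of the finite block is a combination of words in the
  -- kernel of `upsilon`, so it vanishes on the pairings of `R`
  have hmem : ev R ∈ W := by
    by_contra hnot
    obtain ⟨g, hg, hgW⟩ := Submodule.exists_le_ker_of_notMem hnot
    set X := ∑ w : T, g (Pi.single w 1) • wordElt ζ w with hX
    have hgX : ∀ Q, pairing s ζ ζ' X Q = g (ev Q) := by
      intro Q
      rw [hX, map_sum, LinearMap.sum_apply, LinearMap.pi_apply_eq_sum_univ g (ev Q)]
      refine Finset.sum_congr rfl fun w _ => ?_
      have hw : (Pi.single w 1 : T → K) = fun j => if w = j then 1 else 0 :=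
        funext fun j => by rw [Pi.single_apply]; exact if_congr eq_comm rfl rfl
      rw [map_smul, LinearMap.smul_apply, smul_eq_mul, smul_eq_mul, mul_comm, hw]
      rfl
    have hXn : X ∈ degreePart ζ n := by
      refine Submodule.sum_mem _ fun w _ => Submodule.smul_mem _ _ (Submodule.subset_span ?_)
      exact ⟨w, w.2.1, rfl⟩
    refine hg ?_
    rw [← hgX]
    refine hR X ?_
    rw [upsilon_degreePart hXn]
    suffices h : upsilon ζ X n = 0 by rw [h, map_zero]
    by_contra hne
    obtain ⟨w', hw', hi, hne'⟩ := hc₂ n _ (upsilon ζ X n).mem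
      fun h0 => hne (Subtype.ext h0)
    replace hi := hi.mono (le_max_right c₁ c₂)
    refine hne' ?_
    have h3 := pairing_wordElt (-s) ζ' ζ w' (upsilon ζ X)
    rw [hw'] at h3
    rw [← h3, ← pairing_symm s hd]
    by_cases hin : w' ∈ T'
    · rw [hgX]
      exact hgW ⟨_, Submodule.subset_span ⟨w', hin, rfl⟩, rfl⟩
    · rw [hX, map_sum, LinearMap.sum_apply]
      refine Finset.sum_eq_zero fun w _ => ?_
      rw [map_smul, LinearMap.smul_apply, hclosed w w.2 w' hi hin, smul_zero]
  -- now `upsilon ζ' y` and `R` have the same pairings with all nearly increasing words of degree `n`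
  obtain ⟨y, hy, hyR⟩ := hmem
  have hyn : y ∈ degreePart ζ' n :=
    Submodule.span_mono (Set.image_mono fun w hw => hw.1) hy
  refine ⟨y, ?_⟩
  rw [upsilon_degreePart hyn]
  congr 1
  by_contra hne
  obtain ⟨w, hw, hi, hne'⟩ := hc₁ n _ (upsilon ζ' y n - R n).mem
    fun h0 => hne (sub_eq_zero.mp (Subtype.ext h0))
  replace hi := hi.mono (le_max_left c₁ c₂)
  have h3 := pairing_wordElt s ζ ζ' w (upsilon ζ' y - R)
  rw [hw, DirectSum.sub_apply] at h3
  rw [← h3, map_sub] at hne'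
  by_cases hin : w ∈ T
  · exact hne' (sub_eq_zero.mpr (congrFun hyR ⟨w, hin⟩))
  · have h4 : pairing s ζ ζ' (wordElt ζ w) (upsilon ζ' y) = 0 := by
      clear hyR hyn hne hne' h3
      induction hy using Submodule.span_induction with
      | mem y hy =>
        obtain ⟨w', hw', rfl⟩ := hy
        exact hclosed' w' hw' w hi hin
      | zero => simp
      | add a b _ _ ha hb => rw [map_add, map_add, ha, hb, add_zero]
      | smul r a _ ha => rw [map_smul, map_smul, ha, smul_zero]
    rw [h4, zero_sub, neg_ne_zero, pairing_wordElt, hw] at hne'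
    exact hin (hreg L c w hL hw hi hne')

/-- An element that pairs trivially with the kernel of `upsilon` lies in the image of `upsilon`. -/
theorem mem_range_upsilon (s : ℤˣ) {ζ ζ' : ZetaDatum K I} (hd : IsDual ζ ζ')
    (R : BigShuffle ζ') (hR : ∀ x, upsilon ζ x = 0 → pairing s ζ ζ' x R = 0) :
    R ∈ (upsilon ζ').range := by
  classical
  rw [← DirectSum.sum_support_of R]
  exact Subalgebra.sum_mem _ fun n _ => exists_upsilon_component s hd R hR n

/-- The annihilator of the kernel of `upsilon` is the image of `upsilon`. -/
theorem mem_range_upsilon_iff (s : ℤˣ) {ζ ζ' : ZetaDatum K I} (hd : IsDual ζ ζ')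
    (R : BigShuffle ζ') :
    R ∈ (upsilon ζ').range ↔ ∀ x, upsilon ζ x = 0 → pairing s ζ ζ' x R = 0 := by
  refine ⟨?_, mem_range_upsilon s hd R⟩
  rintro ⟨y, rfl⟩ x hx
  refine (pairing_symm s hd x y).trans ?_
  rw [hx, map_zero]

lemma range_upsilon (ζ : ZetaDatum K I) :
    (upsilon ζ).range = Algebra.adjoin K (Set.range fun p : I × ℤ => zgen ζ p.1 p.2) := by
  refine le_antisymm ?_ (Algebra.adjoin_le ?_)
  · rintro _ ⟨x, rfl⟩
    refine quad_induction (p := fun x => upsilon ζ x ∈ Algebra.adjoin K _) x ?_ (fun w => ?_)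
      (fun a b ha hb => ?_) fun r a ha => ?_
    · rw [map_zero]
      exact Subalgebra.zero_mem _
    · rw [wordElt, map_list_prod]
      refine Subalgebra.list_prod_mem _ fun y hy => ?_
      rw [List.map_map, List.mem_map] at hy
      obtain ⟨p, -, rfl⟩ := hy
      refine Algebra.subset_adjoin ⟨p, ?_⟩
      exact (upsilon_gen ζ p.1 p.2).symm
    · rw [map_add]
      exact Subalgebra.add_mem _ ha hb
    · rw [map_smul]
      exact Subalgebra.smul_mem _ ha r
  · rintro _ ⟨p, rfl⟩
    exact ⟨QuadAlg.gen ζ p.1 p.2, upsilon_gen ζ p.1 p.2⟩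

end Duality

/-! ### The reduced algebra and its pairings -/

section Reduced

variable {K I : Type*} [Field K] [CharZero K] [Fintype I] [DecidableEq I]

/-- The isomorphism from the reduced algebra to the image of `upsilon`. -/
noncomputable def loopAlgEquiv (ζ : ZetaDatum K I) :
    LoopAlg ζ ≃ₗ[K] Subalgebra.toSubmodule (upsilon ζ).range :=
  (Ideal.quotientKerEquivRange (upsilon ζ)).toLinearEquiv

/-- The pairing with a space of elements that pair trivially with the kernel of `upsilon`, on the
reduced algebra. -/
noncomputable def reducedPairing (s : ℤˣ) (ζ : ZetaDatum K I) {ζ' : ZetaDatum K I}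
    (S : Submodule K (BigShuffle ζ'))
    (hS : ∀ R ∈ S, ∀ x, upsilon ζ x = 0 → pairing s ζ ζ' x R = 0) : LoopAlg ζ →ₗ[K] S →ₗ[K] K :=
  ((RingHom.ker (upsilon ζ)).restrictScalars K).liftQ ((pairing s ζ ζ').domRestrict₂ S)
    fun x hx => LinearMap.ext fun R => hS R R.2 x hx

lemma reducedPairing_nondegenerate (s : ℤˣ) {ζ ζ' : ZetaDatum K I} (hd : IsDual ζ ζ')
    (S : Submodule K (BigShuffle ζ'))
    (hS : ∀ R ∈ S, ∀ x, upsilon ζ x = 0 → pairing s ζ ζ' x R = 0)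
    (hS' : ∀ y, upsilon ζ' y ∈ S) : (reducedPairing s ζ S hS).Nondegenerate := by
  constructor
  · intro u hu
    obtain ⟨x, rfl⟩ := Ideal.Quotient.mk_surjective u
    refine Ideal.Quotient.eq_zero_iff_mem.mpr ?_
    refine eq_zero_of_pairing (-s) ζ' fun y => ?_
    rw [← pairing_symm s hd]
    exact hu ⟨upsilon ζ' y, hS' y⟩
  · intro R hR
    exact Subtype.ext (eq_zero_of_pairing s ζ fun x => hR (LoopAlg.mk ζ x))

end Reduced

end ShuffleAlgebra

theorem mainTheorem1 {K I : Type*} [Field K] [CharZero K] [Fintype I] [DecidableEq I]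
    (ζ : ShuffleAlgebra.ZetaDatum K I) :
    -- the shuffle algebras are the images of `Υ̃⁺` and `Υ̃⁻`
    ShuffleAlgebra.shufflePlus ζ = Subalgebra.toSubmodule (ShuffleAlgebra.upsilon ζ).range ∧
    ShuffleAlgebra.shuffleMinus ζ = Subalgebra.toSubmodule (ShuffleAlgebra.upsilon ζ.op).range ∧
    -- these images are the subalgebras generated by the `z_{i1}^d`
    (ShuffleAlgebra.upsilon ζ).range = Algebra.adjoin K
      (Set.range fun p : I × ℤ => ShuffleAlgebra.zgen ζ p.1 p.2) ∧
    (ShuffleAlgebra.upsilon ζ.op).range = Algebra.adjoin K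
      (Set.range fun p : I × ℤ => ShuffleAlgebra.zgen ζ.op p.1 p.2) ∧
    -- the isomorphisms `U⁺ ≅ 𝒮⁺` and `U⁻ ≅ 𝒮⁻`
    ∃ (Φp : ShuffleAlgebra.LoopAlg ζ ≃ₗ[K] ShuffleAlgebra.shufflePlus ζ)
      (Φm : ShuffleAlgebra.LoopAlg ζ.op ≃ₗ[K] ShuffleAlgebra.shuffleMinus ζ),
      (∀ x, (Φp (ShuffleAlgebra.LoopAlg.mk ζ x) : ShuffleAlgebra.BigShuffle ζ) =
        ShuffleAlgebra.upsilon ζ x) ∧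
      (∀ y, (Φm (ShuffleAlgebra.LoopAlg.mk ζ.op y) : ShuffleAlgebra.BigShuffle ζ.op) =
        ShuffleAlgebra.upsilon ζ.op y) ∧
      (Φp 1 : ShuffleAlgebra.BigShuffle ζ) = 1 ∧
      (Φm 1 : ShuffleAlgebra.BigShuffle ζ.op) = 1 ∧
      (∀ u v, (Φp (u * v) : ShuffleAlgebra.BigShuffle ζ) = Φp u * Φp v) ∧
      (∀ u v, (Φm (u * v) : ShuffleAlgebra.BigShuffle ζ.op) = Φm u * Φm v) ∧
      -- the induced pairings `U⁺ ⊗ 𝒮⁻ → K` and `𝒮⁺ ⊗ U⁻ → K`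
      ∃ (Bp : ShuffleAlgebra.LoopAlg ζ →ₗ[K] ShuffleAlgebra.shuffleMinus ζ →ₗ[K] K)
        (Bm : ShuffleAlgebra.shufflePlus ζ →ₗ[K] ShuffleAlgebra.LoopAlg ζ.op →ₗ[K] K),
        (∀ x R, Bp (ShuffleAlgebra.LoopAlg.mk ζ x) R = ShuffleAlgebra.pairPlus ζ x R) ∧
        (∀ R y, Bm R (ShuffleAlgebra.LoopAlg.mk ζ.op y) = ShuffleAlgebra.pairMinus ζ R y) ∧
        Bp.Nondegenerate ∧ Bm.Nondegenerate ∧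
        -- they coincide under the isomorphisms
        ∀ u v, Bp u (Φm v) = Bm (Φp u) v := by
  have hd := ShuffleAlgebra.isDual_op ζ
  have hSp : ShuffleAlgebra.shufflePlus ζ =
      Subalgebra.toSubmodule (ShuffleAlgebra.upsilon ζ).range := by
    ext R
    exact (ShuffleAlgebra.mem_range_upsilon_iff 1 hd.symm R).symm
  have hSm : ShuffleAlgebra.shuffleMinus ζ =
      Subalgebra.toSubmodule (ShuffleAlgebra.upsilon ζ.op).range := by
    ext R
    exact (ShuffleAlgebra.mem_range_upsilon_iff (-1) hd R).symm
  refine ⟨hSp, hSm, ShuffleAlgebra.range_upsilon ζ, ShuffleAlgebra.range_upsilon ζ.op,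
    (ShuffleAlgebra.loopAlgEquiv ζ).trans (LinearEquiv.ofEq _ _ hSp.symm),
    (ShuffleAlgebra.loopAlgEquiv ζ.op).trans (LinearEquiv.ofEq _ _ hSm.symm),
    fun x => rfl, fun y => rfl, ?_, ?_, fun u v => ?_, fun u v => ?_,
    ShuffleAlgebra.reducedPairing (-1) ζ (ShuffleAlgebra.shuffleMinus ζ) fun _ hR => hR,
    (ShuffleAlgebra.reducedPairing 1 ζ.op (ShuffleAlgebra.shufflePlus ζ) fun _ hR => hR).flip,
    fun x R => rfl, fun R y => rfl, ?_, ?_, fun u v => ?_⟩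
  · exact map_one (ShuffleAlgebra.upsilon ζ)
  · exact map_one (ShuffleAlgebra.upsilon ζ.op)
  · obtain ⟨x, rfl⟩ := Ideal.Quotient.mk_surjective u
    obtain ⟨y, rfl⟩ := Ideal.Quotient.mk_surjective v
    exact map_mul (ShuffleAlgebra.upsilon ζ) x y
  · obtain ⟨x, rfl⟩ := Ideal.Quotient.mk_surjective u
    obtain ⟨y, rfl⟩ := Ideal.Quotient.mk_surjective v
    exact map_mul (ShuffleAlgebra.upsilon ζ.op) x y
  · refine ShuffleAlgebra.reducedPairing_nondegenerate (-1) hd _ _ fun y => ?_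
    rw [hSm]
    exact ⟨y, rfl⟩
  · refine LinearMap.flip_nondegenerate.mpr ?_
    refine ShuffleAlgebra.reducedPairing_nondegenerate 1 hd.symm _ _ fun y => ?_
    rw [hSp]
    exact ⟨y, rfl⟩
  · obtain ⟨x, rfl⟩ := Ideal.Quotient.mk_surjective u
    obtain ⟨y, rfl⟩ := Ideal.Quotient.mk_surjective v
    have h := ShuffleAlgebra.pairing_symm (-1) hd x y
    rw [neg_neg] at h
    exact h
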